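/- **Setting.** Let $n\ge 1$. Cubes in $\mathbb R^n$ have sides parallel to the axes and positive sidelength. A *weight* is a nonnegative locally integrable function $w$ on $\mathbb R^n$ with $w>0$ a.e.; put $w(E)=\int_E w\,dx$ and $\|f\|_{L^r_w}=(\int |f|^r w\,dx)^{1/r}$. For $1<r<\infty$, $w\in A_r^{loc}$ if $$\sup_{|Q|\le 1}|Q|^{-r}\int_Q w\,dx\Big(\int_Q w^{-1/(r-1)}dx\Big)^{r-1}<\infty ,$$ and $w\in A_1^{loc}$ if $\sup_{|Q|\le1}|Q|^{-1}\int_Q w\,dx\cdot\operatorname{ess\,sup}_Q w^{-1}<\infty$. Let $A_\infty^{loc}=\bigcup_{1\le r<\infty}A_r^{loc}$ and $q_w=\inf\{r\in[1,\infty): w\in A_r^{loc}\}$. For $N\in\mathbb N_0$ and a distribution $f\in\mathcal D'(\mathbb R^n)$ let $$\mathcal M^0_Nf(x)=\sup|\varphi_t*f(x)|,\qquad \varphi_t=t^{-n}\varphi(\cdot/t),$$ the supremum being over $0<t<1$ and all $\varphi\in C_c^\infty(\mathbb R^n;\mathbb R)$ with $\operatorname{supp}\varphi\subset B(0,1)$,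 $\int\varphi\ne0$ and $\|\partial^\alpha\varphi\|_\infty\le 1$ for $|\alpha|\le N+1$. For $0<p\le1$ and $N\ge N_{p,w}:=\max\{0,\lfloor n(q_w/p-1)\rfloor\}+2$ put $\|f\|_{h^p_{w,N}}=\|\mathcal M^0_Nf\|_{L^p_w}$; $h^p_w=h^p_{w,N}$ is the space of distributions for which this is finite. A measurable $a:\mathbb R^n\to\mathbb C$ is a *$(p,q,s)_w$-atom* if there is a cube $Q$ with $\operatorname{supp}a\subset Q$, $\|a\|_{L^q_w}\le w(Q)^{1/q-1/p}$ and, if $|Q|<1$, $\int a(x)x^\alpha dx=0$ for all $|\alpha|\le s$; it has *sidelength $\le 2$* if $Q$ can be chosen so. It is a *$(p,q)_w$ single atom* if $\|a\|_{L^q_w}\le w(\mathbb R^n)^{1/q-1/p}$ (so $a=0$ a.e. when $w(\mathbb R^n)=\infty$ and $p<q$). Let $h^{p,q,s}_{w,fin}$ be the complex vector space of all finite linear combinations of $(p,q,s)_w$-atoms and single atoms (functions being identified with distributions), and $$\|f\|_{h^{p,q,s}_{w,fin}}=\inf\Big\{\Big(\sum_{j=0}^k|\lambda_j|^p\Big)^{1/p}\Big\},$$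 the infimum being over all $k\in\mathbb N_0$, $\lambda_j\in\mathbb C$ and representations $f=\sum_{j=0}^k\lambda_ja_j$ in which $a_0$ is a $(p,q)_w$ single atom and $a_1,\dots,a_k$ are $(p,q,s)_w$-atoms with sidelength $\le2$. **Theorem 6.1.** Let $w\in A_\infty^{loc}$, $p\in(0,1]$, $q\in(q_w,\infty)$, $s\in\mathbb N_0$ with $s\ge\lfloor n(q_w/p-1)\rfloor$, and $N\ge N_{p,w}$. Then $\|\cdot\|_{h^{p,q,s}_{w,fin}}$ and $\|\cdot\|_{h^p_{w,N}}$ are equivalent quasi-norms on $h^{p,q,s}_{w,fin}$: both are finite-valued quasi-norms there (vanishing only at $0$, absolutely homogeneous, satisfying a quasi-triangle inequality), and there is a constant $C>0$ depending only on $n,w,p,q,s,N$ such that for all $f\in h^{p,q,s}_{w,fin}$ $$C^{-1}\|f\|_{h^p_{w,N}}\le\|f\|_{h^{p,q,s}_{w,fin}}\le C\|f\|_{h^p_{w,N}}.$$ -/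

import Mathlib

open MeasureTheory TopologicalSpace
open scoped ENNReal NNReal

noncomputable section

namespace LocalHardy

/-- `ℝⁿ` with its Euclidean norm and Lebesgue measure. -/
abbrev E (n : ℕ) : Type := EuclideanSpace ℝ (Fin n)

/-- The space of (real) test functions on `ℝⁿ`. -/
abbrev Test (n : ℕ) : Type := TestFunction (⊤ : Opens (E n)) ℝ ⊤

/-- The space of complex-valued distributions on `ℝⁿ`. -/
abbrev Distr (n : ℕ) : Type := Distribution (⊤ : Opens (E n)) ℂ ⊤

/-- The closed cube with sides parallel to the axes, center `x` and sidelength `t`. -/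
def cube {n : ℕ} (x : E n) (t : ℝ) : Set (E n) := {y | ∀ i, |y i - x i| ≤ t / 2}

/-! ### Local weights -/

/-- A weight: a nonnegative locally integrable function, positive almost everywhere.
(In the presence of a local `A_p` condition, positivity only excludes the zero function.) -/
structure IsWeight {n : ℕ} (w : E n → ℝ) : Prop where
  nonneg : ∀ x, 0 ≤ w x
  pos_ae : ∀ᵐ x, 0 < w x
  locallyIntegrable : LocallyIntegrable w

/-- The local `A_p` constant for `1 < p`; note `p' / p = 1 / (p - 1)` and `p / p' = p - 1`. -/
def apLocConst {n : ℕ} (p : ℝ) (w : E n → ℝ) : ℝ≥0∞ :=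
  ⨆ (x : E n) (t : ℝ) (_ : 0 < t ∧ volume (cube x t) ≤ 1),
    volume (cube x t) ^ (-p) * (∫⁻ y in cube x t, ENNReal.ofReal (w y)) *
      (∫⁻ y in cube x t, ENNReal.ofReal (w y) ^ (-(1 / (p - 1)))) ^ (p - 1)

/-- The local `A_1` constant. -/
def a1LocConst {n : ℕ} (w : E n → ℝ) : ℝ≥0∞ :=
  ⨆ (x : E n) (t : ℝ) (_ : 0 < t ∧ volume (cube x t) ≤ 1),
    (volume (cube x t))⁻¹ * (∫⁻ y in cube x t, ENNReal.ofReal (w y)) *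
      essSup (fun y => (ENNReal.ofReal (w y))⁻¹) (volume.restrict (cube x t))

/-- The class `A_p^loc`, `1 ≤ p < ∞`. -/
def IsApLoc {n : ℕ} (p : ℝ) (w : E n → ℝ) : Prop :=
  IsWeight w ∧ ((p = 1 ∧ a1LocConst w < ∞) ∨ (1 < p ∧ apLocConst p w < ∞))

/-- The class `A_∞^loc`, the union of the classes `A_p^loc` over `1 ≤ p < ∞`. -/
def IsAInftyLoc {n : ℕ} (w : E n → ℝ) : Prop := ∃ p : ℝ, 1 ≤ p ∧ IsApLoc p w

/-- The critical index `q_w` of a local weight. -/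
def critIndex {n : ℕ} (w : E n → ℝ) : ℝ := sInf {p : ℝ | 1 ≤ p ∧ IsApLoc p w}

/-- The measure `w(x) dx`. -/
def wMeasure {n : ℕ} (w : E n → ℝ) : Measure (E n) :=
  volume.withDensity fun x => ENNReal.ofReal (w x)

/-! ### The grand maximal function and the local Hardy quasi-norm -/

/-- For `t > 0`, the test function `y ↦ φ_t(x - y)`, where `φ_t(z) = t⁻ⁿ φ(z / t)`. -/
def dilateAt {n : ℕ} (φ : Test n) (x : E n) (t : ℝ) (ht : 0 < t) : Test n where
  toFun y := (t ^ n)⁻¹ * φ (t⁻¹ • (x - y))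
  contDiff' := by
    have h : ContDiff ℝ ((⊤ : ℕ∞) : WithTop ℕ∞) (fun y : E n => φ (t⁻¹ • (x - y))) :=
      φ.contDiff.comp (by fun_prop)
    exact contDiff_const.mul h
  hasCompactSupport' := by
    have h : HasCompactSupport (fun y : E n => φ (t⁻¹ • (x - y))) :=
      φ.hasCompactSupport.comp_homeomorph
        ((Homeomorph.subLeft x).trans (Homeomorph.smulOfNeZero t⁻¹ (inv_ne_zero ht.ne')))
    exact h.mul_left
  tsupport_subset' := fun _ _ => trivial

/-- The convolution `(φ_t * T)(x)` of a distribution with a dilated test function. -/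
def convAt {n : ℕ} (T : Distr n) (φ : Test n) (t : ℝ) (ht : 0 < t) (x : E n) : ℂ :=
  T (dilateAt φ x t ht)

/-- The class `D_N^0`: test functions supported in the unit ball, with nonzero integral, all of
whose partial derivatives of order at most `N + 1` are bounded by `1`. The partial derivatives of
order `k` are the values of the `k`-th iterated derivative on `k` standard basis vectors. -/
def D0 (n N : ℕ) : Set (Test n) :=
  {φ | tsupport φ ⊆ Metric.ball (0 : E n) 1 ∧ ∫ x, φ x ≠ 0 ∧
    ∀ k : ℕ, k ≤ N + 1 → ∀ (i : Fin k → Fin n) (x : E n),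
      |iteratedFDeriv ℝ k φ x (fun j => EuclideanSpace.single (i j) (1 : ℝ))| ≤ 1}

/-- The local radial grand maximal function `M_N^0 T`. -/
def grandMax {n : ℕ} (N : ℕ) (T : Distr n) (x : E n) : ℝ≥0∞ :=
  ⨆ (φ ∈ D0 n N) (t : ℝ) (ht : 0 < t ∧ t < 1), ‖convAt T φ t ht.1 x‖ₑ

/-- The quasi-norm of `h^p_{w,N}`, the `L^p(w dx)` quasi-norm of `M_N^0 T`;
the space `h^p_{w,N}` consists of the distributions for which it is finite. -/
def hardyNorm {n : ℕ} (w : E n → ℝ) (p : ℝ) (N : ℕ) (T : Distr n) : ℝ≥0∞ :=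
  (∫⁻ x, grandMax N T x ^ p ∂(wMeasure w)) ^ (1 / p)

/-- The threshold `N_{p,w} = max {0, ⌊n (q_w / p - 1)⌋} + 2`. -/
def critOrder {n : ℕ} (w : E n → ℝ) (p : ℝ) : ℕ := ⌊(n : ℝ) * (critIndex w / p - 1)⌋₊ + 2

/-! ### Atoms and the finite atomic space -/

/-- The distribution `φ ↦ ∫ φ a` defined by a locally integrable function `a`. -/
def ofFun {n : ℕ} (a : E n → ℂ) : Distr n :=
  TestFunction.integralAgainstBilinCLM (ContinuousLinearMap.lsmul ℝ ℝ : ℝ →L[ℝ] ℂ →L[ℝ] ℂ)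
    volume a

/-- `a` is a `(p,q,s)_w`-atom with respect to the cube of center `x` and sidelength `t`. -/
structure IsAtomOn {n : ℕ} (w : E n → ℝ) (p q : ℝ) (s : ℕ) (x : E n) (t : ℝ)
    (a : E n → ℂ) : Prop where
  aestronglyMeasurable : AEStronglyMeasurable a volume
  support_subset : Function.support a ⊆ cube x t
  size : eLpNorm a (ENNReal.ofReal q) (wMeasure w) ≤ wMeasure w (cube x t) ^ (1 / q - 1 / p)
  moment : volume (cube x t) < 1 → ∀ α : Fin n → ℕ, ∑ i, α i ≤ s →
    ∫ y, a y * ((∏ i, y i ^ α i : ℝ) : ℂ) = 0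

/-- `a` is a `(p,q,s)_w`-atom. -/
def IsAtom {n : ℕ} (w : E n → ℝ) (p q : ℝ) (s : ℕ) (a : E n → ℂ) : Prop :=
  ∃ (x : E n) (t : ℝ), 0 < t ∧ IsAtomOn w p q s x t a

/-- `a` is a `(p,q,s)_w`-atom for some cube of sidelength at most `2`. -/
def IsSmallAtom {n : ℕ} (w : E n → ℝ) (p q : ℝ) (s : ℕ) (a : E n → ℂ) : Prop :=
  ∃ (x : E n) (t : ℝ), 0 < t ∧ t ≤ 2 ∧ IsAtomOn w p q s x t a

/-- `a` is a `(p,q)_w` single atom. If `w(ℝⁿ) = ∞`, the right-hand side of `size` is `0`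
(for `p < q`), so that `a` vanishes almost everywhere. -/
structure IsSingleAtom {n : ℕ} (w : E n → ℝ) (p q : ℝ) (a : E n → ℂ) : Prop where
  aestronglyMeasurable : AEStronglyMeasurable a volume
  size : eLpNorm a (ENNReal.ofReal q) (wMeasure w) ≤ wMeasure w Set.univ ^ (1 / q - 1 / p)

/-- The vector space `h^{p,q,s}_{w,fin}` of all finite linear combinations of
`(p,q,s)_w`-atoms and single atoms. -/
def finSpace {n : ℕ} (w : E n → ℝ) (p q : ℝ) (s : ℕ) : Submodule ℂ (Distr n) :=
  Submodule.span ℂ (ofFun '' {a | IsAtom w p q s a ∨ IsSingleAtom w p q a})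

/-- The finite atomic quasi-norm: the infimum of `(∑_{j=0}^k |c_j|^p)^{1/p}` over all
representations `T = ∑_{j=0}^k c_j a_j` with `a_0` a single atom and `a_1, …, a_k` atoms with
cubes of sidelength at most `2`. -/
def finNorm {n : ℕ} (w : E n → ℝ) (p q : ℝ) (s : ℕ) (T : Distr n) : ℝ≥0∞ :=
  sInf {r | ∃ (k : ℕ) (c : Fin (k + 1) → ℂ) (a : Fin (k + 1) → E n → ℂ),
    IsSingleAtom w p q (a 0) ∧ (∀ j, j ≠ 0 → IsSmallAtom w p q s (a j)) ∧
    T = ∑ j, c j • ofFun (a j) ∧ r = (∑ j, ‖c j‖ₑ ^ p) ^ (1 / p)}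

/-- `ν` restricts to a (finite-valued) quasi-norm on the complex vector space `V`. -/
structure IsQuasiNormOn {X : Type*} [AddCommGroup X] [Module ℂ X] (V : Submodule ℂ X)
    (ν : X → ℝ≥0∞) : Prop where
  lt_top : ∀ f ∈ V, ν f < ∞
  eq_zero_iff : ∀ f ∈ V, (ν f = 0 ↔ f = 0)
  smul : ∀ (c : ℂ), ∀ f ∈ V, ν (c • f) = ‖c‖ₑ * ν f
  add_le : ∃ K : ℝ≥0, 1 ≤ K ∧ ∀ f ∈ V, ∀ g ∈ V, ν (f + g) ≤ K * (ν f + ν g)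

end LocalHardy

end

noncomputable section

namespace LocalHardy

/-! ### Cubes -/

section Cube
variable {n : ℕ}

/-! Write `M f` for the grand maximal function. Both quasi-norms have subadditive `p`-th powers,
because `p ≤ 1`; this reduces everything to estimates on individual pieces.

Bounding the Hardy quasi-norm by the atomic one (`Admissible.exists_hardyNorm_le`) requires a
uniform bound of `∫ (M a)^p dw` over atoms and single atoms. Near the cube of an atom this is
Hölder's inequality, doubling and the boundedness of `M` on `L^q_w`, valid since `q > q_w`. Far from
the cube only cubes of side less than `1` matter; the moment conditions and Taylor's formula give a
decay `(l / |x - x₀|)^(n+m+1)`. Its `p`-th power is the `r`-th power of a minorant of the local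
maximal function of a multiple of the indicator of the cube, with `r = p(n+m+1)/n > q_w`.

The reverse bound (`Admissible.exists_finNorm_le`) is the substance. Elements of the finite space
are functions `f` in `L^q_w`. Let `P_j` be convolution with the dilate at scale `2⁻ʲ` of a mollifier
whose moments of orders `1, …, s` vanish. Then `P_{j+1}² - P_j² = (P_{j+1} - P_j)(P_{j+1} + P_j)`,
and the first factor has a kernel with vanishing moments, so that `(P_{j+1} + P_j) f` may be cut up
arbitrarily before that factor is applied. At a point `y` it is assigned to the height `k` for which
`y` has depth at least `A 2⁻ʲ` in `{M f > 2^k}` but not in `{M f > 2^(k+1)}`, and then divided by a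
partition of unity of Whitney type in `{M f > 2^k}`. A nearby point with `M f ≤ 2^(k+1)` bounds the
selected part by `C 2^(k+1)`. For a fixed cube the sum over `j` telescopes up to commutators and two
boundary scales, hence is at most `K 2^k` however many layers are taken
(`IsMollifier.norm_sum_piece_le`). Bounded overlap gives `∑ 2^(kp) w(Q) ≲ ∫ (M f)^p dw`. The coarse
term `P_{J₀}² f` is cut along a lattice into pieces on unit cubes, which carry no moment condition.

These sums are infinite, whereas the finite atomic quasi-norm admits only finite ones. The
remainders tend to zero in `L^q_w` and live on a fixed set, on which the atomic quasi-norm is at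
most a constant times the `L^q_w` norm. This constant is not controlled, but it multiplies a
quantity tending to zero and leaves no trace in the limit (`Admissible.finNorm_rpow_le_tsum`). -/

lemma cube_eq_preimage (x : E n) (t : ℝ) :
    cube x t = (MeasurableEquiv.toLp 2 (Fin n → ℝ)).symm ⁻¹'
      Set.Icc (fun i => x i - t / 2) (fun i => x i + t / 2) := by
  ext y
  simp only [cube, Set.mem_ofPred_eq, Set.mem_preimage, Set.mem_Icc, Pi.le_def, abs_le,
    ← forall_and]
  refine forall_congr' fun i => ?_
  change _ ↔ x i - t / 2 ≤ y i ∧ y i ≤ x i + t / 2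
  constructor <;> rintro ⟨h1, h2⟩ <;> constructor <;> linarith

lemma measurableSet_cube (x : E n) (t : ℝ) : MeasurableSet (cube x t) := by
  rw [cube_eq_preimage]
  exact (MeasurableEquiv.measurable _) measurableSet_Icc

lemma volume_cube (x : E n) {t : ℝ} (ht : 0 ≤ t) :
    volume (cube x t) = ENNReal.ofReal (t ^ n) := by
  rw [cube_eq_preimage, (EuclideanSpace.volume_preserving_symm_measurableEquiv_toLp
    (Fin n)).measure_preimage measurableSet_Icc.nullMeasurableSet, Real.volume_Icc_pi]
  have : ∀ i : Fin n, x i + t / 2 - (x i - t / 2) = t := fun i => by ring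
  simp [this, ENNReal.ofReal_pow ht]

lemma volume_cube_pos (x : E n) {t : ℝ} (ht : 0 < t) : 0 < volume (cube x t) := by
  rw [volume_cube x ht.le]; simpa using pow_pos ht n

lemma volume_cube_lt_top (x : E n) {t : ℝ} (ht : 0 ≤ t) : volume (cube x t) < ∞ := by
  rw [volume_cube x ht]; simp

lemma volume_cube_le_one (x : E n) {t : ℝ} (ht : 0 ≤ t) (h1 : t ≤ 1) :
    volume (cube x t) ≤ 1 := by
  rw [volume_cube x ht]; simpa using pow_le_one₀ ht h1

lemma volume_cube_lt_one_iff (hn : 1 ≤ n) (x : E n) {t : ℝ} (ht : 0 ≤ t) :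
    volume (cube x t) < 1 ↔ t < 1 := by
  rw [volume_cube x ht, ENNReal.ofReal_lt_one]
  exact pow_lt_one_iff_of_nonneg ht (by omega)

lemma self_mem_cube (x : E n) {t : ℝ} (ht : 0 ≤ t) : x ∈ cube x t := by
  intro i; simp; linarith

lemma cube_subset_cube {x y : E n} {t u : ℝ} (h : ∀ i, |y i - x i| + t / 2 ≤ u / 2) :
    cube y t ⊆ cube x u := by
  intro z hz i
  have h1 := hz i
  have h2 := abs_sub_le (z i) (y i) (x i)
  linarith [h i]

lemma abs_apply_le_norm (x : E n) (i : Fin n) : |x i| ≤ ‖x‖ := by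
  simpa using PiLp.norm_apply_le x i

lemma norm_le_of_abs_le (x : E n) {r : ℝ} (hr : 0 ≤ r) (h : ∀ i, |x i| ≤ r) : ‖x‖ ≤ n * r := by
  rw [EuclideanSpace.norm_eq]
  apply Real.sqrt_le_iff.mpr
  refine ⟨by positivity, ?_⟩
  calc ∑ i, ‖x i‖ ^ 2 ≤ ∑ _i : Fin n, r ^ 2 := by
        gcongr with i; simpa using h i
    _ = n * r ^ 2 := by simp
    _ ≤ (n * r) ^ 2 := by
        rw [mul_pow]
        gcongr
        rcases n with _ | n
        · simp
        · have : (1 : ℝ) ≤ ((n + 1 : ℕ) : ℝ) := by push_cast; linarith [n.cast_nonneg (α := ℝ)]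
          nlinarith

lemma ball_subset_cube (x : E n) {t : ℝ} : Metric.ball x t ⊆ cube x (2 * t) := by
  intro y hy i
  have := abs_apply_le_norm (y - x) i
  rw [Metric.mem_ball, dist_eq_norm] at hy
  simp at this
  linarith

lemma cube_subset_closedBall (x : E n) {t : ℝ} (ht : 0 ≤ t) :
    cube x t ⊆ Metric.closedBall x (n * (t / 2)) := by
  intro y hy
  rw [mem_closedBall_iff_norm]
  exact norm_le_of_abs_le _ (by positivity) (fun i => by simpa using hy i)

lemma isClosed_cube (x : E n) (t : ℝ) : IsClosed (cube x t) := by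
  have : cube x t = ⋂ i, {y : E n | |y i - x i| ≤ t / 2} := by ext; simp [cube]
  rw [this]
  exact isClosed_iInter fun i => isClosed_le (by fun_prop) continuous_const

lemma isCompact_cube (x : E n) {t : ℝ} (ht : 0 ≤ t) : IsCompact (cube x t) :=
  (isCompact_closedBall x _).of_isClosed_subset (isClosed_cube x t) (cube_subset_closedBall x ht)

end Cube

/-! ### Weighted measures -/

section Weight
variable {n : ℕ} {w : E n → ℝ}

lemma IsWeight.aemeasurable (hw : IsWeight w) :
    AEMeasurable (fun x => ENNReal.ofReal (w x)) volume :=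
  hw.locallyIntegrable.aestronglyMeasurable.aemeasurable.ennreal_ofReal

lemma IsWeight.ofReal_ne_zero (hw : IsWeight w) : ∀ᵐ x, ENNReal.ofReal (w x) ≠ 0 := by
  filter_upwards [hw.pos_ae] with x hx
  simpa using hx

lemma wMeasure_absolutelyContinuous : wMeasure w ≪ volume := withDensity_absolutelyContinuous _ _

lemma IsWeight.volume_absolutelyContinuous (hw : IsWeight w) : volume ≪ wMeasure w :=
  withDensity_absolutelyContinuous' hw.aemeasurable hw.ofReal_ne_zero

lemma wMeasure_apply (s : Set (E n)) : wMeasure w s = ∫⁻ y in s, ENNReal.ofReal (w y) :=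
  withDensity_apply' _ s

lemma IsWeight.lintegral_wMeasure_restrict (hw : IsWeight w) {s : Set (E n)}
    (hs : MeasurableSet s) {f : E n → ℝ≥0∞} (hf : AEMeasurable f volume) :
    ∫⁻ y in s, f y ∂(wMeasure w) = ∫⁻ y in s, f y * ENNReal.ofReal (w y) := by
  rw [wMeasure, restrict_withDensity hs,
    lintegral_withDensity_eq_lintegral_mul₀ hw.aemeasurable.restrict hf.restrict]
  simp [mul_comm]

lemma IsWeight.wMeasure_cube_pos (hw : IsWeight w) (x : E n) {t : ℝ} (ht : 0 < t) :
    0 < wMeasure w (cube x t) := by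
  rw [pos_iff_ne_zero]
  intro h
  exact (volume_cube_pos x ht).ne' (hw.volume_absolutelyContinuous h)

lemma IsWeight.wMeasure_compact_lt_top (hw : IsWeight w) {K : Set (E n)} (hK : IsCompact K) :
    wMeasure w K < ∞ := by
  rw [wMeasure_apply]
  have := (hw.locallyIntegrable.integrableOn_isCompact hK).2
  refine lt_of_eq_of_lt ?_ this
  refine lintegral_congr fun y => ?_
  rw [Real.enorm_eq_ofReal (hw.nonneg y)]

lemma IsWeight.wMeasure_cube_lt_top (hw : IsWeight w) (x : E n) {t : ℝ} (ht : 0 ≤ t) :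
    wMeasure w (cube x t) < ∞ :=
  hw.wMeasure_compact_lt_top (isCompact_cube x ht)

end Weight

/-- Hölder's inequality against the constant function `1`. -/
lemma rpow_lintegral_le {α : Type*} [MeasurableSpace α] {μ : Measure α} {g : α → ℝ≥0∞}
    (hg : AEMeasurable g μ) {θ : ℝ} (hθ : 1 ≤ θ) :
    (∫⁻ x, g x ∂μ) ^ θ ≤ μ Set.univ ^ (θ - 1) * ∫⁻ x, g x ^ θ ∂μ := by
  rcases hθ.eq_or_lt with rfl | hθ
  · simp
  have hc : θ.HolderConjugate (Real.conjExponent θ) := Real.HolderConjugate.conjExponent hθ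
  have h := ENNReal.lintegral_mul_le_Lp_mul_Lq μ hc hg (aemeasurable_const (b := (1 : ℝ≥0∞)))
  have h2 := ENNReal.rpow_le_rpow h (by linarith : (0 : ℝ) ≤ θ)
  simp only [Pi.mul_apply, mul_one, ENNReal.one_rpow, lintegral_one] at h2
  refine h2.trans (le_of_eq ?_)
  rw [ENNReal.mul_rpow_of_nonneg _ _ (by linarith), ← ENNReal.rpow_mul, ← ENNReal.rpow_mul,
    one_div_mul_cancel (by linarith), ENNReal.rpow_one, mul_comm]
  congr 2
  rw [Real.conjExponent]; field_simp

/-! ### The averaging inequality equivalent to the local `A_r` condition -/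

/-- `|⨍_Q f|^r ≤ C ⨍_Q |f|^r dw` for all cubes of sidelength at most `T`. -/
def AvgBound {n : ℕ} (w : E n → ℝ) (r T : ℝ) (C : ℝ≥0) : Prop :=
  ∀ (x : E n) (t : ℝ), 0 < t → t ≤ T → ∀ f : E n → ℝ≥0∞, AEMeasurable f volume →
    wMeasure w (cube x t) * (∫⁻ y in cube x t, f y) ^ r ≤
      C * volume (cube x t) ^ r * ∫⁻ y in cube x t, f y ^ r ∂(wMeasure w)

section Avg
variable {n : ℕ} {w : E n → ℝ}

/-- Hölder's inequality for the factorization `f = (f w^(1/r)) · w^(-1/r)`: the second factor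
produces exactly the dual integral in the `A_r` constant. -/
lemma avgBound_of_apLocConst (hw : IsWeight w) {r : ℝ} (hr : 1 < r) (h : apLocConst r w < ∞) :
    AvgBound w r 1 (apLocConst r w).toNNReal := by
  intro x t ht ht1 f hf
  have hr0 : 0 < r := by linarith
  rw [ENNReal.coe_toNNReal h.ne]
  set Q := cube x t with hQ
  have hV0 := (volume_cube_pos x ht).ne'
  have hV := (volume_cube_lt_top x ht.le).ne
  have hA : volume Q ^ (-r) * (∫⁻ y in Q, ENNReal.ofReal (w y)) *
      (∫⁻ y in Q, ENNReal.ofReal (w y) ^ (-(1 / (r - 1)))) ^ (r - 1) ≤ apLocConst r w := by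
    unfold apLocConst
    exact le_iSup₂_of_le x t (le_iSup_of_le ⟨ht, volume_cube_le_one x ht.le ht1⟩ le_rfl)
  rw [hw.lintegral_wMeasure_restrict (measurableSet_cube x t) (hf.pow_const r), wMeasure_apply]
  have hc : r.HolderConjugate (Real.conjExponent r) := Real.HolderConjugate.conjExponent hr
  have hH := ENNReal.lintegral_mul_le_Lp_mul_Lq (volume.restrict Q) hc
    (f := fun y => f y * ENNReal.ofReal (w y) ^ (1 / r))
    (g := fun y => ENNReal.ofReal (w y) ^ (-(1 / r)))
    (hf.mul (hw.aemeasurable.pow_const _)).restrict (hw.aemeasurable.pow_const _).restrict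
  have h1 : ∫⁻ y in Q, ((fun y => f y * ENNReal.ofReal (w y) ^ (1 / r)) *
      (fun y => ENNReal.ofReal (w y) ^ (-(1 / r)))) y = ∫⁻ y in Q, f y := by
    refine lintegral_congr_ae (ae_restrict_of_ae ?_)
    filter_upwards [hw.ofReal_ne_zero] with y hy
    simp only [Pi.mul_apply]
    rw [mul_assoc, ← ENNReal.rpow_add _ _ hy ENNReal.ofReal_ne_top]
    simp
  have h2 : ∀ y, (f y * ENNReal.ofReal (w y) ^ (1 / r)) ^ r = f y ^ r * ENNReal.ofReal (w y) := by
    intro y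
    rw [ENNReal.mul_rpow_of_nonneg _ _ hr0.le, ← ENNReal.rpow_mul, one_div_mul_cancel hr0.ne',
      ENNReal.rpow_one]
  have h3 : ∀ y, (ENNReal.ofReal (w y) ^ (-(1 / r))) ^ (Real.conjExponent r) =
      ENNReal.ofReal (w y) ^ (-(1 / (r - 1))) := by
    intro y
    rw [← ENNReal.rpow_mul]
    congr 1
    rw [Real.conjExponent]
    have : r - 1 ≠ 0 := by linarith
    field_simp
  simp_rw [h1, h2, h3] at hH
  have h4 := ENNReal.rpow_le_rpow hH hr0.le
  rw [ENNReal.mul_rpow_of_nonneg _ _ hr0.le, ← ENNReal.rpow_mul, ← ENNReal.rpow_mul,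
    one_div_mul_cancel hr0.ne', ENNReal.rpow_one] at h4
  have h5 : 1 / Real.conjExponent r * r = r - 1 := by
    rw [Real.conjExponent]
    have : r - 1 ≠ 0 := by linarith
    field_simp
  rw [h5] at h4
  set I := ∫⁻ y in Q, ENNReal.ofReal (w y) ^ (-(1 / (r - 1)))
  set W := ∫⁻ y in Q, ENNReal.ofReal (w y)
  have h6 : W * I ^ (r - 1) ≤ apLocConst r w * volume Q ^ r := by
    calc W * I ^ (r - 1) = volume Q ^ r * (volume Q ^ (-r) * W * I ^ (r - 1)) := by
          rw [mul_assoc, ← mul_assoc, ← ENNReal.rpow_add _ _ hV0 hV]; simp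
      _ ≤ volume Q ^ r * apLocConst r w := by gcongr
      _ = _ := mul_comm _ _
  calc W * (∫⁻ y in Q, f y) ^ r
      ≤ W * ((∫⁻ y in Q, f y ^ r * ENNReal.ofReal (w y)) * I ^ (r - 1)) := by gcongr
    _ = (W * I ^ (r - 1)) * ∫⁻ y in Q, f y ^ r * ENNReal.ofReal (w y) := by ring
    _ ≤ _ := by gcongr

/-- Insert `1 = w⁻¹ w` in the integral of `f` and bound `w⁻¹` by its essential supremum. -/
lemma avgBound_of_a1LocConst (hw : IsWeight w) (h : a1LocConst w < ∞) :
    AvgBound w 1 1 (a1LocConst w).toNNReal := by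
  intro x t ht ht1 f hf
  rw [ENNReal.coe_toNNReal h.ne]
  set Q := cube x t with hQ
  have hV0 := (volume_cube_pos x ht).ne'
  have hV := (volume_cube_lt_top x ht.le).ne
  set M := essSup (fun y => (ENNReal.ofReal (w y))⁻¹) (volume.restrict Q)
  have hA : (volume Q)⁻¹ * (∫⁻ y in Q, ENNReal.ofReal (w y)) * M ≤ a1LocConst w := by
    unfold a1LocConst
    exact le_iSup₂_of_le x t (le_iSup_of_le ⟨ht, volume_cube_le_one x ht.le ht1⟩ le_rfl)
  simp only [ENNReal.rpow_one]
  rw [hw.lintegral_wMeasure_restrict (measurableSet_cube x t) hf, wMeasure_apply]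
  set W := ∫⁻ y in Q, ENNReal.ofReal (w y)
  have h1 : ∫⁻ y in Q, f y ≤ M * ∫⁻ y in Q, f y * ENNReal.ofReal (w y) := by
    rw [← lintegral_const_mul'' (f := fun y => f y * ENNReal.ofReal (w y)) _
      (hf.mul hw.aemeasurable).restrict]
    refine lintegral_mono_ae ?_
    filter_upwards [ENNReal.ae_le_essSup (μ := volume.restrict Q)
      (fun y => (ENNReal.ofReal (w y))⁻¹), ae_restrict_of_ae hw.ofReal_ne_zero] with y hy hy0
    calc f y = (ENNReal.ofReal (w y))⁻¹ * (f y * ENNReal.ofReal (w y)) := by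
          rw [mul_comm, mul_assoc, ENNReal.mul_inv_cancel hy0 ENNReal.ofReal_ne_top, mul_one]
      _ ≤ _ := by gcongr
  have h6 : W * M ≤ a1LocConst w * volume Q := by
    calc W * M = volume Q * ((volume Q)⁻¹ * W * M) := by
          rw [mul_assoc, ← mul_assoc, ENNReal.mul_inv_cancel hV0 hV, one_mul]
      _ ≤ volume Q * a1LocConst w := by gcongr
      _ = _ := mul_comm _ _
  calc W * (∫⁻ y in Q, f y)
      ≤ W * (M * ∫⁻ y in Q, f y * ENNReal.ofReal (w y)) := by gcongr
    _ = (W * M) * ∫⁻ y in Q, f y * ENNReal.ofReal (w y) := by ring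
    _ ≤ _ := by gcongr

/-- Raise the inequality to the power `r' / r` and apply Jensen's inequality on the cube with
respect to `w dx`; the excess power of `w(Q)` cancels. -/
lemma AvgBound.mono_exponent (hw : IsWeight w) {r r' T : ℝ} {C : ℝ≥0} (h : AvgBound w r T C)
    (hr : 1 ≤ r) (hrr : r ≤ r') : AvgBound w r' T (C ^ (r' / r)) := by
  intro x t ht htT f hf
  have hr0 : 0 < r := by linarith
  have hθ : 1 ≤ r' / r := by rwa [one_le_div hr0]
  have hθ0 : 0 ≤ r' / r := by linarith
  have hrθ : r * (r' / r) = r' := by field_simp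
  have h1 := ENNReal.rpow_le_rpow (h x t ht htT f hf) hθ0
  set W := wMeasure w (cube x t)
  have hW0 : W ≠ 0 := (hw.wMeasure_cube_pos x ht).ne'
  have hWt : W ≠ ∞ := (hw.wMeasure_cube_lt_top x ht.le).ne
  rw [ENNReal.mul_rpow_of_nonneg _ _ hθ0, ENNReal.mul_rpow_of_nonneg _ _ hθ0,
    ENNReal.mul_rpow_of_nonneg _ _ hθ0, ← ENNReal.rpow_mul, ← ENNReal.rpow_mul, hrθ] at h1
  have h2 := rpow_lintegral_le (μ := (wMeasure w).restrict (cube x t)) (g := fun y => f y ^ r)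
    ((hf.pow_const r).mono_ac (Measure.absolutelyContinuous_of_le Measure.restrict_le_self |>.trans
      wMeasure_absolutelyContinuous)) hθ
  simp_rw [← ENNReal.rpow_mul, hrθ, Measure.restrict_apply_univ] at h2
  have h3 : W ^ (r' / r) = W ^ (r' / r - 1) * W := by
    rw [← ENNReal.rpow_one (W), ← ENNReal.rpow_mul, ← ENNReal.rpow_mul,
      ← ENNReal.rpow_add _ _ hW0 hWt]; ring_nf
  have hW1 : W ^ (r' / r - 1) ≠ 0 := by simp [ENNReal.rpow_eq_zero_iff, hW0, hWt]
  have hW2 : W ^ (r' / r - 1) ≠ ∞ := by simp [ENNReal.rpow_eq_top_iff, hW0, hWt]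
  rw [← ENNReal.mul_le_mul_iff_right hW1 hW2, ← mul_assoc, ← h3]
  refine h1.trans ?_
  rw [ENNReal.coe_rpow_of_nonneg _ hθ0]
  calc _ ≤ (C : ℝ≥0∞) ^ (r' / r) * volume (cube x t) ^ r' *
        (W ^ (r' / r - 1) * ∫⁻ y in cube x t, f y ^ r' ∂(wMeasure w)) := by gcongr
    _ = _ := by ring

lemma IsAInftyLoc.isWeight (hw : IsAInftyLoc w) : IsWeight w := by
  obtain ⟨p, -, h⟩ := hw; exact h.1

lemma IsAInftyLoc.one_le_critIndex (hw : IsAInftyLoc w) : 1 ≤ critIndex w :=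
  le_csInf hw fun _ h => h.1

/-- Some exponent below `r` belongs to the set whose infimum is `critIndex w`, and the averaging
inequality passes to larger exponents. -/
lemma IsAInftyLoc.exists_avgBound_one (hw : IsAInftyLoc w) {r : ℝ} (hr : critIndex w < r) :
    ∃ C, AvgBound w r 1 C := by
  obtain ⟨r₀, ⟨h1, h2⟩, h3⟩ := exists_lt_of_csInf_lt hw hr
  rcases h2.2 with ⟨rfl, h⟩ | ⟨h4, h⟩
  · exact ⟨_, (avgBound_of_a1LocConst h2.1 h).mono_exponent h2.1 le_rfl h3.le⟩
  · exact ⟨_, (avgBound_of_apLocConst h2.1 h4 h).mono_exponent h2.1 h1 h3.le⟩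

end Avg

/-! ### Larger cubes and local doubling -/

section Extend
variable {n : ℕ} {w : E n → ℝ}

/-- The averaging inequality tested on an indicator function. -/
lemma AvgBound.measure_le {r T : ℝ} {C : ℝ≥0} (h : AvgBound w r T C) (hr : 0 < r)
    {x : E n} {t : ℝ} (ht : 0 < t) (htT : t ≤ T) {Z : Set (E n)} (hZ : MeasurableSet Z)
    (hZQ : Z ⊆ cube x t) :
    wMeasure w (cube x t) * volume Z ^ r ≤ C * volume (cube x t) ^ r * wMeasure w Z := by
  have h1 := h x t ht htT (Z.indicator fun _ => 1) (aemeasurable_const.indicator hZ)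
  have h2 : (fun y => (Z.indicator (fun _ => (1 : ℝ≥0∞)) y) ^ r) = Z.indicator fun _ => 1 := by
    ext y
    by_cases hy : y ∈ Z <;> simp [hy, hr]
  simp_rw [h2] at h1
  rw [lintegral_indicator hZ, lintegral_indicator hZ] at h1
  simp only [lintegral_one, Measure.restrict_apply_univ] at h1
  rw [Measure.restrict_apply hZ, Measure.restrict_apply hZ, Set.inter_eq_left.mpr hZQ] at h1
  exact h1

lemma AvgBound.measure_cube_le {r T : ℝ} (hr : 0 < r) {C : ℝ≥0} (h : AvgBound w r T C)
    {x y : E n} {t u : ℝ} (ht : 0 < t) (htT : t ≤ T) (hu : 0 < u) (hs : cube y u ⊆ cube x t) :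
    wMeasure w (cube x t) ≤ C * ENNReal.ofReal ((t / u) ^ n) ^ r * wMeasure w (cube y u) := by
  have h1 := h.measure_le hr ht htT (measurableSet_cube y u) hs
  rw [volume_cube _ ht.le, volume_cube _ hu.le] at h1
  have hU0 : ENNReal.ofReal (u ^ n) ^ r ≠ 0 := by
    simp [ENNReal.rpow_eq_zero_iff, hr, hr.le, not_lt.mpr, pow_pos hu n]
  have hUt : ENNReal.ofReal (u ^ n) ^ r ≠ ∞ := by
    simp [ENNReal.rpow_eq_top_iff, hr.le, not_lt.mpr]
  rw [← ENNReal.mul_le_mul_iff_left hU0 hUt]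
  refine h1.trans (le_of_eq ?_)
  have : ENNReal.ofReal (t ^ n) ^ r =
      ENNReal.ofReal ((t / u) ^ n) ^ r * ENNReal.ofReal (u ^ n) ^ r := by
    rw [← ENNReal.mul_rpow_of_nonneg _ _ hr.le, ← ENNReal.ofReal_mul (by positivity), ← mul_pow,
      div_mul_cancel₀ _ hu.ne']
  rw [this]; ring

/-- A cube of side `t` is covered by its `2^n` corner subcubes of side `2t/3`, which are admissible
when `t ≤ 3T/2`. All of them contain the central cube of side `t/3`, so their `w`-measures are
comparable with each other and with that of the whole cube. -/
lemma AvgBound.extend {r T : ℝ} {C : ℝ≥0} (h : AvgBound w r T C) (hr : 1 ≤ r) :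
    ∃ C', AvgBound w r (3 / 2 * T) C' := by
  have hr0 : 0 < r := by linarith
  set M : ℝ≥0∞ := ((Fintype.card (Fin n → Bool) : ℕ) : ℝ≥0∞)
  set D : ℝ≥0∞ := C * ENNReal.ofReal (2 ^ n) ^ r
  have hD : D ≠ ∞ := by
    refine ENNReal.mul_ne_top (by simp) ?_
    simp [ENNReal.rpow_eq_top_iff, hr0.le, not_lt.mpr]
  set K : ℝ≥0∞ := M ^ (r - 1) * (M * (M * D * C))
  have hM : M ≠ ∞ := by simp [M]
  have hK : K ≠ ∞ := by
    refine ENNReal.mul_ne_top (ENNReal.rpow_ne_top_of_nonneg (by linarith) hM) ?_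
    exact ENNReal.mul_ne_top hM (ENNReal.mul_ne_top (ENNReal.mul_ne_top hM hD) (by simp))
  refine ⟨K.toNNReal, fun x t ht htT f hf => ?_⟩
  rw [ENNReal.coe_toNNReal hK]
  let c : (Fin n → Bool) → E n := fun σ => WithLp.toLp 2 fun i => x i + if σ i then t / 6 else -(t / 6)
  have hc : ∀ σ i, |c σ i - x i| = t / 6 := by
    intro σ i
    have : c σ i = x i + if σ i then t / 6 else -(t / 6) := rfl
    rw [this]
    split_ifs <;> simp <;> linarith
  set Q : (Fin n → Bool) → Set (E n) := fun σ => cube (c σ) (2 / 3 * t) with hQ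
  have hQs : ∀ σ, Q σ ⊆ cube x t := fun σ => cube_subset_cube fun i => by rw [hc]; linarith
  have hZ : ∀ σ, cube x (t / 3) ⊆ Q σ := fun σ => cube_subset_cube fun i => by
    rw [abs_sub_comm, hc]; linarith
  have hcov : cube x t ⊆ ⋃ σ, Q σ := by
    intro y hy
    refine Set.mem_iUnion.mpr ⟨fun i => decide (x i ≤ y i), fun i => ?_⟩
    have hc' : c (fun i => decide (x i ≤ y i)) i = x i + if x i ≤ y i then t / 6 else -(t / 6) := by
      simp [c]
    rw [hc']
    have := abs_le.mp (hy i)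
    split_ifs with h <;> rw [abs_le] <;> constructor <;> linarith
  have hdbl : ∀ σ τ, wMeasure w (Q σ) ≤ D * wMeasure w (Q τ) := fun σ τ => by
    refine (h.measure_cube_le hr0 (by linarith) (by linarith) (by linarith) (hZ σ)).trans ?_
    have : 2 / 3 * t / (t / 3) = 2 := by field_simp
    rw [this]
    exact mul_le_mul_right (measure_mono (hZ τ)) _
  have hW : ∀ σ, wMeasure w (cube x t) ≤ M * D * wMeasure w (Q σ) := fun σ => by
    calc wMeasure w (cube x t) ≤ ∑ τ, wMeasure w (Q τ) :=
          (measure_mono hcov).trans (measure_iUnion_fintype_le _ _)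
      _ ≤ ∑ τ : Fin n → Bool, D * wMeasure w (Q σ) := Finset.sum_le_sum fun τ _ => hdbl τ σ
      _ = _ := by simp [M, mul_assoc]
  have hI : ∫⁻ y in cube x t, f y ≤ ∑ σ, ∫⁻ y in Q σ, f y := by
    refine (lintegral_mono_set hcov).trans ?_
    have := lintegral_iUnion_le (μ := volume) Q f
    rwa [tsum_fintype] at this
  have hterm : ∀ σ, wMeasure w (cube x t) * (∫⁻ y in Q σ, f y) ^ r ≤
      M * D * C * (volume (cube x t) ^ r * ∫⁻ y in cube x t, f y ^ r ∂(wMeasure w)) := fun σ => by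
    calc wMeasure w (cube x t) * (∫⁻ y in Q σ, f y) ^ r
        ≤ M * D * (wMeasure w (Q σ) * (∫⁻ y in Q σ, f y) ^ r) := by
          rw [← mul_assoc]; gcongr; exact hW σ
      _ ≤ M * D * (C * volume (Q σ) ^ r * ∫⁻ y in Q σ, f y ^ r ∂(wMeasure w)) := by
          exact mul_le_mul_right (h _ _ (by linarith) (by linarith) f hf) _
      _ ≤ M * D * (C * volume (cube x t) ^ r * ∫⁻ y in cube x t, f y ^ r ∂(wMeasure w)) := by
          gcongr
          · exact hQs σ
          · exact hQs σ
      _ = _ := by ring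
  calc wMeasure w (cube x t) * (∫⁻ y in cube x t, f y) ^ r
      ≤ wMeasure w (cube x t) * (M ^ (r - 1) * ∑ σ, (∫⁻ y in Q σ, f y) ^ r) := by
        gcongr
        refine (ENNReal.rpow_le_rpow hI hr0.le).trans ?_
        exact ENNReal.rpow_sum_le_const_mul_sum_rpow _ _ hr
    _ = M ^ (r - 1) * ∑ σ, wMeasure w (cube x t) * (∫⁻ y in Q σ, f y) ^ r := by
        rw [← Finset.mul_sum]; ring
    _ ≤ M ^ (r - 1) * ∑ _σ : Fin n → Bool,
          M * D * C * (volume (cube x t) ^ r * ∫⁻ y in cube x t, f y ^ r ∂(wMeasure w)) := by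
        exact mul_le_mul_right (Finset.sum_le_sum fun σ _ => hterm σ) _
    _ = _ := by
        rw [Finset.sum_const, nsmul_eq_mul, Finset.card_univ]
        ring

lemma AvgBound.mono_size {r T T' : ℝ} {C : ℝ≥0} (h : AvgBound w r T C) (hT : T' ≤ T) :
    AvgBound w r T' C := fun x t ht htT => h x t ht (htT.trans hT)

/-- Iterating the enlargement by `3/2` reaches every size: the bound `|Q| ≤ 1` in the definition of
the local classes is immaterial, at the price of the constant. -/
lemma IsAInftyLoc.exists_avgBound (hw : IsAInftyLoc w) {r : ℝ} (hr : critIndex w < r) (R : ℝ) :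
    ∃ C, AvgBound w r R C := by
  have hr1 : 1 ≤ r := hw.one_le_critIndex.trans hr.le
  have : ∀ k : ℕ, ∃ C, AvgBound w r ((3 / 2) ^ k) C := by
    intro k
    induction k with
    | zero => simpa using hw.exists_avgBound_one hr
    | succ k ih =>
      obtain ⟨C, hC⟩ := ih
      rw [pow_succ']
      exact hC.extend hr1
  obtain ⟨k, hk⟩ := pow_unbounded_of_one_lt R (by norm_num : (1 : ℝ) < 3 / 2)
  obtain ⟨C, hC⟩ := this k
  exact ⟨C, hC.mono_size hk.le⟩

lemma IsAInftyLoc.exists_doubling (hw : IsAInftyLoc w) (κ : ℝ) (hκ : 1 ≤ κ) (R : ℝ) :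
    ∃ D : ℝ≥0, ∀ (x : E n) (t : ℝ), 0 < t → t ≤ R →
      wMeasure w (cube x (κ * t)) ≤ D * wMeasure w (cube x t) := by
  have h0 : critIndex w < critIndex w + 1 := by linarith
  have hr : 0 < critIndex w + 1 := by linarith [hw.one_le_critIndex]
  obtain ⟨C, hC⟩ := hw.exists_avgBound h0 (κ * R)
  have hf : (C : ℝ≥0∞) * ENNReal.ofReal (κ ^ n) ^ (critIndex w + 1) ≠ ∞ :=
    ENNReal.mul_ne_top (by simp) (ENNReal.rpow_ne_top_of_nonneg hr.le (by simp))
  refine ⟨(C * ENNReal.ofReal (κ ^ n) ^ (critIndex w + 1)).toNNReal, fun x t ht htR => ?_⟩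
  rw [ENNReal.coe_toNNReal hf]
  have := hC.measure_cube_le hr (x := x) (y := x) (t := κ * t) (u := t) (by positivity)
    (by gcongr) ht (cube_subset_cube fun i => by simp; nlinarith)
  rwa [mul_div_cancel_right₀ _ ht.ne'] at this

end Extend

/-! ### Dyadic sums -/

lemma two_zpow_rpow (k : ℤ) (p : ℝ) : ((2 : ℝ≥0∞) ^ k) ^ p = 2 ^ ((k : ℝ) * p) := by
  rw [ENNReal.rpow_mul, ENNReal.rpow_intCast]

open Classical in
-- The term with `2^k < a ≤ 2^(k+1)` alone suffices; for `a = ∞` the series diverges.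
lemma rpow_le_tsum_dyadic (a : ℝ≥0∞) {θ : ℝ} (hθ : 0 < θ) :
    a ^ θ ≤ 2 ^ θ * ∑' k : ℤ, if (2 : ℝ≥0∞) ^ k < a then ((2 : ℝ≥0∞) ^ k) ^ θ else 0 := by
  rcases eq_or_ne a 0 with rfl | ha0
  · simp [hθ]
  rcases eq_or_ne a ∞ with rfl | hat
  · have : ∑' k : ℤ, (if (2 : ℝ≥0∞) ^ k < ∞ then ((2 : ℝ≥0∞) ^ k) ^ θ else 0) = ∞ := by
      have h1 : ∀ k : ℤ, (2 : ℝ≥0∞) ^ k < ∞ := fun k => ENNReal.zpow_lt_top (by simp) (by simp) k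
      simp only [h1, if_true]
      rw [eq_top_iff, ← ENNReal.tsum_const_eq_top_of_ne_zero (α := ℕ) (one_ne_zero)]
      refine le_trans ?_ (ENNReal.tsum_comp_le_tsum_of_injective
        (f := fun m : ℕ => (m : ℤ)) Nat.cast_injective _)
      refine ENNReal.tsum_le_tsum fun m => ?_
      apply ENNReal.one_le_rpow _ hθ
      simpa using one_le_pow₀ (by norm_num : (1 : ℝ≥0∞) ≤ 2)
    rw [this, ENNReal.mul_top]
    · exact le_top
    · simp [ENNReal.rpow_eq_zero_iff]
  obtain ⟨k, hk1, hk2⟩ := ENNReal.exists_mem_Ioc_zpow ha0 hat (y := 2) (by norm_num) (by simp)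
  calc a ^ θ ≤ ((2 : ℝ≥0∞) ^ (k + 1)) ^ θ := by gcongr
    _ = 2 ^ θ * ((2 : ℝ≥0∞) ^ k) ^ θ := by
        rw [ENNReal.zpow_add (by simp) (by simp), zpow_one, mul_comm,
          ENNReal.mul_rpow_of_nonneg _ _ hθ.le]
    _ = 2 ^ θ * (if (2 : ℝ≥0∞) ^ k < a then ((2 : ℝ≥0∞) ^ k) ^ θ else 0) := by rw [if_pos hk1]
    _ ≤ _ := by gcongr; exact ENNReal.le_tsum k

open Classical in
-- A geometric series is comparable to its largest term.
lemma exists_tsum_dyadic_le {θ : ℝ} (hθ : 0 < θ) : ∃ C : ℝ≥0, C ≠ 0 ∧ ∀ a : ℝ≥0∞,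
    ∑' k : ℤ, (if (2 : ℝ≥0∞) ^ k < a then ((2 : ℝ≥0∞) ^ k) ^ θ else 0) ≤ C * a ^ θ := by
  set ρ : ℝ≥0∞ := 2 ^ (-θ)
  have hρ : ρ < 1 := ENNReal.rpow_lt_one_of_one_lt_of_neg (by norm_num) (by linarith)
  have hC : (1 - ρ)⁻¹ ≠ ∞ := by
    simp [tsub_eq_zero_iff_le, hρ]
  have hC0 : (1 - ρ)⁻¹ ≠ 0 := by
    apply ENNReal.inv_ne_zero.mpr
    exact ne_top_of_le_ne_top ENNReal.one_ne_top tsub_le_self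
  refine ⟨((1 - ρ)⁻¹).toNNReal, ?_, fun a => ?_⟩
  · rw [ENNReal.toNNReal_ne_zero]; exact ⟨hC0, hC⟩
  rw [ENNReal.coe_toNNReal hC]
  rcases eq_or_ne a 0 with rfl | ha0
  · simp
  rcases eq_or_ne a ∞ with rfl | hat
  · rw [ENNReal.top_rpow_of_pos hθ, ENNReal.mul_top hC0]; exact le_top
  obtain ⟨k, hk1, hk2⟩ := ENNReal.exists_mem_Ioc_zpow ha0 hat (y := 2) (by norm_num) (by simp)
  have hinj : Function.Injective fun i : ℕ => k - i := fun i j h => by simpa using h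
  rw [← hinj.tsum_eq]
  · calc ∑' i : ℕ, (if (2 : ℝ≥0∞) ^ (k - i : ℤ) < a then ((2 : ℝ≥0∞) ^ (k - i : ℤ)) ^ θ else 0)
        ≤ ∑' i : ℕ, a ^ θ * ρ ^ i := by
          refine ENNReal.tsum_le_tsum fun i => ?_
          split_ifs with h
          · calc ((2 : ℝ≥0∞) ^ (k - i : ℤ)) ^ θ = ((2 : ℝ≥0∞) ^ k) ^ θ * ρ ^ i := by
                  rw [two_zpow_rpow, two_zpow_rpow, ← ENNReal.rpow_natCast, ← ENNReal.rpow_mul,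
                    ← ENNReal.rpow_add _ _ (by simp) (by simp)]
                  congr 1; push_cast; ring
              _ ≤ _ := by gcongr
          · exact zero_le
      _ = _ := by rw [ENNReal.tsum_mul_left, ENNReal.tsum_geometric, mul_comm]
  · intro j hj
    have hj' : (2 : ℝ≥0∞) ^ j < a := by
      by_contra h; simp [h] at hj
    have : j < k + 1 := by
      by_contra h
      exact absurd (hj'.trans_le hk2) (not_lt.mpr (ENNReal.zpow_le_of_le (by norm_num) (by omega)))
    exact ⟨(k - j).toNat, by simp; omega⟩

/-! ### The local maximal inequality -/

section Maximal
variable {n : ℕ} {w : E n → ℝ}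

lemma interior_cube_nonempty (x : E n) {t : ℝ} (ht : 0 < t) : (interior (cube x t)).Nonempty := by
  refine ⟨x, mem_interior.mpr ⟨Metric.ball x (t / 2), ?_, Metric.isOpen_ball, by simpa using ht⟩⟩
  simpa [mul_div_cancel₀] using ball_subset_cube x (t := t / 2)

/-- Vitali's lemma selects disjoint cubes whose enlargements cover `S`. Only the centers have to be
covered, so the factor `5` is generous. -/
lemma weak_type {R : ℝ} {D : ℝ≥0} (hD : ∀ (x : E n) (t : ℝ), 0 < t → t ≤ R →
      wMeasure w (cube x (5 * t)) ≤ D * wMeasure w (cube x t))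
    (g : E n → ℝ≥0∞) (l : ℝ≥0∞) (S : Set (E n))
    (hS : ∀ x ∈ S, ∃ t : ℝ, 0 < t ∧ t ≤ R ∧
      l * wMeasure w (cube x t) ≤ ∫⁻ y in cube x t, g y ∂(wMeasure w)) :
    l * wMeasure w S ≤ D * ∫⁻ y, g y ∂(wMeasure w) := by
  choose! τ h0 hR hl using hS
  obtain ⟨u, huS, hdis, hcov⟩ := Vitali.exists_disjoint_subfamily_covering_enlargement
    (fun x => cube x (τ x)) S τ 2 (by norm_num) (fun x hx => (h0 x hx).le) R hR
    (fun x hx => ⟨x, self_mem_cube x (h0 x hx).le⟩)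
  have hcount : u.Countable := hdis.countable_of_nonempty_interior
    fun x hx => interior_cube_nonempty x (h0 x (huS hx))
  have hsub : S ⊆ ⋃ b ∈ u, cube b (5 * τ b) := by
    intro a ha
    obtain ⟨b, hb, ⟨z, hza, hzb⟩, hab⟩ := hcov a ha
    refine Set.mem_biUnion hb fun i => ?_
    have h1 := hza i
    have h2 := hzb i
    have h3 := abs_sub_le (a i) (z i) (b i)
    rw [abs_sub_comm (a i) (z i)] at h3
    linarith [h0 b (huS hb)]
  calc l * wMeasure w S ≤ l * ∑' b : u, wMeasure w (cube (b : E n) (5 * τ b)) := by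
        gcongr
        exact (measure_mono hsub).trans (measure_biUnion_le _ hcount _)
    _ = ∑' b : u, l * wMeasure w (cube (b : E n) (5 * τ b)) := ENNReal.tsum_mul_left.symm
    _ ≤ ∑' b : u, D * ∫⁻ y in cube (b : E n) (τ b), g y ∂(wMeasure w) := by
        refine ENNReal.tsum_le_tsum fun b => ?_
        have hb := huS b.2
        calc l * wMeasure w (cube (b : E n) (5 * τ b))
            ≤ l * (D * wMeasure w (cube (b : E n) (τ b))) := by
              gcongr; exact hD _ _ (h0 _ hb) (hR _ hb)
          _ = D * (l * wMeasure w (cube (b : E n) (τ b))) := by ring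
          _ ≤ _ := by gcongr; exact hl _ hb
    _ = D * ∫⁻ y in ⋃ b ∈ u, cube b (τ b), g y ∂(wMeasure w) := by
        rw [ENNReal.tsum_mul_left, lintegral_biUnion hcount
          (fun b _ => measurableSet_cube b _) hdis]
    _ ≤ _ := mul_le_mul_right (setLIntegral_le_lintegral _ _) _

open Classical in
-- Marcinkiewicz interpolation between the weak type `(1,1)` bound and the trivial `L^∞` bound, in
-- dyadic form: at height `2^k` only the part of `g` above `2^(k-1)` counts, since the rest
-- contributes at most `2^(k-1)` to each average. Working with a measurable minorant `F` avoids the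
-- measurability of the maximal function itself.
lemma strong_type (hw : IsWeight w) {R : ℝ} {D : ℝ≥0} (hD : ∀ (x : E n) (t : ℝ), 0 < t → t ≤ R →
      wMeasure w (cube x (5 * t)) ≤ D * wMeasure w (cube x t)) {θ : ℝ} (hθ : 1 < θ) :
    ∃ C : ℝ≥0, ∀ (g F : E n → ℝ≥0∞), AEMeasurable g (wMeasure w) → Measurable F →
      (∀ x, F x ≤ ⨆ (t : ℝ) (_ : 0 < t ∧ t ≤ R),
        (wMeasure w (cube x t))⁻¹ * ∫⁻ y in cube x t, g y ∂(wMeasure w)) →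
      ∫⁻ x, F x ^ θ ∂(wMeasure w) ≤ C * ∫⁻ x, g x ^ θ ∂(wMeasure w) := by
  obtain ⟨C₀, -, hC₀⟩ := exists_tsum_dyadic_le (θ := θ - 1) (by linarith)
  have hθ0 : 0 < θ := by linarith
  set K : ℝ≥0∞ := 2 ^ θ * (2 * D * (2 ^ (θ - 1) * C₀))
  have hK : K ≠ ∞ := by
    have h2 : ∀ s : ℝ, (2 : ℝ≥0∞) ^ s ≠ ∞ := fun s => by simp [ENNReal.rpow_eq_top_iff]
    exact ENNReal.mul_ne_top (h2 _) (ENNReal.mul_ne_top (ENNReal.mul_ne_top (by simp) (by simp))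
      (ENNReal.mul_ne_top (h2 _) (by simp)))
  refine ⟨K.toNNReal, fun g F hg hF hle => ?_⟩
  rw [ENNReal.coe_toNNReal hK]
  -- the part of `g` above half the height `2 ^ k`
  set h : ℤ → E n → ℝ≥0∞ := fun k x => if (2 : ℝ≥0∞) ^ (k - 1) < g x then g x else 0 with hh
  have hpow : ∀ k : ℤ, (2 : ℝ≥0∞) ^ k = 2 ^ (k - 1) + 2 ^ (k - 1) := fun k => by
    conv_lhs => rw [← sub_add_cancel k 1, ENNReal.zpow_add (by simp) (by simp), zpow_one, mul_two]
  have hptop : ∀ k : ℤ, (2 : ℝ≥0∞) ^ k ≠ ∞ := fun k => (ENNReal.zpow_lt_top (by simp) (by simp) k).ne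
  have hweak : ∀ k : ℤ, (2 : ℝ≥0∞) ^ k * wMeasure w {x | (2 : ℝ≥0∞) ^ k < F x} ≤
      2 * D * ∫⁻ x, h k x ∂(wMeasure w) := by
    intro k
    have := weak_type hD (h k) ((2 : ℝ≥0∞) ^ (k - 1)) {x | (2 : ℝ≥0∞) ^ k < F x} ?_
    · calc (2 : ℝ≥0∞) ^ k * wMeasure w {x | (2 : ℝ≥0∞) ^ k < F x}
          = 2 * (2 ^ (k - 1) * wMeasure w {x | (2 : ℝ≥0∞) ^ k < F x}) := by
            rw [← mul_assoc, two_mul, ← hpow k]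
        _ ≤ 2 * (D * ∫⁻ y, h k y ∂(wMeasure w)) := mul_le_mul_right this _
        _ = _ := (mul_assoc _ _ _).symm
    intro x hx
    have hx' : (2 : ℝ≥0∞) ^ k < _ := lt_of_lt_of_le hx (hle x)
    simp only [lt_iSup_iff] at hx'
    obtain ⟨t, ⟨ht0, htR⟩, ht⟩ := hx'
    refine ⟨t, ht0, htR, ?_⟩
    have hW0 := (hw.wMeasure_cube_pos x ht0).ne'
    have hWt := (hw.wMeasure_cube_lt_top x ht0.le).ne
    set W := wMeasure w (cube x t)
    have h1 : (2 : ℝ≥0∞) ^ k * W ≤ ∫⁻ y in cube x t, g y ∂(wMeasure w) := by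
      calc (2 : ℝ≥0∞) ^ k * W ≤ (W⁻¹ * ∫⁻ y in cube x t, g y ∂(wMeasure w)) * W := by gcongr
        _ = _ := by rw [mul_comm, ← mul_assoc, ENNReal.mul_inv_cancel hW0 hWt, one_mul]
    have h2 : ∫⁻ y in cube x t, g y ∂(wMeasure w) ≤
        2 ^ (k - 1) * W + ∫⁻ y in cube x t, h k y ∂(wMeasure w) := by
      calc _ ≤ ∫⁻ y in cube x t, ((2 : ℝ≥0∞) ^ (k - 1) + h k y) ∂(wMeasure w) := by
            refine lintegral_mono fun y => ?_
            simp only [hh]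
            split_ifs with hy
            · exact le_add_self
            · simpa using not_lt.mp hy
        _ = _ := by rw [lintegral_add_left measurable_const]; simp [W]
    rw [hpow k, add_mul] at h1
    exact (ENNReal.add_le_add_iff_left (ENNReal.mul_ne_top (hptop _) hWt)).mp (h1.trans h2)
  have hhm : ∀ k, AEMeasurable (h k) (wMeasure w) := fun k => by
    have : h k = fun x => (fun a : ℝ≥0∞ => if (2 : ℝ≥0∞) ^ (k - 1) < a then a else 0) (g x) := rfl
    rw [this]
    exact (Measurable.ite measurableSet_Ioi measurable_id measurable_const).comp_aemeasurable hg
  calc ∫⁻ x, F x ^ θ ∂(wMeasure w)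
      ≤ ∫⁻ x, 2 ^ θ * ∑' k : ℤ, (if (2 : ℝ≥0∞) ^ k < F x then ((2 : ℝ≥0∞) ^ k) ^ θ else 0)
          ∂(wMeasure w) := lintegral_mono fun x => rpow_le_tsum_dyadic _ hθ0
    _ = 2 ^ θ * ∑' k : ℤ, ((2 : ℝ≥0∞) ^ k) ^ θ * wMeasure w {x | (2 : ℝ≥0∞) ^ k < F x} := by
        have hm : ∀ k : ℤ, MeasurableSet {x | (2 : ℝ≥0∞) ^ k < F x} := fun k =>
          measurableSet_lt measurable_const hF
        have hm' : ∀ k : ℤ, Measurable fun x =>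
            if (2 : ℝ≥0∞) ^ k < F x then ((2 : ℝ≥0∞) ^ k) ^ θ else 0 := fun k =>
          Measurable.ite (hm k) measurable_const measurable_const
        rw [lintegral_const_mul _ (Measurable.tsum hm'),
          lintegral_tsum fun k => (hm' k).aemeasurable]
        congr 2
        ext k
        rw [← lintegral_indicator_const (hm k)]
        refine lintegral_congr fun x => ?_
        simp [Set.indicator_apply]
    _ ≤ 2 ^ θ * ∑' k : ℤ, ((2 : ℝ≥0∞) ^ k) ^ (θ - 1) *
          (2 * D * ∫⁻ x, h k x ∂(wMeasure w)) := by
        refine mul_le_mul_right (ENNReal.tsum_le_tsum fun k => ?_) _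
        calc ((2 : ℝ≥0∞) ^ k) ^ θ * wMeasure w {x | (2 : ℝ≥0∞) ^ k < F x}
            = ((2 : ℝ≥0∞) ^ k) ^ (θ - 1) *
              ((2 : ℝ≥0∞) ^ k * wMeasure w {x | (2 : ℝ≥0∞) ^ k < F x}) := by
              rw [← mul_assoc]
              congr 1
              nth_rewrite 3 [← ENNReal.rpow_one ((2 : ℝ≥0∞) ^ k)]
              rw [← ENNReal.rpow_add _ _ (ENNReal.zpow_pos (by simp) (by simp) k).ne' (hptop k)]
              ring_nf
          _ ≤ _ := mul_le_mul_right (hweak k) _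
    _ = 2 ^ θ * (2 * D * ∑' k : ℤ, ∫⁻ x, ((2 : ℝ≥0∞) ^ k) ^ (θ - 1) * h k x ∂(wMeasure w)) := by
        rw [← ENNReal.tsum_mul_left (a := 2 * (D : ℝ≥0∞))]
        congr 2
        ext k
        rw [lintegral_const_mul'' _ (hhm k)]
        ring
    _ = 2 ^ θ * (2 * D * ∫⁻ x, ∑' k : ℤ, ((2 : ℝ≥0∞) ^ k) ^ (θ - 1) * h k x ∂(wMeasure w)) := by
        rw [lintegral_tsum fun k => (hhm k).const_mul _]
    _ ≤ 2 ^ θ * (2 * D * ∫⁻ x, (2 ^ (θ - 1) * C₀) * g x ^ θ ∂(wMeasure w)) := by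
        gcongr with x
        have h1 : ∀ k : ℤ, ((2 : ℝ≥0∞) ^ k) ^ (θ - 1) * h k x = (2 ^ (θ - 1) * g x) *
            (if (2 : ℝ≥0∞) ^ (k - 1) < g x then ((2 : ℝ≥0∞) ^ (k - 1)) ^ (θ - 1) else 0) := by
          intro k
          simp only [hh]
          split_ifs
          · have : (2 : ℝ≥0∞) ^ k = 2 * 2 ^ (k - 1) := by rw [hpow k, two_mul]
            rw [this, ENNReal.mul_rpow_of_nonneg _ _ (by linarith)]; ring
          · simp
        simp_rw [h1]
        have h2 := (Equiv.subRight (1 : ℤ)).tsum_eq (fun k : ℤ =>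
          if (2 : ℝ≥0∞) ^ k < g x then ((2 : ℝ≥0∞) ^ k) ^ (θ - 1) else 0)
        simp only [Equiv.subRight_apply] at h2
        rw [ENNReal.tsum_mul_left, h2]
        calc _ ≤ 2 ^ (θ - 1) * g x * (C₀ * g x ^ (θ - 1)) := by gcongr; exact hC₀ _
          _ = 2 ^ (θ - 1) * C₀ * (g x ^ (1 : ℝ) * g x ^ (θ - 1)) := by
              rw [ENNReal.rpow_one]; ring
          _ = _ := by
              rw [← ENNReal.rpow_add_of_nonneg _ _ (by norm_num) (by linarith)]
              ring_nf
    _ = _ := by rw [lintegral_const_mul'' _ (hg.pow_const _)]; ring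

/-- The local Hardy–Littlewood maximal inequality, for measurable minorants of the maximal
function. -/
lemma IsAInftyLoc.maximal_bound (hw : IsAInftyLoc w) {q : ℝ} (hq : critIndex w < q) (R : ℝ) :
    ∃ C : ℝ≥0, ∀ (f F : E n → ℝ≥0∞), AEMeasurable f volume → Measurable F →
      (∀ x, F x ≤ ⨆ (t : ℝ) (_ : 0 < t ∧ t ≤ R),
        (volume (cube x t))⁻¹ * ∫⁻ y in cube x t, f y) →
      ∫⁻ x, F x ^ q ∂(wMeasure w) ≤ C * ∫⁻ x, f x ^ q ∂(wMeasure w) := by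
  -- The room between `critIndex w` and `q`: `r`-th powers of averages are controlled by
  -- `w`-averages of `f ^ r`, to which the maximal inequality for `w dx` applies with the exponent
  -- `q / r > 1`.
  obtain ⟨r, hr, hrq⟩ := exists_between hq
  have hr0 : 0 < r := by linarith [hw.one_le_critIndex]
  have hθ : 1 < q / r := by rwa [one_lt_div hr0]
  obtain ⟨A, hA⟩ := hw.exists_avgBound hr R
  obtain ⟨D, hD⟩ := hw.exists_doubling 5 (by norm_num) R
  obtain ⟨C, hC⟩ := strong_type hw.isWeight hD hθ
  have hθ0 : 0 ≤ q / r := by linarith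
  have hrθ : r * (q / r) = q := by field_simp
  refine ⟨C * A ^ (q / r), fun f F hf hF hle => ?_⟩
  have hf' : AEMeasurable f (wMeasure w) := hf.mono_ac wMeasure_absolutelyContinuous
  have := hC (fun x => A * f x ^ r) (fun x => F x ^ r) ((hf'.pow_const r).const_mul _)
    (hF.pow_const r) ?_
  · simp_rw [ENNReal.mul_rpow_of_nonneg _ _ hθ0, ← ENNReal.rpow_mul, hrθ] at this
    rw [lintegral_const_mul'' _ (hf'.pow_const _), ← mul_assoc] at this
    rwa [ENNReal.coe_mul, ENNReal.coe_rpow_of_nonneg _ hθ0]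
  intro x
  refine (ENNReal.rpow_le_rpow (hle x) hr0.le).trans ?_
  have hmono : ∀ a b : ℝ≥0∞, a ^ r ≤ b → a ≤ b ^ (1 / r) := fun a b h => by
    rwa [one_div, ENNReal.le_rpow_inv_iff hr0]
  set B := ⨆ (t : ℝ) (_ : 0 < t ∧ t ≤ R),
    (wMeasure w (cube x t))⁻¹ * ∫⁻ y in cube x t, A * f y ^ r ∂(wMeasure w)
  have : (⨆ (t : ℝ) (_ : 0 < t ∧ t ≤ R), (volume (cube x t))⁻¹ * ∫⁻ y in cube x t, f y) ≤
      B ^ (1 / r) := by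
    refine iSup₂_le fun t ht => hmono _ _ ?_
    refine le_trans ?_ (le_iSup₂_of_le t ht le_rfl)
    have h1 := hA x t ht.1 ht.2 f hf
    have hW0 := (hw.isWeight.wMeasure_cube_pos x ht.1).ne'
    have hWt := (hw.isWeight.wMeasure_cube_lt_top x ht.1.le).ne
    have hV0 := (volume_cube_pos x ht.1).ne'
    have hVt := (volume_cube_lt_top x ht.1.le).ne
    set W := wMeasure w (cube x t)
    set V := volume (cube x t)
    rw [ENNReal.mul_rpow_of_nonneg _ _ hr0.le, lintegral_const_mul'' _ (hf'.pow_const _).restrict,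
      ← ENNReal.mul_le_mul_iff_right hW0 hWt]
    have hVr0 : V ^ r ≠ 0 := by simp [ENNReal.rpow_eq_zero_iff, hV0, hVt]
    have hVrt : V ^ r ≠ ∞ := by simp [ENNReal.rpow_eq_top_iff, hV0, hVt]
    calc W * (V⁻¹ ^ r * (∫⁻ y in cube x t, f y) ^ r)
        = V⁻¹ ^ r * (W * (∫⁻ y in cube x t, f y) ^ r) := by ring
      _ ≤ V⁻¹ ^ r * (A * V ^ r * ∫⁻ y in cube x t, f y ^ r ∂(wMeasure w)) := by gcongr
      _ = (V⁻¹ ^ r * V ^ r) * (A * ∫⁻ y in cube x t, f y ^ r ∂(wMeasure w)) := by ring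
      _ = (W * W⁻¹) * (A * ∫⁻ y in cube x t, f y ^ r ∂(wMeasure w)) := by
          rw [ENNReal.inv_rpow, ENNReal.inv_mul_cancel hVr0 hVrt, ENNReal.mul_inv_cancel hW0 hWt]
      _ = _ := by ring
  calc _ ≤ (B ^ (1 / r)) ^ r := ENNReal.rpow_le_rpow this hr0.le
    _ = B := by rw [← ENNReal.rpow_mul, one_div_mul_cancel hr0.ne', ENNReal.rpow_one]

end Maximal

/-- The standing assumptions on the weight and the exponents. -/
structure Admissible {n : ℕ} (w : E n → ℝ) (p q : ℝ) : Prop where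
  weight : IsAInftyLoc w
  one_le_dim : 1 ≤ n
  p_pos : 0 < p
  p_le_one : p ≤ 1
  critIndex_lt : critIndex w < q

/-- The moments of `a` of order at most `s` vanish. -/
def VanishingMoments {n : ℕ} (s : ℕ) (a : E n → ℂ) : Prop :=
  ∀ α : Fin n → ℕ, ∑ i, α i ≤ s → ∫ y, a y * ((∏ i, y i ^ α i : ℝ) : ℂ) = 0

/-! ### Exponents, and functions as distributions -/

section Basic
variable {n : ℕ} {w : E n → ℝ} {p q : ℝ}

lemma Admissible.one_lt_q (h : Admissible w p q) : 1 < q :=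
  h.weight.one_le_critIndex.trans_lt h.critIndex_lt

lemma Admissible.q_pos (h : Admissible w p q) : 0 < q := by linarith [h.one_lt_q]

lemma Admissible.exponent_neg (h : Admissible w p q) : 1 / q - 1 / p < 0 := by
  have := one_div_lt_one_div_of_lt h.p_pos (h.p_le_one.trans_lt h.one_lt_q)
  linarith

lemma Admissible.isWeight (h : Admissible w p q) : IsWeight w := h.weight.isWeight

lemma Admissible.eLpNorm_rpow (h : Admissible w p q) (a : E n → ℂ) :
    eLpNorm a (ENNReal.ofReal q) (wMeasure w) ^ q = ∫⁻ x, ‖a x‖ₑ ^ q ∂(wMeasure w) := by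
  rw [eLpNorm_eq_lintegral_rpow_enorm_toReal (by simpa using h.q_pos) ENNReal.ofReal_ne_top,
    ENNReal.toReal_ofReal h.q_pos.le, ← ENNReal.rpow_mul, one_div_mul_cancel h.q_pos.ne',
    ENNReal.rpow_one]

lemma Admissible.one_le_ofReal (h : Admissible w p q) : 1 ≤ ENNReal.ofReal q := by
  simpa using h.one_lt_q.le

/-- The averaging inequality with exponent `q` on unit cubes embeds `L^q_w` in `L^1_loc`. This is
what makes `ofFun a` the expected distribution for atoms. -/
lemma Admissible.locallyIntegrable (h : Admissible w p q) {a : E n → ℂ}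
    (ha : AEStronglyMeasurable a volume)
    (hfin : eLpNorm a (ENNReal.ofReal q) (wMeasure w) < ∞) : LocallyIntegrable a volume := by
  obtain ⟨C, hC⟩ := h.weight.exists_avgBound h.critIndex_lt 1
  intro x
  refine ⟨cube x 1, ?_, ha.restrict, ?_⟩
  · refine Filter.mem_of_superset (Metric.ball_mem_nhds x (by norm_num : (0 : ℝ) < 1 / 2)) ?_
    simpa using ball_subset_cube x (t := 1 / 2)
  · have h1 := hC x 1 one_pos le_rfl (fun y => ‖a y‖ₑ) ha.enorm
    have h2 : (C : ℝ≥0∞) * volume (cube x 1) ^ q *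
        ∫⁻ y in cube x 1, ‖a y‖ₑ ^ q ∂(wMeasure w) < ∞ := by
      refine ENNReal.mul_lt_top (ENNReal.mul_lt_top (by simp) ?_) ?_
      · exact ENNReal.rpow_lt_top_of_nonneg h.q_pos.le (volume_cube_lt_top x (by norm_num)).ne
      · refine (setLIntegral_le_lintegral _ _).trans_lt ?_
        rw [← h.eLpNorm_rpow]
        exact ENNReal.rpow_lt_top_of_nonneg h.q_pos.le hfin.ne
    have h3 := h1.trans_lt h2
    have h4 : (∫⁻ y in cube x 1, ‖a y‖ₑ) ^ q < ∞ :=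
      ENNReal.lt_top_of_mul_ne_top_right h3.ne (h.isWeight.wMeasure_cube_pos x one_pos).ne'
    rw [hasFiniteIntegral_iff_enorm]
    exact (ENNReal.rpow_lt_top_iff_of_pos h.q_pos).mp h4

lemma ofFun_apply {a : E n → ℂ} (ha : LocallyIntegrable a volume) (φ : Test n) :
    ofFun a φ = ∫ y, φ y • a y :=
  TestFunction.integralAgainstBilinCLM_eq_integral (ha.locallyIntegrableOn _)

lemma ofFun_zero : ofFun (0 : E n → ℂ) = 0 := by
  ext φ
  have h := ofFun_apply (a := (0 : E n → ℂ)) locallyIntegrable_zero φ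
  rw [h]; simp

lemma ofFun_congr {a b : E n → ℂ} (ha : LocallyIntegrable a volume) (hab : a =ᵐ[volume] b) :
    ofFun a = ofFun b := by
  have hb : LocallyIntegrable b volume := fun x => by
    obtain ⟨s, hs, hi⟩ := ha x
    exact ⟨s, hs, hi.congr (ae_restrict_of_ae hab)⟩
  ext φ
  rw [ofFun_apply ha, ofFun_apply hb]
  refine integral_congr_ae ?_
  filter_upwards [hab] with x hx
  rw [hx]

lemma integrable_test_smul {a : E n → ℂ} (ha : LocallyIntegrable a volume) (φ : Test n) :
    Integrable (fun y => φ y • a y) volume :=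
  ha.integrable_smul_left_of_hasCompactSupport φ.contDiff.continuous φ.hasCompactSupport

lemma ofFun_add {a b : E n → ℂ} (ha : LocallyIntegrable a volume)
    (hb : LocallyIntegrable b volume) : ofFun (a + b) = ofFun a + ofFun b := by
  ext φ
  change ofFun (a + b) φ = ofFun a φ + ofFun b φ
  rw [ofFun_apply (ha.add hb), ofFun_apply ha, ofFun_apply hb,
    ← integral_add (integrable_test_smul ha φ) (integrable_test_smul hb φ)]
  simp [smul_add]

lemma ofFun_smul {a : E n → ℂ} (ha : LocallyIntegrable a volume) (c : ℂ) :
    ofFun (c • a) = c • ofFun a := by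
  ext φ
  change ofFun (c • a) φ = c • ofFun a φ
  rw [ofFun_apply (ha.smul c), ofFun_apply ha, ← integral_smul]
  simp only [Pi.smul_apply]
  congr 1
  ext y
  rw [smul_comm]

lemma ofFun_sum {ι : Type*} (s : Finset ι) {a : ι → E n → ℂ}
    (ha : ∀ i ∈ s, LocallyIntegrable (a i) volume) :
    ofFun (∑ i ∈ s, a i) = ∑ i ∈ s, ofFun (a i) := by
  classical
  induction s using Finset.induction_on with
  | empty => simpa using ofFun_zero
  | insert i s hi ih =>
    have h1 : ∀ j ∈ s, LocallyIntegrable (a j) volume := fun j hj => ha j (by simp [hj])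
    rw [Finset.sum_insert hi, Finset.sum_insert hi, ofFun_add (ha i (by simp)), ih h1]
    have := locallyIntegrable_finsetSum s h1
    rwa [← Finset.sum_fn] at this

lemma convAt_ofFun {a : E n → ℂ} (ha : LocallyIntegrable a volume) (φ : Test n) {t : ℝ}
    (ht : 0 < t) (x : E n) :
    convAt (ofFun a) φ t ht x = ∫ y, ((t ^ n)⁻¹ * φ (t⁻¹ • (x - y))) • a y :=
  ofFun_apply ha _

lemma zero_smul_distr (T : Distr n) : (0 : ℂ) • T = 0 := zero_smul ℂ T

/-! ### The finite atomic quasi-norm -/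

lemma Admissible.univ_ne_zero (h : Admissible w p q) : wMeasure w Set.univ ≠ 0 := fun h0 =>
  (h.isWeight.wMeasure_cube_pos 0 one_pos).ne' (measure_mono_null (Set.subset_univ _) h0)

lemma rpow_ne_top_of_ne_zero {x : ℝ≥0∞} (hx : x ≠ 0) {r : ℝ} (hr : r ≤ 0) : x ^ r ≠ ∞ := by
  simp [ENNReal.rpow_eq_top_iff, hx, hr.not_gt]

lemma IsSingleAtom.locallyIntegrable (h : Admissible w p q) {a : E n → ℂ}
    (ha : IsSingleAtom w p q a) : LocallyIntegrable a volume :=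
  h.locallyIntegrable ha.1 (ha.2.trans_lt
    (rpow_ne_top_of_ne_zero h.univ_ne_zero h.exponent_neg.le).lt_top)

lemma IsAtomOn.eLpNorm_lt_top (h : Admissible w p q) {s : ℕ} {x : E n} {t : ℝ} (ht : 0 < t)
    {a : E n → ℂ} (ha : IsAtomOn w p q s x t a) :
    eLpNorm a (ENNReal.ofReal q) (wMeasure w) < ∞ :=
  ha.size.trans_lt (rpow_ne_top_of_ne_zero (h.isWeight.wMeasure_cube_pos x ht).ne'
    h.exponent_neg.le).lt_top

lemma IsSmallAtom.locallyIntegrable (h : Admissible w p q) {s : ℕ} {a : E n → ℂ}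
    (ha : IsSmallAtom w p q s a) : LocallyIntegrable a volume := by
  obtain ⟨x, t, ht, -, ha⟩ := ha
  exact h.locallyIntegrable ha.1 (ha.eLpNorm_lt_top h ht)

lemma isSingleAtom_zero : IsSingleAtom w p q (0 : E n → ℂ) :=
  ⟨aestronglyMeasurable_zero, by simp⟩

/-- Separating the single atom and allowing any finite index type makes it possible to concatenate
representations. -/
lemma finNorm_le_of_rep {s : ℕ} {ι : Type*} [Fintype ι] {c₀ : ℂ} {a₀ : E n → ℂ}
    (ha₀ : IsSingleAtom w p q a₀) {c : ι → ℂ} {a : ι → E n → ℂ}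
    (ha : ∀ i, IsSmallAtom w p q s (a i)) :
    finNorm w p q s (c₀ • ofFun a₀ + ∑ i, c i • ofFun (a i)) ≤
      (‖c₀‖ₑ ^ p + ∑ i, ‖c i‖ₑ ^ p) ^ (1 / p) := by
  refine sInf_le ⟨Fintype.card ι, Fin.cons c₀ (c ∘ (Fintype.equivFin ι).symm),
    Fin.cons a₀ (a ∘ (Fintype.equivFin ι).symm), by simpa using ha₀, ?_, ?_, ?_⟩
  · intro j hj
    obtain ⟨i, rfl⟩ := Fin.exists_succ_eq.mpr hj
    simpa using ha _
  · rw [Fin.sum_univ_succ]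
    simp only [Fin.cons_zero, Fin.cons_succ, Function.comp_apply]
    rw [(Fintype.equivFin ι).symm.sum_comp (fun i => c i • ofFun (a i))]
  · rw [Fin.sum_univ_succ]
    simp only [Fin.cons_zero, Fin.cons_succ, Function.comp_apply]
    rw [(Fintype.equivFin ι).symm.sum_comp (fun i => ‖c i‖ₑ ^ p)]

lemma exists_rep_of_finNorm_lt {s : ℕ} {T : Distr n} {r : ℝ≥0∞} (hT : finNorm w p q s T < r) :
    ∃ (c₀ : ℂ) (a₀ : E n → ℂ) (k : ℕ) (c : Fin k → ℂ) (a : Fin k → E n → ℂ),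
      IsSingleAtom w p q a₀ ∧ (∀ i, IsSmallAtom w p q s (a i)) ∧
      T = c₀ • ofFun a₀ + ∑ i, c i • ofFun (a i) ∧
      (‖c₀‖ₑ ^ p + ∑ i, ‖c i‖ₑ ^ p) ^ (1 / p) < r := by
  obtain ⟨r', ⟨k, c, a, h0, h1, h2, rfl⟩, hr⟩ := sInf_lt_iff.mp hT
  refine ⟨c 0, a 0, k, fun i => c i.succ, fun i => a i.succ, h0,
    fun i => h1 _ (Fin.succ_ne_zero i), ?_, ?_⟩
  · rw [h2, Fin.sum_univ_succ]
  · rwa [Fin.sum_univ_succ] at hr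

lemma Admissible.finNorm_zero (h : Admissible w p q) (s : ℕ) : finNorm w p q s 0 = 0 := by
  have := finNorm_le_of_rep (s := s) (ι := Empty) (c₀ := 0) (isSingleAtom_zero (w := w) (p := p)
    (q := q)) (c := fun i => i.elim) (a := fun i => i.elim) (fun i => i.elim)
  rw [zero_smul_distr] at this
  simpa [h.p_pos, h.p_pos.not_gt] using this

lemma Admissible.finNorm_smul_le (h : Admissible w p q) (s : ℕ) (c : ℂ) (T : Distr n) :
    finNorm w p q s (c • T) ≤ ‖c‖ₑ * finNorm w p q s T := by
  rcases eq_or_ne c 0 with rfl | hc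
  · rw [zero_smul_distr, h.finNorm_zero]; exact zero_le
  refine le_of_forall_gt fun r hr => ?_
  have hc0 : ‖c‖ₑ ≠ 0 := by simpa using hc
  have hr' : finNorm w p q s T < r / ‖c‖ₑ := by
    rw [ENNReal.lt_div_iff_mul_lt (Or.inl hc0) (Or.inl enorm_ne_top), mul_comm]; exact hr
  obtain ⟨c₀, a₀, k, b, a, h0, h1, rfl, h2⟩ := exists_rep_of_finNorm_lt hr'
  have h3 := finNorm_le_of_rep (s := s) (c₀ := c * c₀) h0 (c := fun i => c * b i) h1
  have h4 : (‖c * c₀‖ₑ ^ p + ∑ i, ‖c * b i‖ₑ ^ p) ^ (1 / p) =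
      ‖c‖ₑ * (‖c₀‖ₑ ^ p + ∑ i, ‖b i‖ₑ ^ p) ^ (1 / p) := by
    simp_rw [enorm_mul, ENNReal.mul_rpow_of_nonneg _ _ h.p_pos.le]
    rw [← Finset.mul_sum, ← mul_add, ENNReal.mul_rpow_of_nonneg _ _ (by simpa using h.p_pos.le),
      ← ENNReal.rpow_mul, mul_one_div_cancel h.p_pos.ne', ENNReal.rpow_one]
  rw [h4] at h3
  rw [smul_add, Finset.smul_sum]
  simp_rw [smul_smul]
  refine h3.trans_lt ?_
  rw [mul_comm, ← ENNReal.lt_div_iff_mul_lt (Or.inl hc0) (Or.inl enorm_ne_top)]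
  exact h2

lemma Admissible.finNorm_smul (h : Admissible w p q) (s : ℕ) (c : ℂ) (T : Distr n) :
    finNorm w p q s (c • T) = ‖c‖ₑ * finNorm w p q s T := by
  refine le_antisymm (h.finNorm_smul_le s c T) ?_
  rcases eq_or_ne c 0 with rfl | hc
  · simp
  have h1 := h.finNorm_smul_le s c⁻¹ (c • T)
  rw [inv_smul_smul₀ hc, enorm_inv hc] at h1
  have hc0 : ‖c‖ₑ ≠ 0 := by simpa using hc
  calc ‖c‖ₑ * finNorm w p q s T ≤ ‖c‖ₑ * (‖c‖ₑ⁻¹ * finNorm w p q s (c • T)) := by gcongr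
    _ = _ := by rw [← mul_assoc, ENNReal.mul_inv_cancel hc0 enorm_ne_top, one_mul]

/-- A representation has room for one single atom only, so two of them must be fused when
representations are added. By Minkowski's inequality the combination divided by `|c| + |d|` is again
a single atom. -/
lemma Admissible.exists_merge_single (h : Admissible w p q) {a b : E n → ℂ} (c d : ℂ)
    (ha : IsSingleAtom w p q a) (hb : IsSingleAtom w p q b) :
    ∃ (e : ℂ) (f : E n → ℂ), IsSingleAtom w p q f ∧ ‖e‖ₑ ≤ ‖c‖ₑ + ‖d‖ₑ ∧
      c • ofFun a + d • ofFun b = e • ofFun f := by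
  by_cases h0 : ‖c‖ + ‖d‖ = 0
  · have hc : c = 0 := norm_eq_zero.mp (by linarith [norm_nonneg c, norm_nonneg d])
    have hd : d = 0 := norm_eq_zero.mp (by linarith [norm_nonneg c, norm_nonneg d])
    exact ⟨0, 0, isSingleAtom_zero, by simp, by rw [hc, hd, zero_smul_distr, zero_smul_distr, zero_smul_distr, add_zero]⟩
  set e : ℝ := ‖c‖ + ‖d‖
  have he : 0 < e := lt_of_le_of_ne (by positivity) (Ne.symm h0)
  have hec : (e : ℂ) ≠ 0 := by exact_mod_cast h0
  have hen : ‖(e : ℂ)‖ₑ = ‖c‖ₑ + ‖d‖ₑ := by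
    rw [← ofReal_norm, Complex.norm_real, Real.norm_of_nonneg he.le,
      ENNReal.ofReal_add (norm_nonneg _) (norm_nonneg _), ofReal_norm,
      ofReal_norm]
  have hen0 : ‖(e : ℂ)‖ₑ ≠ 0 := by simpa using h0
  have hla := ha.locallyIntegrable h
  have hlb := hb.locallyIntegrable h
  refine ⟨e, ((e : ℂ)⁻¹ * c) • a + ((e : ℂ)⁻¹ * d) • b, ⟨?_, ?_⟩, hen.le, ?_⟩
  · exact (ha.1.const_smul _).add (hb.1.const_smul _)
  · set S := wMeasure w Set.univ ^ (1 / q - 1 / p)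
    have hma := ha.1.mono_ac (wMeasure_absolutelyContinuous (w := w))
    have hmb := hb.1.mono_ac (wMeasure_absolutelyContinuous (w := w))
    calc _ ≤ eLpNorm (((e : ℂ)⁻¹ * c) • a) (ENNReal.ofReal q) (wMeasure w) +
          eLpNorm (((e : ℂ)⁻¹ * d) • b) (ENNReal.ofReal q) (wMeasure w) :=
          eLpNorm_add_le (hma.const_smul _) (hmb.const_smul _) h.one_le_ofReal
      _ ≤ ‖(e : ℂ)⁻¹ * c‖ₑ * S + ‖(e : ℂ)⁻¹ * d‖ₑ * S := by
          rw [eLpNorm_const_smul, eLpNorm_const_smul]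
          gcongr
          · exact ha.2
          · exact hb.2
      _ = ‖(e : ℂ)‖ₑ⁻¹ * (‖c‖ₑ + ‖d‖ₑ) * S := by
          rw [enorm_mul, enorm_mul, enorm_inv hec]; ring
      _ = S := by rw [← hen, ENNReal.inv_mul_cancel hen0 enorm_ne_top, one_mul]
  · rw [ofFun_add (hla.smul _) (hlb.smul _), ofFun_smul hla, ofFun_smul hlb, smul_add, smul_smul,
      smul_smul, ← mul_assoc, ← mul_assoc, mul_inv_cancel₀ hec, one_mul, one_mul]

/-- Concatenate nearly optimal representations; the fused single atoms cost at most `(|c₀| + |d₀|)^p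
≤ |c₀|^p + |d₀|^p`. -/
lemma Admissible.finNorm_add_rpow (h : Admissible w p q) (s : ℕ) (S T : Distr n) :
    finNorm w p q s (S + T) ^ p ≤ finNorm w p q s S ^ p + finNorm w p q s T ^ p := by
  have hp := h.p_pos
  have key : ∀ (x y : ℝ≥0∞), finNorm w p q s S < x → finNorm w p q s T < y →
      finNorm w p q s (S + T) ^ p ≤ x ^ p + y ^ p := by
    intro x y hx hy
    obtain ⟨c₀, a₀, k, c, a, h0, h1, rfl, h2⟩ := exists_rep_of_finNorm_lt hx
    obtain ⟨d₀, b₀, l, d, b, h0', h1', rfl, h2'⟩ := exists_rep_of_finNorm_lt hy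
    obtain ⟨e, f, hf, hef, heq⟩ := h.exists_merge_single c₀ d₀ h0 h0'
    have h3 := finNorm_le_of_rep (s := s) (c₀ := e) hf (ι := Fin k ⊕ Fin l) (c := Sum.elim c d)
      (a := Sum.elim a b) (by rintro (i | i); exacts [h1 i, h1' i])
    rw [Fintype.sum_sum_type, Fintype.sum_sum_type] at h3
    simp only [Sum.elim_inl, Sum.elim_inr] at h3
    rw [← heq] at h3
    have h4 := ENNReal.rpow_le_rpow h3 hp.le
    rw [← ENNReal.rpow_mul, one_div_mul_cancel hp.ne', ENNReal.rpow_one] at h4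
    have h5 := ENNReal.rpow_le_rpow h2.le hp.le
    have h5' := ENNReal.rpow_le_rpow h2'.le hp.le
    rw [← ENNReal.rpow_mul, one_div_mul_cancel hp.ne', ENNReal.rpow_one] at h5 h5'
    have h6 : ‖e‖ₑ ^ p ≤ ‖c₀‖ₑ ^ p + ‖d₀‖ₑ ^ p :=
      (ENNReal.rpow_le_rpow hef hp.le).trans (ENNReal.rpow_add_le_add_rpow _ _ hp.le h.p_le_one)
    calc _ = finNorm w p q s (c₀ • ofFun a₀ + d₀ • ofFun b₀ +
          (∑ i, c i • ofFun (a i) + ∑ i, d i • ofFun (b i))) ^ p := by congr 2; abel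
      _ ≤ ‖e‖ₑ ^ p + (∑ i, ‖c i‖ₑ ^ p + ∑ i, ‖d i‖ₑ ^ p) := h4
      _ ≤ (‖c₀‖ₑ ^ p + ‖d₀‖ₑ ^ p) + (∑ i, ‖c i‖ₑ ^ p + ∑ i, ‖d i‖ₑ ^ p) := by gcongr
      _ = (‖c₀‖ₑ ^ p + ∑ i, ‖c i‖ₑ ^ p) + (‖d₀‖ₑ ^ p + ∑ i, ‖d i‖ₑ ^ p) := by ring
      _ ≤ _ := add_le_add h5 h5'
  rcases eq_or_ne (finNorm w p q s S) ∞ with hS | hS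
  · simp [hS, hp]
  rcases eq_or_ne (finNorm w p q s T) ∞ with hT | hT
  · simp [hT, hp]
  -- The infima need not be attained: enlarge both by `ε` and let `ε` decrease to `0`, which is
  -- legitimate once both are finite.
  have hc : Filter.Tendsto (fun ε : ℝ≥0∞ => (finNorm w p q s S + ε) ^ p +
      (finNorm w p q s T + ε) ^ p) (nhdsWithin 0 (Set.Ioi 0))
      (nhds (finNorm w p q s S ^ p + finNorm w p q s T ^ p)) := by
    have : Continuous fun ε : ℝ≥0∞ => (finNorm w p q s S + ε) ^ p +
      (finNorm w p q s T + ε) ^ p := by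
      have := ENNReal.continuous_rpow_const (y := p)
      fun_prop
    have h' := this.tendsto 0
    simp only [add_zero] at h'
    exact h'.mono_left nhdsWithin_le_nhds
  refine ge_of_tendsto hc ?_
  filter_upwards [self_mem_nhdsWithin] with ε hε
  exact key _ _ (ENNReal.lt_add_right hS hε.ne') (ENNReal.lt_add_right hT hε.ne')

lemma Admissible.finNorm_sum_rpow (h : Admissible w p q) (s : ℕ) {ι : Type*} (I : Finset ι)
    (T : ι → Distr n) :
    finNorm w p q s (∑ i ∈ I, T i) ^ p ≤ ∑ i ∈ I, finNorm w p q s (T i) ^ p := by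
  classical
  induction I using Finset.induction_on with
  | empty => simp [h.finNorm_zero, h.p_pos]
  | insert i I hi ih =>
    rw [Finset.sum_insert hi, Finset.sum_insert hi]
    exact (h.finNorm_add_rpow s _ _).trans (by gcongr)

lemma Admissible.finNorm_single_le (h : Admissible w p q) (s : ℕ) {a : E n → ℂ}
    (ha : IsSingleAtom w p q a) (c : ℂ) : finNorm w p q s (c • ofFun a) ≤ ‖c‖ₑ := by
  have := finNorm_le_of_rep (s := s) (ι := Empty) (c₀ := c) ha
    (c := fun i => i.elim) (a := fun i => i.elim) (fun i => i.elim)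
  simpa [← ENNReal.rpow_mul, h.p_pos.ne'] using this

lemma Admissible.finNorm_small_le (h : Admissible w p q) (s : ℕ) {a : E n → ℂ}
    (ha : IsSmallAtom w p q s a) (c : ℂ) : finNorm w p q s (c • ofFun a) ≤ ‖c‖ₑ := by
  have := finNorm_le_of_rep (s := s) (ι := Unit) (c₀ := 0) (isSingleAtom_zero (w := w) (p := p)
    (q := q)) (c := fun _ => c) (a := fun _ => a) (fun _ => ha)
  rw [zero_smul_distr, zero_add] at this
  simpa [← ENNReal.rpow_mul, h.p_pos.ne', h.p_pos] using this

lemma Admissible.eq_zero_of_eLpNorm (h : Admissible w p q) {a : E n → ℂ}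
    (ha : AEStronglyMeasurable a volume)
    (h0 : eLpNorm a (ENNReal.ofReal q) (wMeasure w) = 0) : a =ᵐ[volume] 0 := by
  rw [eLpNorm_eq_zero_iff (ha.mono_ac wMeasure_absolutelyContinuous)
    (by simpa using h.q_pos)] at h0
  exact h.isWeight.volume_absolutelyContinuous.ae_eq h0

/-- Normalization of a function of finite norm. -/
lemma exists_normalize {a : E n → ℂ} {W : ℝ≥0∞} (hW0 : W ≠ 0) (hWt : W ≠ ∞)
    (hfin : eLpNorm a (ENNReal.ofReal q) (wMeasure w) ≠ ∞)
    (h0 : eLpNorm a (ENNReal.ofReal q) (wMeasure w) ≠ 0) :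
    ∃ c : ℂ, c ≠ 0 ∧ ‖c‖ₑ = eLpNorm a (ENNReal.ofReal q) (wMeasure w) * W ^ (1 / p - 1 / q) ∧
      eLpNorm (c⁻¹ • a) (ENNReal.ofReal q) (wMeasure w) ≤ W ^ (1 / q - 1 / p) := by
  set A := eLpNorm a (ENNReal.ofReal q) (wMeasure w)
  have h1 : W ^ (1 / p - 1 / q) ≠ ∞ := by simp [ENNReal.rpow_eq_top_iff, hW0, hWt]
  have h2 : W ^ (1 / p - 1 / q) ≠ 0 := by simp [ENNReal.rpow_eq_zero_iff, hW0, hWt]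
  set B := A * W ^ (1 / p - 1 / q) with hB
  have hBt : B ≠ ∞ := ENNReal.mul_ne_top hfin h1
  have hB0 : B ≠ 0 := mul_ne_zero h0 h2
  have hn : ‖((B.toReal : ℝ) : ℂ)‖ₑ = B := by
    rw [← ofReal_norm, Complex.norm_real, Real.norm_of_nonneg ENNReal.toReal_nonneg,
      ENNReal.ofReal_toReal hBt]
  have hc : ((B.toReal : ℝ) : ℂ) ≠ 0 := by
    rw [← enorm_ne_zero, hn]; exact hB0
  refine ⟨(B.toReal : ℝ), hc, hn, ?_⟩
  rw [eLpNorm_const_smul, enorm_inv hc, hn, hB, ENNReal.mul_inv (Or.inl h0) (Or.inl hfin),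
    mul_comm, ← mul_assoc, ENNReal.mul_inv_cancel h0 hfin, one_mul, ← ENNReal.rpow_neg, neg_sub]

/-- Such a function is a scalar multiple of a small atom, the scalar being the right-hand side. -/
lemma Admissible.finNorm_ofFun_le (h : Admissible w p q) (s : ℕ) {a : E n → ℂ}
    (ha : AEStronglyMeasurable a volume) {x : E n} {t : ℝ} (ht : 0 < t) (ht2 : t ≤ 2)
    (hsupp : Function.support a ⊆ cube x t) (hmom : t < 1 → VanishingMoments s a) :
    finNorm w p q s (ofFun a) ≤ eLpNorm a (ENNReal.ofReal q) (wMeasure w) *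
      wMeasure w (cube x t) ^ (1 / p - 1 / q) := by
  have hW0 := (h.isWeight.wMeasure_cube_pos x ht).ne'
  have hWt := (h.isWeight.wMeasure_cube_lt_top x ht.le).ne
  rcases eq_or_ne (eLpNorm a (ENNReal.ofReal q) (wMeasure w)) 0 with h0 | h0
  · have := ofFun_congr (locallyIntegrable_zero (μ := volume)) (h.eq_zero_of_eLpNorm ha h0).symm
    rw [← this, show ofFun (fun _ : E n => (0 : ℂ)) = 0 from ofFun_zero, h.finNorm_zero]
    exact zero_le
  rcases eq_or_ne (eLpNorm a (ENNReal.ofReal q) (wMeasure w)) ∞ with hf | hf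
  · rw [hf, ENNReal.top_mul]
    · exact le_top
    · simp [ENNReal.rpow_eq_zero_iff, hW0, hWt]
  obtain ⟨c, hc, hcn, hcl⟩ := exists_normalize (p := p) hW0 hWt hf h0
  have hat : IsSmallAtom w p q s (c⁻¹ • a) := by
    refine ⟨x, t, ht, ht2, ha.const_smul _, ?_, hcl, ?_⟩
    · exact (Function.support_const_smul_subset _ _).trans hsupp
    · intro hv α hα
      have := hmom ((volume_cube_lt_one_iff h.one_le_dim x ht.le).mp hv) α hα
      simp only [Pi.smul_apply, smul_eq_mul, mul_assoc]
      rw [integral_const_mul, this, mul_zero]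
  have h2 := h.finNorm_small_le s hat c
  rw [ofFun_smul (h.locallyIntegrable ha hf.lt_top), smul_smul, mul_inv_cancel₀ hc, one_smul,
    hcn] at h2
  exact h2

/-- When `w(ℝⁿ)` is finite, every function in `L^q_w` is a multiple of a single atom. -/
lemma Admissible.finNorm_ofFun_le_univ (h : Admissible w p q) (s : ℕ) {a : E n → ℂ}
    (ha : AEStronglyMeasurable a volume) (hwfin : wMeasure w Set.univ ≠ ∞) :
    finNorm w p q s (ofFun a) ≤ eLpNorm a (ENNReal.ofReal q) (wMeasure w) *
      wMeasure w Set.univ ^ (1 / p - 1 / q) := by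
  have hW0 := h.univ_ne_zero
  rcases eq_or_ne (eLpNorm a (ENNReal.ofReal q) (wMeasure w)) 0 with h0 | h0
  · have := ofFun_congr (locallyIntegrable_zero (μ := volume)) (h.eq_zero_of_eLpNorm ha h0).symm
    rw [← this, show ofFun (fun _ : E n => (0 : ℂ)) = 0 from ofFun_zero, h.finNorm_zero]
    exact zero_le
  rcases eq_or_ne (eLpNorm a (ENNReal.ofReal q) (wMeasure w)) ∞ with hf | hf
  · rw [hf, ENNReal.top_mul]
    · exact le_top
    · simp [ENNReal.rpow_eq_zero_iff, hW0, hwfin]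
  obtain ⟨c, hc, hcn, hcl⟩ := exists_normalize (p := p) hW0 hwfin hf h0
  have h2 := h.finNorm_single_le s (⟨ha.const_smul _, hcl⟩ : IsSingleAtom w p q (c⁻¹ • a)) c
  rw [ofFun_smul (h.locallyIntegrable ha hf.lt_top), smul_smul, mul_inv_cancel₀ hc, one_smul,
    hcn] at h2
  exact h2

/-- The `L^q_w` norm is at most `L w(Q)^(1/q)`, and the exponents add up to `1/p`. In this form,
free of `q`, the pieces of the decomposition are counted. -/
lemma Admissible.finNorm_rpow_le_of_bounded (h : Admissible w p q) (s : ℕ) {a : E n → ℂ}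
    (ha : AEStronglyMeasurable a volume) {x : E n} {t : ℝ} (ht : 0 < t) (ht2 : t ≤ 2)
    (hsupp : Function.support a ⊆ cube x t) (hmom : t < 1 → VanishingMoments s a)
    {L : ℝ≥0∞} (hL : ∀ y, ‖a y‖ₑ ≤ L) :
    finNorm w p q s (ofFun a) ^ p ≤ L ^ p * wMeasure w (cube x t) := by
  have hW0 := (h.isWeight.wMeasure_cube_pos x ht).ne'
  have hWt := (h.isWeight.wMeasure_cube_lt_top x ht.le).ne
  set W := wMeasure w (cube x t)
  have h1 : eLpNorm a (ENNReal.ofReal q) (wMeasure w) ^ q ≤ L ^ q * W := by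
    rw [h.eLpNorm_rpow]
    calc _ ≤ ∫⁻ y, (cube x t).indicator (fun _ => L ^ q) y ∂(wMeasure w) := by
          refine lintegral_mono fun y => ?_
          by_cases hy : y ∈ cube x t
          · simp only [hy, Set.indicator_of_mem]
            exact ENNReal.rpow_le_rpow (hL y) h.q_pos.le
          · have : a y = 0 := by
              by_contra h0; exact hy (hsupp h0)
            simp [this, h.q_pos]
      _ = _ := by rw [lintegral_indicator_const (measurableSet_cube x t)]
  have h2 : eLpNorm a (ENNReal.ofReal q) (wMeasure w) ≤ L * W ^ (1 / q) := by
    rw [← ENNReal.rpow_le_rpow_iff h.q_pos, ENNReal.mul_rpow_of_nonneg _ _ h.q_pos.le,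
      ← ENNReal.rpow_mul, one_div_mul_cancel h.q_pos.ne', ENNReal.rpow_one]
    exact h1
  calc finNorm w p q s (ofFun a) ^ p
      ≤ (L * W ^ (1 / q) * W ^ (1 / p - 1 / q)) ^ p := by
        refine ENNReal.rpow_le_rpow ?_ h.p_pos.le
        exact (h.finNorm_ofFun_le s ha ht ht2 hsupp hmom).trans (by gcongr)
    _ = (L * W ^ (1 / p)) ^ p := by
        rw [mul_assoc, ← ENNReal.rpow_add _ _ hW0 hWt]
        congr 3; ring
    _ = _ := by
        rw [ENNReal.mul_rpow_of_nonneg _ _ h.p_pos.le, ← ENNReal.rpow_mul,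
          one_div_mul_cancel h.p_pos.ne', ENNReal.rpow_one]

end Basic

/-! ### The grand maximal function of a locally integrable function -/

section GrandMax
variable {n : ℕ} {w : E n → ℝ} {p q : ℝ}

lemma continuous_conv {κ : E n → ℝ} (hκ : Continuous κ) (hs : HasCompactSupport κ)
    {a : E n → ℂ} (ha : LocallyIntegrable a volume) :
    Continuous fun x => ∫ y, κ (x - y) • a y :=
  hs.continuous_convolution_right ((ContinuousLinearMap.lsmul ℝ ℝ : ℝ →L[ℝ] ℂ →L[ℝ] ℂ).flip) ha hκ

lemma integrable_conv {κ : E n → ℝ} (hκ : Continuous κ) (hs : HasCompactSupport κ)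
    {a : E n → ℂ} (ha : LocallyIntegrable a volume) (x : E n) :
    Integrable (fun y => κ (x - y) • a y) volume :=
  ha.integrable_smul_left_of_hasCompactSupport (hκ.comp (by fun_prop))
    (hs.comp_homeomorph (Homeomorph.subLeft x))

lemma continuous_convAt {a : E n → ℂ} (ha : LocallyIntegrable a volume) (φ : Test n) {t : ℝ}
    (ht : 0 < t) : Continuous (convAt (ofFun a) φ t ht) := by
  have h1 : Continuous fun z : E n => (t ^ n)⁻¹ * φ (t⁻¹ • z) :=
    continuous_const.mul (φ.contDiff.continuous.comp (by fun_prop))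
  have h2 : HasCompactSupport fun z : E n => (t ^ n)⁻¹ * φ (t⁻¹ • z) :=
    (φ.hasCompactSupport.comp_homeomorph
      (Homeomorph.smulOfNeZero t⁻¹ (inv_ne_zero ht.ne'))).mul_left
  have := continuous_conv h1 h2 ha
  convert this using 2 with x
  exact convAt_ofFun ha φ ht x

/-- A supremum of continuous functions. This gives both measurability and the openness of the
superlevel sets on which the decomposition is built. -/
lemma lowerSemicontinuous_grandMax {a : E n → ℂ} (ha : LocallyIntegrable a volume) (N : ℕ) :
    LowerSemicontinuous (grandMax N (ofFun a)) := by
  unfold grandMax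
  refine lowerSemicontinuous_iSup fun φ => lowerSemicontinuous_iSup fun _ =>
    lowerSemicontinuous_iSup fun t => lowerSemicontinuous_iSup fun ht => ?_
  exact (continuous_enorm.comp (continuous_convAt ha φ ht.1)).lowerSemicontinuous

lemma measurable_grandMax {a : E n → ℂ} (ha : LocallyIntegrable a volume) (N : ℕ) :
    Measurable (grandMax N (ofFun a)) := (lowerSemicontinuous_grandMax ha N).measurable

lemma abs_le_one_of_mem_D0 {N : ℕ} {φ : Test n} (hφ : φ ∈ D0 n N) (x : E n) : |φ x| ≤ 1 := by
  simpa using hφ.2.2 0 (Nat.zero_le _) Fin.elim0 x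

lemma eq_zero_of_mem_D0 {N : ℕ} {φ : Test n} (hφ : φ ∈ D0 n N) {x : E n} (hx : 1 ≤ ‖x‖) :
    φ x = 0 := by
  by_contra h
  have := hφ.1 (subset_tsupport _ h)
  rw [mem_ball_zero_iff] at this
  linarith

lemma dilate_eq_zero {N : ℕ} {φ : Test n} (hφ : φ ∈ D0 n N) {t : ℝ} (ht : 0 < t) {x y : E n}
    (hxy : t ≤ ‖x - y‖) : φ (t⁻¹ • (x - y)) = 0 := by
  apply eq_zero_of_mem_D0 hφ
  rw [norm_smul, norm_inv, Real.norm_of_nonneg ht.le, ← div_eq_inv_mul, one_le_div ht]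
  exact hxy

/-- The kernel is bounded by `t⁻ⁿ` and supported in the cube of side `2t`; the factor `2 ^ n` is the
volume of that cube divided by `t ^ n`. -/
lemma enorm_convAt_le {a : E n → ℂ} (ha : LocallyIntegrable a volume) {N : ℕ} {φ : Test n}
    (hφ : φ ∈ D0 n N) {t : ℝ} (ht : 0 < t) (x : E n) :
    ‖convAt (ofFun a) φ t ht x‖ₑ ≤
      (volume (cube x (2 * t)))⁻¹ * ∫⁻ y in cube x (2 * t), 2 ^ n * ‖a y‖ₑ := by
  rw [convAt_ofFun ha]
  refine (enorm_integral_le_lintegral_enorm _).trans ?_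
  have hv : (volume (cube x (2 * t)))⁻¹ * 2 ^ n = ENNReal.ofReal (t ^ n)⁻¹ := by
    rw [volume_cube x (by positivity), mul_pow, ENNReal.ofReal_mul (by positivity),
      ENNReal.mul_inv (by simp) (by simp), ENNReal.ofReal_inv_of_pos (by positivity)]
    rw [mul_comm, ← mul_assoc, ENNReal.ofReal_pow (by norm_num), ENNReal.ofReal_ofNat,
      ENNReal.mul_inv_cancel (by simp) (by simp), one_mul]
  calc ∫⁻ y, ‖((t ^ n)⁻¹ * φ (t⁻¹ • (x - y))) • a y‖ₑ
      ≤ ∫⁻ y, (cube x (2 * t)).indicator (fun y => ENNReal.ofReal (t ^ n)⁻¹ * ‖a y‖ₑ) y := by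
        refine lintegral_mono fun y => ?_
        by_cases hy : y ∈ cube x (2 * t)
        · simp only [hy, Set.indicator_of_mem]
          rw [enorm_smul]
          gcongr
          rw [Real.enorm_eq_ofReal_abs, abs_mul, abs_of_pos (by positivity : 0 < (t ^ n)⁻¹)]
          refine ENNReal.ofReal_le_ofReal ?_
          exact mul_le_of_le_one_right (by positivity) (abs_le_one_of_mem_D0 hφ _)
        · have : t ≤ ‖x - y‖ := by
            by_contra h
            apply hy
            apply ball_subset_cube x
            rw [mem_ball_iff_norm, norm_sub_rev]; linarith
          simp [dilate_eq_zero hφ ht this]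
    _ = ENNReal.ofReal (t ^ n)⁻¹ * ∫⁻ y in cube x (2 * t), ‖a y‖ₑ := by
        rw [lintegral_indicator (measurableSet_cube _ _),
          lintegral_const_mul'' _ ha.aestronglyMeasurable.enorm.restrict]
    _ = _ := by
        rw [lintegral_const_mul'' _ ha.aestronglyMeasurable.enorm.restrict, ← mul_assoc, hv]

lemma grandMax_le_maximal {a : E n → ℂ} (ha : LocallyIntegrable a volume) (N : ℕ) (x : E n) :
    grandMax N (ofFun a) x ≤ ⨆ (t : ℝ) (_ : 0 < t ∧ t ≤ 2),
      (volume (cube x t))⁻¹ * ∫⁻ y in cube x t, 2 ^ n * ‖a y‖ₑ := by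
  refine iSup₂_le fun φ hφ => iSup₂_le fun t ht => ?_
  exact le_iSup₂_of_le (2 * t) ⟨by linarith, by linarith⟩ (enorm_convAt_le ha hφ ht.1 x)

lemma Admissible.lintegral_grandMax_le (h : Admissible w p q) (N : ℕ) :
    ∃ C : ℝ≥0, ∀ a : E n → ℂ, LocallyIntegrable a volume →
      ∫⁻ x, grandMax N (ofFun a) x ^ q ∂(wMeasure w) ≤ C * ∫⁻ x, ‖a x‖ₑ ^ q ∂(wMeasure w) := by
  obtain ⟨C, hC⟩ := h.weight.maximal_bound h.critIndex_lt 2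
  refine ⟨C * ((2 ^ n : ℝ≥0) ^ q), fun a ha => ?_⟩
  have := hC (fun y => 2 ^ n * ‖a y‖ₑ) _ (ha.aestronglyMeasurable.enorm.const_mul _)
    (measurable_grandMax ha N) (grandMax_le_maximal ha N)
  refine this.trans (le_of_eq ?_)
  simp_rw [ENNReal.mul_rpow_of_nonneg _ _ h.q_pos.le]
  rw [lintegral_const_mul'' _ ((ha.aestronglyMeasurable.enorm.mono_ac
    wMeasure_absolutelyContinuous).pow_const _), ← mul_assoc, ENNReal.coe_mul,
    ENNReal.coe_rpow_of_nonneg _ h.q_pos.le]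
  simp

lemma grandMax_add_le (N : ℕ) (S T : Distr n) (x : E n) :
    grandMax N (S + T) x ≤ grandMax N S x + grandMax N T x := by
  refine iSup₂_le fun φ hφ => iSup₂_le fun t ht => ?_
  have h1 : convAt (S + T) φ t ht.1 x = convAt S φ t ht.1 x + convAt T φ t ht.1 x := rfl
  rw [h1]
  refine (enorm_add_le _ _).trans (add_le_add ?_ ?_)
  · exact le_iSup₂_of_le φ hφ (le_iSup₂_of_le t ht le_rfl)
  · exact le_iSup₂_of_le φ hφ (le_iSup₂_of_le t ht le_rfl)

lemma grandMax_smul (N : ℕ) (c : ℂ) (T : Distr n) (x : E n) :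
    grandMax N (c • T) x = ‖c‖ₑ * grandMax N T x := by
  have h1 : ∀ (φ : Test n) (t : ℝ) (ht : 0 < t), ‖convAt (c • T) φ t ht x‖ₑ =
      ‖c‖ₑ * ‖convAt T φ t ht x‖ₑ := fun φ t ht => enorm_smul c (convAt T φ t ht x)
  unfold grandMax
  simp_rw [h1, ENNReal.mul_iSup]

lemma hardyNorm_rpow (hp : 0 < p) (N : ℕ) (T : Distr n) :
    hardyNorm w p N T ^ p = ∫⁻ x, grandMax N T x ^ p ∂(wMeasure w) := by
  rw [hardyNorm, ← ENNReal.rpow_mul, one_div_mul_cancel hp.ne', ENNReal.rpow_one]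

lemma hardyNorm_smul (hp : 0 < p) (N : ℕ) (c : ℂ) (T : Distr n) :
    hardyNorm w p N (c • T) = ‖c‖ₑ * hardyNorm w p N T := by
  unfold hardyNorm
  simp_rw [grandMax_smul, ENNReal.mul_rpow_of_nonneg _ _ hp.le]
  rw [lintegral_const_mul' _ _ (ENNReal.rpow_ne_top_of_nonneg hp.le enorm_ne_top),
    ENNReal.mul_rpow_of_nonneg _ _ (by positivity), ← ENNReal.rpow_mul,
    mul_one_div_cancel hp.ne', ENNReal.rpow_one]

/-- Measurability of one summand is what allows the integral of the sum to be split. -/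
lemma hardyNorm_add_rpow (hp : 0 < p) (hp1 : p ≤ 1) (N : ℕ) {S T : Distr n}
    (hS : Measurable (grandMax N S)) :
    hardyNorm w p N (S + T) ^ p ≤ hardyNorm w p N S ^ p + hardyNorm w p N T ^ p := by
  rw [hardyNorm_rpow hp, hardyNorm_rpow hp, hardyNorm_rpow hp,
    ← lintegral_add_left (hS.pow_const p)]
  refine lintegral_mono fun x => ?_
  exact (ENNReal.rpow_le_rpow (grandMax_add_le N S T x) hp.le).trans
    (ENNReal.rpow_add_le_add_rpow _ _ hp.le hp1)

/-- The maximal function is local: the scales are below `1` and the test functions live in the unit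
ball. -/
lemma grandMax_eq_zero {a : E n → ℂ} (ha : LocallyIntegrable a volume) (N : ℕ) {x : E n}
    (h : ∀ y, ‖x - y‖ < 1 → a y = 0) : grandMax N (ofFun a) x = 0 := by
  rw [← nonpos_iff_eq_zero]
  refine iSup₂_le fun φ hφ => iSup₂_le fun t ht => ?_
  rw [convAt_ofFun ha]
  have : ∀ y, ((t ^ n)⁻¹ * φ (t⁻¹ • (x - y))) • a y = 0 := by
    intro y
    rcases lt_or_ge ‖x - y‖ 1 with h1 | h1
    · simp [h y h1]
    · simp [dilate_eq_zero hφ ht.1 (ht.2.le.trans h1)]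
  simp [this]

/-- Hölder's inequality for the maximal function on a set of finite measure. -/
lemma Admissible.setLIntegral_grandMax_le (h : Admissible w p q) (N : ℕ) :
    ∃ C : ℝ≥0, ∀ (a : E n → ℂ), AEStronglyMeasurable a volume → ∀ (S : Set (E n)) (W : ℝ≥0∞)
      (D : ℝ≥0), W ≠ 0 → W ≠ ∞ → wMeasure w S ≤ D * W →
      eLpNorm a (ENNReal.ofReal q) (wMeasure w) ≤ W ^ (1 / q - 1 / p) →
      (∫⁻ x in S, grandMax N (ofFun a) x ^ p ∂(wMeasure w)) ^ (q / p) ≤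
        C * (D : ℝ≥0∞) ^ (q / p - 1) := by
  obtain ⟨C, hC⟩ := h.lintegral_grandMax_le N
  refine ⟨C, fun a ha S W D hW0 hWt hD hsize => ?_⟩
  have hp := h.p_pos
  have hq := h.q_pos
  have hθ : 1 ≤ q / p := by
    rw [one_le_div hp]; exact h.p_le_one.trans h.one_lt_q.le
  have hla := h.locallyIntegrable ha (hsize.trans_lt
    (rpow_ne_top_of_ne_zero hW0 h.exponent_neg.le).lt_top)
  have h1 := rpow_lintegral_le (μ := (wMeasure w).restrict S)
    (g := fun x => grandMax N (ofFun a) x ^ p)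
    ((measurable_grandMax hla N).pow_const p).aemeasurable hθ
  simp_rw [← ENNReal.rpow_mul, mul_div_cancel₀ q hp.ne', Measure.restrict_apply_univ] at h1
  have h2 : ∫⁻ x, ‖a x‖ₑ ^ q ∂(wMeasure w) ≤ W ^ (1 - q / p) := by
    rw [← h.eLpNorm_rpow]
    refine (ENNReal.rpow_le_rpow hsize hq.le).trans (le_of_eq ?_)
    rw [← ENNReal.rpow_mul]
    congr 1; field_simp
  calc _ ≤ wMeasure w S ^ (q / p - 1) * ∫⁻ x in S, grandMax N (ofFun a) x ^ q ∂(wMeasure w) := h1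
    _ ≤ (D * W) ^ (q / p - 1) * (C * W ^ (1 - q / p)) := by
        refine mul_le_mul' (ENNReal.rpow_le_rpow hD (by linarith)) ?_
        refine (setLIntegral_le_lintegral _ _).trans ((hC a hla).trans ?_)
        exact mul_le_mul_right h2 _
    -- The powers of `W` have opposite exponents, so the bound sees the atom only through `D`.
    _ = C * (D : ℝ≥0∞) ^ (q / p - 1) * (W ^ (q / p - 1) * W ^ (1 - q / p)) := by
        rw [ENNReal.mul_rpow_of_nonneg _ _ (by linarith)]; ring
    _ = _ := by
        rw [← ENNReal.rpow_add _ _ hW0 hWt]; simp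

end GrandMax

/-! ### Moments and Taylor expansion -/

section Moments
variable {n : ℕ} {w : E n → ℝ} {p q : ℝ}

lemma integrable_mul_of_support {a : E n → ℂ} (ha : LocallyIntegrable a volume) {K : Set (E n)}
    (hK : IsCompact K) (hs : Function.support a ⊆ K) {g : E n → ℝ} (hg : Continuous g) :
    Integrable (fun y => a y * (g y : ℂ)) volume := by
  have h1 : IntegrableOn (fun y => a y * (g y : ℂ)) K volume :=
    (ha.integrableOn_isCompact hK).mul_continuousOn (by fun_prop) hK
  rwa [integrableOn_iff_integrable_of_support_subset] at h1
  intro y hy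
  exact hs fun h => hy (by simp [h])

/-- Linearity. Unlike the monomial form, the polynomial form is stable under the affine
substitutions needed for Taylor polynomials and translations. -/
lemma VanishingMoments.integral_eval {s : ℕ} {a : E n → ℂ} (hm : VanishingMoments s a)
    (ha : LocallyIntegrable a volume) {K : Set (E n)} (hK : IsCompact K)
    (hs : Function.support a ⊆ K) (P : MvPolynomial (Fin n) ℝ) (hP : P.totalDegree ≤ s) :
    ∫ y, a y * ((MvPolynomial.eval (fun i => y i) P : ℝ) : ℂ) = 0 := by
  have h1 : ∀ y : E n, a y * ((MvPolynomial.eval (fun i => y i) P : ℝ) : ℂ) =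
      ∑ m ∈ P.support, ((P.coeff m : ℝ) : ℂ) * (a y * ((∏ i, y i ^ m i : ℝ) : ℂ)) := by
    intro y
    rw [MvPolynomial.eval_eq', Complex.ofReal_sum, Finset.mul_sum]
    refine Finset.sum_congr rfl fun m _ => ?_
    push_cast; ring
  simp_rw [h1]
  rw [integral_finsetSum]
  · refine Finset.sum_eq_zero fun m hm' => ?_
    rw [integral_const_mul, hm m, mul_zero]
    have := (MvPolynomial.le_totalDegree hm').trans hP
    rwa [Finsupp.sum_fintype _ _ (fun _ => rfl)] at this
  · intro m _
    exact (integrable_mul_of_support ha hK hs (by fun_prop)).const_mul _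

/-- Multilinearity in the standard basis: this converts the bounds on partial derivatives in `D0`
into bounds in an arbitrary direction. -/
lemma iteratedFDeriv_eq_sum (φ : E n → ℝ) (k : ℕ) (z v : E n) :
    iteratedFDeriv ℝ k φ z (fun _ => v) = ∑ r : Fin k → Fin n, (∏ j, v (r j)) *
      iteratedFDeriv ℝ k φ z (fun j => EuclideanSpace.single (r j) (1 : ℝ)) := by
  have hv : v = ∑ i, v i • EuclideanSpace.single i (1 : ℝ) := by
    ext i
    simp [Finset.sum_apply, Pi.single_apply]
  conv_lhs => rw [hv]
  rw [ContinuousMultilinearMap.map_sum]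
  refine Finset.sum_congr rfl fun r _ => ?_
  rw [ContinuousMultilinearMap.map_smul_univ, smul_eq_mul]

lemma abs_iteratedFDeriv_le {N : ℕ} {φ : Test n} (hφ : φ ∈ D0 n N) {k : ℕ} (hk : k ≤ N + 1)
    (z v : E n) : |iteratedFDeriv ℝ k φ z (fun _ => v)| ≤ (∑ i, |v i|) ^ k := by
  rw [iteratedFDeriv_eq_sum]
  calc _ ≤ ∑ r : Fin k → Fin n, ∏ j, |v (r j)| := by
        refine (Finset.abs_sum_le_sum_abs _ _).trans (Finset.sum_le_sum fun r _ => ?_)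
        rw [abs_mul, Finset.abs_prod]
        exact mul_le_of_le_one_right (Finset.prod_nonneg fun _ _ => abs_nonneg _)
          (hφ.2.2 k hk r z)
    _ = _ := by
        have := Finset.prod_univ_sum (ι := Fin k) (fun _ => (Finset.univ : Finset (Fin n)))
          (fun _ i => |v i|)
        rw [Finset.prod_const, Finset.card_univ, Fintype.card_fin, Fintype.piFinset_univ] at this
        exact this.symm

/-- Taylor's formula with integral remainder; the order `m + 1 ≤ N + 1` is within the range
controlled by `D0`, and the factor `1 / m!` is discarded. -/
lemma taylor_bound {N m : ℕ} {φ : Test n} (hφ : φ ∈ D0 n N) (hm : m ≤ N) (z v : E n) :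
    |φ (z + v) - ∑ k ∈ Finset.range (m + 1),
      ((k.factorial : ℝ))⁻¹ • iteratedFDeriv ℝ k φ z (fun _ => v)| ≤ (∑ i, |v i|) ^ (m + 1) := by
  have h := map_add_eq_sum_add_integral_iteratedFDeriv (f := φ) (x := z) (y := v) (n := m)
    (fun t _ => (φ.contDiff.of_le (by exact_mod_cast le_top)).contDiffAt)
  rw [h, add_sub_cancel_left, smul_eq_mul, abs_mul]
  have h1 : |((m.factorial : ℝ))⁻¹| ≤ 1 := by
    rw [abs_of_nonneg (by positivity)]
    exact inv_le_one_of_one_le₀ (by exact_mod_cast Nat.one_le_iff_ne_zero.mpr (Nat.factorial_ne_zero m))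
  have h2 : |∫ t in (0 : ℝ)..1, (1 - t) ^ m • iteratedFDeriv ℝ (m + 1) φ (z + t • v)
      (fun _ => v)| ≤ (∑ i, |v i|) ^ (m + 1) := by
    have := intervalIntegral.norm_integral_le_of_norm_le_const (a := (0 : ℝ)) (b := 1)
      (f := fun t => (1 - t) ^ m • iteratedFDeriv ℝ (m + 1) φ (z + t • v) (fun _ => v))
      (C := (∑ i, |v i|) ^ (m + 1)) ?_
    · simpa using this
    intro t ht
    rw [Set.uIoc_of_le zero_le_one] at ht
    rw [norm_smul, Real.norm_eq_abs, Real.norm_eq_abs, abs_pow, abs_of_nonneg (by linarith [ht.2])]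
    have h3 := abs_iteratedFDeriv_le hφ (k := m + 1) (by omega) (z + t • v) v
    calc _ ≤ 1 * (∑ i, |v i|) ^ (m + 1) := by
          refine mul_le_mul (pow_le_one₀ (by linarith [ht.2]) (by linarith [ht.1])) h3
            (abs_nonneg _) zero_le_one
      _ = _ := one_mul _
  calc _ ≤ 1 * (∑ i, |v i|) ^ (m + 1) := mul_le_mul h1 h2 (abs_nonneg _) zero_le_one
    _ = _ := one_mul _

/-- As a function of `y`, the Taylor polynomial at `z` in the increment `c • (x₀ - y)` is a
polynomial of degree at most `m ≤ s`. -/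
lemma VanishingMoments.integral_taylor {s m : ℕ} {a : E n → ℂ} (hm : VanishingMoments s a)
    (hms : m ≤ s) (ha : LocallyIntegrable a volume) {K : Set (E n)} (hK : IsCompact K)
    (hs : Function.support a ⊆ K) (φ : E n → ℝ) (z x₀ : E n) (c : ℝ) :
    ∫ y, a y * ((∑ k ∈ Finset.range (m + 1), ((k.factorial : ℝ))⁻¹ •
      iteratedFDeriv ℝ k φ z (fun _ => c • (x₀ - y)) : ℝ) : ℂ) = 0 := by
  let P : MvPolynomial (Fin n) ℝ := ∑ k ∈ Finset.range (m + 1), ∑ r : Fin k → Fin n,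
    MvPolynomial.C (((k.factorial : ℝ))⁻¹ *
      iteratedFDeriv ℝ k φ z (fun j => EuclideanSpace.single (r j) (1 : ℝ))) *
    ∏ j, (MvPolynomial.C c * (MvPolynomial.C (x₀ (r j)) - MvPolynomial.X (r j)))
  have hdeg : P.totalDegree ≤ s := by
    refine MvPolynomial.totalDegree_finsetSum_le fun k hk => ?_
    refine MvPolynomial.totalDegree_finsetSum_le fun r _ => ?_
    refine (MvPolynomial.totalDegree_mul _ _).trans ?_
    rw [MvPolynomial.totalDegree_C, zero_add]
    refine (MvPolynomial.totalDegree_finsetProd _ _).trans ?_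
    have : ∀ j : Fin k, (MvPolynomial.C c * (MvPolynomial.C (x₀ (r j)) -
        MvPolynomial.X (r j)) : MvPolynomial (Fin n) ℝ).totalDegree ≤ 1 := by
      intro j
      refine (MvPolynomial.totalDegree_mul _ _).trans ?_
      rw [MvPolynomial.totalDegree_C, zero_add]
      refine (MvPolynomial.totalDegree_sub _ _).trans ?_
      simp
    calc _ ≤ ∑ _j : Fin k, 1 := Finset.sum_le_sum fun j _ => this j
      _ = k := by simp
      _ ≤ s := by have := Finset.mem_range.mp hk; omega
  have h := hm.integral_eval ha hK hs P hdeg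
  rw [← h]
  congr 1
  ext y
  congr 2
  simp only [P, map_sum, map_mul, map_prod, map_sub, MvPolynomial.eval_C, MvPolynomial.eval_X]
  refine Finset.sum_congr rfl fun k _ => ?_
  rw [iteratedFDeriv_eq_sum, Finset.smul_sum]
  refine Finset.sum_congr rfl fun r _ => ?_
  simp only [PiLp.smul_apply, PiLp.sub_apply, smul_eq_mul]
  ring

end Moments

/-! ### Uniform bounds for atoms -/

section AtomBound
variable {n : ℕ} {w : E n → ℝ} {p q : ℝ}

/-- The Taylor polynomial of `φ` at `t⁻¹ • (x - x₀)` may be subtracted for free. On the cube each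
coordinate of the increment is at most `l / t`, which gives the remainder `(n l / t)^(m+1)`. -/
lemma norm_convAt_le_of_moments {s m N : ℕ} (hms : m ≤ s) (hmN : m ≤ N) {a : E n → ℂ}
    (ha : LocallyIntegrable a volume) (hm : VanishingMoments s a) {x₀ : E n} {l : ℝ}
    (hl : 0 < l) (hs : Function.support a ⊆ cube x₀ l) {φ : Test n} (hφ : φ ∈ D0 n N) {t : ℝ}
    (ht : 0 < t) (x : E n) :
    ‖convAt (ofFun a) φ t ht x‖ ≤ (t ^ n)⁻¹ * (n * l / t) ^ (m + 1) * ∫ y, ‖a y‖ := by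
  set z := t⁻¹ • (x - x₀)
  set T : E n → ℝ := fun y => ∑ k ∈ Finset.range (m + 1),
    ((k.factorial : ℝ))⁻¹ • iteratedFDeriv ℝ k φ z (fun _ => t⁻¹ • (x₀ - y))
  have hK := isCompact_cube x₀ hl.le
  have hTc : Continuous T := by
    refine continuous_finsetSum _ fun k _ => ?_
    have : Continuous fun y : E n => iteratedFDeriv ℝ k φ z (fun _ => t⁻¹ • (x₀ - y)) :=
      (iteratedFDeriv ℝ k φ z).cont.comp (by fun_prop)
    exact this.const_smul ((k.factorial : ℝ))⁻¹
  have h0 : ∫ y, a y * ((T y : ℝ) : ℂ) = 0 :=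
    hm.integral_taylor hms ha hK hs φ z x₀ t⁻¹
  have h1 : convAt (ofFun a) φ t ht x =
      ((t ^ n)⁻¹ : ℝ) • ∫ y, a y * ((φ (t⁻¹ • (x - y)) - T y : ℝ) : ℂ) := by
    have hφc : Continuous fun y : E n => φ (t⁻¹ • (x - y)) :=
      φ.contDiff.continuous.comp (by fun_prop)
    have h2 : ∫ y, a y * ((φ (t⁻¹ • (x - y)) - T y : ℝ) : ℂ) =
        ∫ y, a y * ((φ (t⁻¹ • (x - y)) : ℝ) : ℂ) := by
      rw [← sub_zero (∫ y, a y * ((φ (t⁻¹ • (x - y)) : ℝ) : ℂ)), ← h0, ← integral_sub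
        (integrable_mul_of_support ha hK hs hφc) (integrable_mul_of_support ha hK hs hTc)]
      congr 1; ext y; push_cast; ring
    rw [h2, convAt_ofFun ha, ← integral_smul]
    congr 1; ext y
    simp only [Complex.real_smul]; push_cast; ring
  rw [h1, norm_smul, Real.norm_of_nonneg (by positivity), mul_assoc]
  refine mul_le_mul_of_nonneg_left ?_ (by positivity)
  rw [← integral_const_mul]
  have hai : Integrable a volume := by
    have := integrable_mul_of_support ha hK hs (g := fun _ => 1) continuous_const
    simpa using this
  refine norm_integral_le_of_norm_le (hai.norm.const_mul _) (Filter.Eventually.of_forall fun y => ?_)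
  rw [norm_mul, Complex.norm_real, mul_comm]
  by_cases hy : y ∈ cube x₀ l
  · refine mul_le_mul_of_nonneg_right ?_ (norm_nonneg _)
    have h3 := taylor_bound hφ hmN z (t⁻¹ • (x₀ - y))
    have h4 : z + t⁻¹ • (x₀ - y) = t⁻¹ • (x - y) := by
      rw [← smul_add]; congr 1; abel
    rw [h4] at h3
    refine h3.trans (pow_le_pow_left₀ (Finset.sum_nonneg fun _ _ => abs_nonneg _) ?_ _)
    calc ∑ i, |(t⁻¹ • (x₀ - y)) i| ≤ ∑ _i : Fin n, l / t := by
          refine Finset.sum_le_sum fun i _ => ?_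
          have := hy i
          rw [PiLp.smul_apply, PiLp.sub_apply, smul_eq_mul, abs_mul, abs_of_pos (by positivity),
            ← div_eq_inv_mul, abs_sub_comm]
          gcongr; linarith
      _ = n * l / t := by simp; ring
  · have : a y = 0 := by by_contra h; exact hy (hs h)
    simp [this]

/-- The decay of the grand maximal function of an atom away from its cube. -/
lemma grandMax_le_of_moments {s m N : ℕ} (hms : m ≤ s) (hmN : m ≤ N) {a : E n → ℂ}
    (ha : LocallyIntegrable a volume) (hm : VanishingMoments s a) {x₀ : E n} {l : ℝ}
    (hl : 0 < l) (hs : Function.support a ⊆ cube x₀ l) {x : E n} (hx : n * l ≤ ‖x - x₀‖)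
    (hx0 : 0 < ‖x - x₀‖) :
    grandMax N (ofFun a) x ≤ ENNReal.ofReal (2 ^ n * (2 * n) ^ (m + 1) * (l ^ n)⁻¹ *
      (l / ‖x - x₀‖) ^ (n + m + 1)) * ∫⁻ y, ‖a y‖ₑ := by
  have hai : Integrable a volume := by
    have := integrable_mul_of_support ha (isCompact_cube x₀ hl.le) hs (g := fun _ => 1)
      continuous_const
    simpa using this
  rw [← ofReal_integral_norm_eq_lintegral_enorm hai, ← ENNReal.ofReal_mul (by positivity)]
  refine iSup₂_le fun φ hφ => iSup₂_le fun t ht => ?_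
  rw [← ofReal_norm]
  refine ENNReal.ofReal_le_ofReal ?_
  set d := ‖x - x₀‖
  -- For `t ≥ d / 2` the moment estimate is worst at `t = d / 2`. For `t < d / 2` the dilated test
  -- function misses the cube, which lies within `n l / 2 ≤ d / 2` of its center.
  rcases le_or_gt (d / 2) t with htd | htd
  · refine (norm_convAt_le_of_moments hms hmN ha hm hl hs hφ ht.1 x).trans ?_
    refine mul_le_mul_of_nonneg_right ?_ (integral_nonneg fun _ => norm_nonneg _)
    calc (t ^ n)⁻¹ * (n * l / t) ^ (m + 1)
        ≤ ((d / 2) ^ n)⁻¹ * (n * l / (d / 2)) ^ (m + 1) := by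
          have := ht.1
          gcongr
      _ = 2 ^ n * (2 * n) ^ (m + 1) * ((l ^ n)⁻¹ * (l / d) ^ n) * (l / d) ^ (m + 1) := by
          have h1 : n * l / (d / 2) = 2 * n * (l / d) := by field_simp
          have h2 : (l ^ n)⁻¹ * (l / d) ^ n = (d ^ n)⁻¹ := by rw [div_pow]; field_simp
          rw [h1, h2, mul_pow _ (l / d), div_pow, inv_div]; ring
      _ = _ := by rw [add_assoc n m 1, pow_add (l / d) n]; ring
  · have : convAt (ofFun a) φ t ht.1 x = 0 := by
      rw [convAt_ofFun ha]
      have : ∀ y, ((t ^ n)⁻¹ * φ (t⁻¹ • (x - y))) • a y = 0 := by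
        intro y
        by_cases hy : y ∈ cube x₀ l
        · have h1 := cube_subset_closedBall x₀ hl.le hy
          rw [mem_closedBall_iff_norm] at h1
          have h2 : d ≤ ‖x - y‖ + ‖y - x₀‖ := norm_sub_le_norm_sub_add_norm_sub _ _ _
          rw [dilate_eq_zero hφ ht.1 (by linarith)]; simp
        · have : a y = 0 := by by_contra h; exact hy (hs h)
          simp [this]
      simp [this]
    rw [this, norm_zero]
    have : 0 ≤ ∫ y, ‖a y‖ := integral_nonneg fun _ => norm_nonneg _
    positivity

/-- The averaging inequality with exponent `q` turns the weighted size condition into an unweighted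
`L^1` bound of order `|Q| w(Q)^(-1/p)`. -/
lemma Admissible.lintegral_atom_le (h : Admissible w p q) :
    ∃ C : ℝ≥0, ∀ (s : ℕ) (x : E n) (t : ℝ) (a : E n → ℂ), 0 < t → t ≤ 2 →
      IsAtomOn w p q s x t a →
      ∫⁻ y, ‖a y‖ₑ ≤ C * ENNReal.ofReal (t ^ n) * wMeasure w (cube x t) ^ (-(1 / p)) := by
  obtain ⟨C, hC⟩ := h.weight.exists_avgBound h.critIndex_lt 2
  have hq := h.q_pos
  refine ⟨C ^ (1 / q), fun s x t a ht ht2 ha => ?_⟩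
  have hW0 := (h.isWeight.wMeasure_cube_pos x ht).ne'
  have hWt := (h.isWeight.wMeasure_cube_lt_top x ht.le).ne
  have h1 := hC x t ht ht2 (fun y => ‖a y‖ₑ) ha.1.enorm
  have h2 : ∫⁻ y in cube x t, ‖a y‖ₑ = ∫⁻ y, ‖a y‖ₑ := by
    refine setLIntegral_eq_of_support_subset fun y hy => ha.2 ?_
    simpa using hy
  rw [h2, volume_cube x ht.le] at h1
  set W := wMeasure w (cube x t)
  have h3 : ∫⁻ y in cube x t, ‖a y‖ₑ ^ q ∂(wMeasure w) ≤ W ^ (1 - q / p) := by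
    refine (setLIntegral_le_lintegral _ _).trans ?_
    rw [← h.eLpNorm_rpow]
    refine (ENNReal.rpow_le_rpow ha.size hq.le).trans (le_of_eq ?_)
    rw [← ENNReal.rpow_mul]
    congr 1; field_simp
  have h4 : (∫⁻ y, ‖a y‖ₑ) ^ q ≤ C * ENNReal.ofReal (t ^ n) ^ q * W ^ (-(q / p)) := by
    rw [← ENNReal.mul_le_mul_iff_right hW0 hWt]
    refine (h1.trans (mul_le_mul_right h3 _)).trans (le_of_eq ?_)
    rw [sub_eq_add_neg, ENNReal.rpow_add _ _ hW0 hWt, ENNReal.rpow_one]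
    ring
  rw [← ENNReal.rpow_le_rpow_iff hq, ENNReal.mul_rpow_of_nonneg _ _ hq.le,
    ENNReal.mul_rpow_of_nonneg _ _ hq.le, ENNReal.coe_rpow_of_nonneg _ (by positivity),
    ← ENNReal.rpow_mul, ← ENNReal.rpow_mul, one_div_mul_cancel hq.ne', ENNReal.rpow_one]
  refine h4.trans (le_of_eq ?_)
  congr 2; ring

/-- Inside a fixed enlargement of the cube, use Hölder's inequality and doubling. Outside, the decay
from the moments is a power of a minorant of the local maximal function of a multiple of the
indicator of the cube. -/
lemma Admissible.exists_atom_bound (h : Admissible w p q) {s N : ℕ}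
    (hs : ⌊(n : ℝ) * (critIndex w / p - 1)⌋ ≤ (s : ℤ)) (hN : critOrder w p ≤ N) :
    ∃ C : ℝ≥0, ∀ a : E n → ℂ, IsSmallAtom w p q s a →
      ∫⁻ x, grandMax N (ofFun a) x ^ p ∂(wMeasure w) ≤ C := by
  have hp := h.p_pos
  have hq := h.q_pos
  have hn1 : (1 : ℝ) ≤ n := by exact_mod_cast h.one_le_dim
  have hn0 : (0 : ℝ) < n := by linarith
  set m := ⌊(n : ℝ) * (critIndex w / p - 1)⌋₊ with hm
  have hms : m ≤ s := by
    have : (m : ℤ) ≤ s := by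
      rw [hm, Int.natCast_floor_eq_floor]
      · exact hs
      · refine mul_nonneg hn0.le ?_
        rw [sub_nonneg, one_le_div hp]
        exact h.p_le_one.trans h.weight.one_le_critIndex
    exact_mod_cast this
  have hmN : m ≤ N := by unfold critOrder at hN; omega
  -- Chosen so that the `p`-th power of `(t / |x - x₀|)^(n+m+1)` is the `r`-th power of `(t / |x -
  -- x₀|)^n`. The choice of `m` as a floor is exactly what makes `r` exceed the critical index.
  set r : ℝ := p * (n + m + 1) / n with hr
  have hrq : critIndex w < r := by
    have h1 : (n : ℝ) * (critIndex w / p - 1) < m + 1 := Nat.lt_floor_add_one _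
    rw [hr, lt_div_iff₀ hn0]
    have h2 : (n : ℝ) * (critIndex w / p) < n + m + 1 := by linarith
    calc critIndex w * n = p * (n * (critIndex w / p)) := by field_simp
      _ < _ := by gcongr
  have hr0 : 0 < r := by linarith [h.weight.one_le_critIndex]
  obtain ⟨D, hD⟩ := h.weight.exists_doubling (2 * n + 3) (by linarith) 2
  obtain ⟨C₁, hC₁⟩ := h.setLIntegral_grandMax_le N
  obtain ⟨C₃, hC₃⟩ := h.lintegral_atom_le
  -- The maximal function of the cube's indicator is tested on cubes of side `3 |x - x₀|`, where `|x
  -- - x₀| ≤ n + 1`.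
  obtain ⟨C₄, hC₄⟩ := h.weight.maximal_bound hrq (3 * (n + 1))
  set c : ℝ := 2 ^ n * (2 * n) ^ (m + 1)
  have hc : 0 ≤ c := by positivity
  set A : ℝ≥0∞ := (C₁ * (D : ℝ≥0∞) ^ (q / p - 1)) ^ (p / q)
  set K : ℝ≥0∞ := (ENNReal.ofReal c * C₃) ^ p
  set B : ℝ≥0∞ := K * (C₄ * ((3 : ℝ≥0∞) ^ n) ^ r)
  have hqp : 0 ≤ q / p - 1 := by
    rw [sub_nonneg, one_le_div hp]; exact h.p_le_one.trans h.one_lt_q.le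
  have hA : A ≠ ∞ := ENNReal.rpow_ne_top_of_nonneg (by positivity)
    (ENNReal.mul_ne_top (by simp) (ENNReal.rpow_ne_top_of_nonneg hqp (by simp)))
  have hB : B ≠ ∞ := ENNReal.mul_ne_top
    (ENNReal.rpow_ne_top_of_nonneg hp.le (ENNReal.mul_ne_top (by simp) (by simp)))
    (ENNReal.mul_ne_top (by simp) (ENNReal.rpow_ne_top_of_nonneg hr0.le (by simp)))
  refine ⟨(A + B).toNNReal, fun a ha => ?_⟩
  rw [ENNReal.coe_toNNReal (ENNReal.add_ne_top.mpr ⟨hA, hB⟩)]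
  have hla := ha.locallyIntegrable h
  obtain ⟨x₀, t, ht, ht2, ha⟩ := ha
  have hW0 := (h.isWeight.wMeasure_cube_pos x₀ ht).ne'
  have hWt := (h.isWeight.wMeasure_cube_lt_top x₀ ht.le).ne
  set W := wMeasure w (cube x₀ t) with hW
  set S := cube x₀ ((2 * n + 3) * t) with hS
  have hSm : MeasurableSet S := measurableSet_cube _ _
  have hfar : ∀ x ∉ S, n * t + t < ‖x - x₀‖ := by
    intro x hx
    have : ∃ i, (2 * n + 3) * t / 2 < |x i - x₀ i| := by
      by_contra hcon
      push Not at hcon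
      exact hx hcon
    obtain ⟨i, hi⟩ := this
    have h2 := abs_apply_le_norm (x - x₀) i
    rw [PiLp.sub_apply] at h2
    nlinarith
  have hnear : ∫⁻ x in S, grandMax N (ofFun a) x ^ p ∂(wMeasure w) ≤ A := by
    have h1 := hC₁ a ha.1 S W D hW0 hWt (hD x₀ t ht ht2) ha.size
    have h2 := ENNReal.rpow_le_rpow h1 (by positivity : 0 ≤ p / q)
    rwa [← ENNReal.rpow_mul, show q / p * (p / q) = 1 by field_simp, ENNReal.rpow_one] at h2
  set V : Set (E n) := Sᶜ ∩ {x | ‖x - x₀‖ ≤ n + 1} with hV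
  have hVm : MeasurableSet V := hSm.compl.inter
    (measurableSet_le (by fun_prop) measurable_const)
  set F : E n → ℝ≥0∞ := V.indicator fun x => ENNReal.ofReal ((t / ‖x - x₀‖) ^ n) with hF
  have hFm : Measurable F := by
    refine Measurable.indicator ?_ hVm
    fun_prop
  have hpt : ∀ x ∈ Sᶜ, grandMax N (ofFun a) x ^ p ≤ K * W⁻¹ * F x ^ r := by
    intro x hx
    have hd := hfar x hx
    have hd0 : 0 < ‖x - x₀‖ := lt_of_le_of_lt (by positivity) hd
    by_cases hzero : grandMax N (ofFun a) x = 0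
    · simp [hzero, hp]
    have hex : ∃ y, ‖x - y‖ < 1 ∧ y ∈ cube x₀ t := by
      by_contra hcon
      push Not at hcon
      refine hzero (grandMax_eq_zero hla N fun y hy => ?_)
      by_contra h0
      exact hcon y hy (ha.2 h0)
    obtain ⟨y, hy1, hy2⟩ := hex
    have hy3 := cube_subset_closedBall x₀ ht.le hy2
    rw [mem_closedBall_iff_norm] at hy3
    have hy4 : ‖x - x₀‖ ≤ ‖x - y‖ + ‖y - x₀‖ := norm_sub_le_norm_sub_add_norm_sub _ _ _
    -- A point outside `S` but within distance `1` of the cube satisfies `n t + t < |x - x₀| < 1 + n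
    -- t / 2`. So the moment conditions are available exactly where they are needed.
    have ht1 : t < 1 := by nlinarith
    have hxV : x ∈ V := ⟨hx, by show ‖x - x₀‖ ≤ n + 1; nlinarith⟩
    have hmom : VanishingMoments s a :=
      ha.moment ((volume_cube_lt_one_iff h.one_le_dim x₀ ht.le).mpr ht1)
    have h1 := grandMax_le_of_moments (N := N) hms hmN hla hmom ht ha.2 (x := x) (by linarith) hd0
    have h2 := hC₃ s x₀ t a ht ht2 ha
    set u := t / ‖x - x₀‖
    have hu : 0 < u := by positivity
    have h3 : grandMax N (ofFun a) x ≤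
        ENNReal.ofReal c * C₃ * (W ^ (-(1 / p)) * ENNReal.ofReal (u ^ (n + m + 1))) := by
      refine h1.trans ((mul_le_mul_right h2 _).trans (le_of_eq ?_))
      rw [ENNReal.ofReal_mul (by positivity), ENNReal.ofReal_mul (by positivity)]
      calc _ = (ENNReal.ofReal (t ^ n)⁻¹ * ENNReal.ofReal (t ^ n)) * (ENNReal.ofReal c * C₃ *
            (W ^ (-(1 / p)) * ENNReal.ofReal (u ^ (n + m + 1)))) := by ring
        _ = _ := by
            rw [← ENNReal.ofReal_mul (by positivity), inv_mul_cancel₀ (by positivity),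
              ENNReal.ofReal_one, one_mul]
    refine (ENNReal.rpow_le_rpow h3 hp.le).trans (le_of_eq ?_)
    rw [ENNReal.mul_rpow_of_nonneg _ _ hp.le, ENNReal.mul_rpow_of_nonneg (W ^ (-(1 / p))) _ hp.le,
      ← ENNReal.rpow_mul, neg_mul, one_div_mul_cancel hp.ne', ENNReal.rpow_neg_one]
    rw [hF, Set.indicator_of_mem hxV, mul_assoc]
    congr 2
    rw [ENNReal.ofReal_rpow_of_nonneg (by positivity) hp.le,
      ENNReal.ofReal_rpow_of_nonneg (by positivity) hr0.le, ← Real.rpow_natCast, ← Real.rpow_natCast,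
      ← Real.rpow_mul hu.le, ← Real.rpow_mul hu.le]
    congr 2
    rw [hr]; push_cast; field_simp
  have hFint : ∫⁻ x, F x ^ r ∂(wMeasure w) ≤ C₄ * ((3 : ℝ≥0∞) ^ n) ^ r * W := by
    have hQm := measurableSet_cube x₀ t
    have h1 := hC₄ ((cube x₀ t).indicator fun _ => (3 : ℝ≥0∞) ^ n) F
      (aemeasurable_const.indicator hQm) hFm ?_
    · refine h1.trans (le_of_eq ?_)
      have : ∀ x, ((cube x₀ t).indicator (fun _ => (3 : ℝ≥0∞) ^ n) x) ^ r =
          (cube x₀ t).indicator (fun _ => ((3 : ℝ≥0∞) ^ n) ^ r) x := by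
        intro x
        by_cases hx : x ∈ cube x₀ t <;> simp [hx, hr0]
      simp_rw [this]
      rw [lintegral_indicator_const hQm]; ring
    · intro x
      by_cases hx : x ∈ V
      · have hd := hfar x hx.1
        have hd0 : 0 < ‖x - x₀‖ := lt_of_le_of_lt (by positivity) hd
        have hle : ‖x - x₀‖ ≤ n + 1 := hx.2
        -- The cube of side `3 |x - x₀|` about `x` contains the atom's cube, and the average over it
        -- of `3 ^ n` times the indicator is exactly `(t / |x - x₀|)^n`.
        refine le_iSup₂_of_le (3 * ‖x - x₀‖) ⟨by positivity, by linarith⟩ ?_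
        rw [lintegral_indicator hQm, Measure.restrict_restrict hQm, Set.inter_eq_left.mpr]
        · rw [lintegral_const, Measure.restrict_apply_univ, volume_cube _ (by positivity),
            volume_cube _ ht.le, hF, Set.indicator_of_mem hx,
            ← ENNReal.ofReal_inv_of_pos (by positivity),
            show (3 : ℝ≥0∞) ^ n = ENNReal.ofReal (3 ^ n) by
              rw [ENNReal.ofReal_pow (by norm_num), ENNReal.ofReal_ofNat],
            ← ENNReal.ofReal_mul (by positivity), ← ENNReal.ofReal_mul (by positivity)]
          refine ENNReal.ofReal_le_ofReal (le_of_eq ?_)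
          rw [div_pow, mul_pow]; field_simp
        · refine cube_subset_cube fun i => ?_
          have h2 := abs_apply_le_norm (x₀ - x) i
          rw [PiLp.sub_apply, norm_sub_rev] at h2
          nlinarith
      · rw [hF, Set.indicator_of_notMem hx]; exact zero_le
  rw [← lintegral_add_compl _ hSm]
  refine add_le_add hnear ?_
  calc ∫⁻ x in Sᶜ, grandMax N (ofFun a) x ^ p ∂(wMeasure w)
      ≤ ∫⁻ x in Sᶜ, K * W⁻¹ * F x ^ r ∂(wMeasure w) := setLIntegral_mono' hSm.compl hpt
    _ ≤ ∫⁻ x, K * W⁻¹ * F x ^ r ∂(wMeasure w) := setLIntegral_le_lintegral _ _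
    _ = K * W⁻¹ * ∫⁻ x, F x ^ r ∂(wMeasure w) := lintegral_const_mul _ (hFm.pow_const _)
    _ ≤ K * W⁻¹ * (C₄ * ((3 : ℝ≥0∞) ^ n) ^ r * W) := mul_le_mul_right hFint _
    _ = (W⁻¹ * W) * B := by ring
    _ = B := by rw [ENNReal.inv_mul_cancel hW0 hWt, one_mul]

/-- Hölder's inequality on the whole space if `w(ℝⁿ)` is finite; otherwise a single atom vanishes
almost everywhere. -/
lemma Admissible.exists_single_bound (h : Admissible w p q) (N : ℕ) :
    ∃ C : ℝ≥0, ∀ a : E n → ℂ, IsSingleAtom w p q a →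
      ∫⁻ x, grandMax N (ofFun a) x ^ p ∂(wMeasure w) ≤ C := by
  obtain ⟨C₁, hC₁⟩ := h.setLIntegral_grandMax_le N
  have hp := h.p_pos
  have hq := h.q_pos
  refine ⟨C₁ ^ (p / q), fun a ha => ?_⟩
  rcases eq_or_ne (wMeasure w Set.univ) ∞ with hwt | hwt
  · have h0 : eLpNorm a (ENNReal.ofReal q) (wMeasure w) = 0 := by
      have := ha.size
      rwa [hwt, ENNReal.top_rpow_of_neg h.exponent_neg, nonpos_iff_eq_zero] at this
    have h1 : ofFun a = ofFun 0 :=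
      ofFun_congr (ha.locallyIntegrable h) (h.eq_zero_of_eLpNorm ha.1 h0)
    have h2 : ∀ x, grandMax N (ofFun a) x = 0 := fun x => by
      rw [h1]; exact grandMax_eq_zero locallyIntegrable_zero N fun _ _ => rfl
    simp [h2, hp]
  · have h1 := hC₁ a ha.1 Set.univ (wMeasure w Set.univ) 1 h.univ_ne_zero hwt (by simp) ha.size
    have h2 := ENNReal.rpow_le_rpow h1 (by positivity : 0 ≤ p / q)
    rw [← ENNReal.rpow_mul, show q / p * (p / q) = 1 by field_simp, ENNReal.rpow_one] at h2
    simpa [ENNReal.coe_rpow_of_nonneg _ (by positivity : 0 ≤ p / q)] using h2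

lemma Admissible.exists_hardyNorm_le (h : Admissible w p q) {s N : ℕ}
    (hs : ⌊(n : ℝ) * (critIndex w / p - 1)⌋ ≤ (s : ℤ)) (hN : critOrder w p ≤ N) :
    ∃ C : ℝ≥0, ∀ T : Distr n, hardyNorm w p N T ≤ C * finNorm w p q s T := by
  have hp := h.p_pos
  obtain ⟨C₁, hC₁⟩ := h.exists_atom_bound hs hN
  obtain ⟨C₂, hC₂⟩ := h.exists_single_bound N
  set C := C₁ + C₂
  have hC : ∀ (T : Distr n) (r : ℝ≥0∞), finNorm w p q s T < r →
      hardyNorm w p N T ≤ (C ^ (1 / p) : ℝ≥0) * r := by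
    intro T r hr
    obtain ⟨c₀, a₀, k, c, a, h0, h1, rfl, h2⟩ := exists_rep_of_finNorm_lt hr
    have hm : ∀ i, LocallyIntegrable (a i) volume := fun i => (h1 i).locallyIntegrable h
    have hsum : ∀ I : Finset (Fin k), hardyNorm w p N (∑ i ∈ I, c i • ofFun (a i)) ^ p ≤
        ∑ i ∈ I, C * ‖c i‖ₑ ^ p := by
      intro I
      induction I using Finset.induction_on with
      | empty =>
        have h3 := hardyNorm_smul (w := w) hp N 0 (0 : Distr n)
        rw [zero_smul_distr] at h3
        rw [Finset.sum_empty, Finset.sum_empty, h3, enorm_zero, zero_mul, ENNReal.zero_rpow_of_pos hp]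
      | insert i I hi ih =>
        rw [Finset.sum_insert hi, Finset.sum_insert hi]
        refine (hardyNorm_add_rpow hp h.p_le_one N ?_).trans (add_le_add ?_ ih)
        · rw [← ofFun_smul (hm i)]
          exact measurable_grandMax ((hm i).smul _) N
        · rw [hardyNorm_smul hp, ENNReal.mul_rpow_of_nonneg _ _ hp.le, hardyNorm_rpow hp, mul_comm]
          gcongr
          exact (hC₁ _ (h1 i)).trans (by exact_mod_cast le_self_add)
    have h3 : hardyNorm w p N (c₀ • ofFun a₀ + ∑ i, c i • ofFun (a i)) ^ p ≤
        C * (‖c₀‖ₑ ^ p + ∑ i, ‖c i‖ₑ ^ p) := by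
      refine (hardyNorm_add_rpow hp h.p_le_one N ?_).trans ?_
      · rw [← ofFun_smul (h0.locallyIntegrable h)]
        exact measurable_grandMax ((h0.locallyIntegrable h).smul _) N
      · rw [mul_add, Finset.mul_sum]
        refine add_le_add ?_ (hsum _)
        rw [hardyNorm_smul hp, ENNReal.mul_rpow_of_nonneg _ _ hp.le, hardyNorm_rpow hp, mul_comm]
        gcongr
        exact (hC₂ _ h0).trans (by exact_mod_cast le_add_self)
    have h4 := ENNReal.rpow_le_rpow h3 (by positivity : 0 ≤ 1 / p)
    rw [← ENNReal.rpow_mul, mul_one_div_cancel hp.ne', ENNReal.rpow_one,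
      ENNReal.mul_rpow_of_nonneg _ _ (by positivity)] at h4
    refine h4.trans ?_
    rw [ENNReal.coe_rpow_of_nonneg _ (by positivity)]
    gcongr
  -- The summand `1` keeps the constant nonzero, so that its product with an infinite `finNorm` is
  -- infinite.
  refine ⟨C ^ (1 / p) + 1, fun T => ?_⟩
  rcases eq_or_ne (finNorm w p q s T) ∞ with hT | hT
  · rw [hT, ENNReal.mul_top]
    · exact le_top
    · simp
  have hlim : Filter.Tendsto (fun r : ℝ≥0∞ => (C ^ (1 / p) : ℝ≥0) * r)
      (nhdsWithin (finNorm w p q s T) (Set.Ioi (finNorm w p q s T)))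
      (nhds ((C ^ (1 / p) : ℝ≥0) * finNorm w p q s T)) :=
    ((ENNReal.continuous_const_mul (by simp)).tendsto _).mono_left nhdsWithin_le_nhds
  have hne : (nhdsWithin (finNorm w p q s T) (Set.Ioi (finNorm w p q s T))).NeBot :=
    nhdsGT_neBot_of_exists_gt ⟨∞, hT.lt_top⟩
  have h5 : hardyNorm w p N T ≤ (C ^ (1 / p) : ℝ≥0) * finNorm w p q s T := by
    refine ge_of_tendsto hlim ?_
    filter_upwards [self_mem_nhdsWithin] with r hr
    exact hC T r hr
  refine h5.trans ?_
  gcongr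
  exact le_self_add

end AtomBound

/-! ### Mollifiers with vanishing moments -/

section Mollifier
variable {n : ℕ}

/-- The dilate `t⁻ⁿ φ(z / t)`. -/
def kern (φ : E n → ℝ) (t : ℝ) (z : E n) : ℝ := (t ^ n)⁻¹ * φ (t⁻¹ • z)

/-- A smooth function supported in the unit ball, of integral one, whose moments of orders
`1, …, s` vanish. -/
structure IsMollifier (s : ℕ) (φ : E n → ℝ) : Prop where
  contDiff : ContDiff ℝ ((⊤ : ℕ∞) : WithTop ℕ∞) φ
  eq_zero : ∀ z, 1 ≤ ‖z‖ → φ z = 0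
  integral_eq_one : ∫ z, φ z = 1
  moment : ∀ α : Fin n → ℕ, 1 ≤ ∑ i, α i → ∑ i, α i ≤ s → ∫ z, φ z * ∏ i, z i ^ α i = 0

lemma hasCompactSupport_of_eq_zero {φ : E n → ℝ} {r : ℝ} (h : ∀ z, r ≤ ‖z‖ → φ z = 0) :
    HasCompactSupport φ := by
  refine HasCompactSupport.of_support_subset_isCompact (isCompact_closedBall (0 : E n) r) ?_
  intro z hz
  rw [mem_closedBall_zero_iff]
  by_contra hcon
  exact hz (h z (not_le.mp hcon).le)

lemma IsMollifier.hasCompactSupport {s : ℕ} {φ : E n → ℝ} (h : IsMollifier s φ) :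
    HasCompactSupport φ := hasCompactSupport_of_eq_zero h.eq_zero

lemma continuous_kern {φ : E n → ℝ} (h : Continuous φ) (t : ℝ) : Continuous (kern φ t) := by
  unfold kern; exact continuous_const.mul (h.comp (by fun_prop))

lemma kern_eq_zero {φ : E n → ℝ} (h : ∀ z, 1 ≤ ‖z‖ → φ z = 0) {t : ℝ} (ht : 0 < t) {z : E n}
    (hz : t ≤ ‖z‖) : kern φ t z = 0 := by
  unfold kern
  rw [h, mul_zero]
  rw [norm_smul, norm_inv, Real.norm_of_nonneg ht.le, ← div_eq_inv_mul, one_le_div ht]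
  exact hz

lemma integral_kern_mul (φ : E n → ℝ) {t : ℝ} (ht : 0 < t) (g : E n → ℝ) :
    ∫ z, kern φ t z * g z = ∫ z, φ z * g (t • z) := by
  have h := Measure.integral_comp_inv_smul_of_nonneg volume (fun z : E n => φ z * g (t • z)) ht.le
  simp only [smul_inv_smul₀ ht.ne', finrank_euclideanSpace_fin] at h
  unfold kern
  simp_rw [mul_assoc]
  rw [integral_const_mul, h, smul_eq_mul, ← mul_assoc, inv_mul_cancel₀ (by positivity), one_mul]

lemma integral_abs_kern (φ : E n → ℝ) {t : ℝ} (ht : 0 < t) :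
    ∫ z, |kern φ t z| = ∫ z, |φ z| := by
  have h1 : ∀ z, |kern φ t z| = kern (fun z => |φ z|) t z * 1 := by
    intro z
    unfold kern
    rw [abs_mul, abs_of_pos (by positivity : 0 < (t ^ n)⁻¹), mul_one]
  simp_rw [h1]
  rw [integral_kern_mul _ ht (fun _ => 1)]
  simp

lemma integral_kern_monomial (φ : E n → ℝ) {t : ℝ} (ht : 0 < t) (α : Fin n → ℕ) :
    ∫ z, kern φ t z * ∏ i, z i ^ α i = t ^ (∑ i, α i) * ∫ z, φ z * ∏ i, z i ^ α i := by
  rw [integral_kern_mul φ ht, ← integral_const_mul]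
  congr 1; ext z
  have : ∏ i, (t • z) i ^ α i = t ^ (∑ i, α i) * ∏ i, z i ^ α i := by
    simp only [PiLp.smul_apply, smul_eq_mul, mul_pow]
    rw [Finset.prod_mul_distrib, Finset.prod_pow_eq_pow_sum]
  rw [this]; ring

/-- Richardson extrapolation. With `c = 2^(s+1)`, passing from `φ` to `(c φ_{1/2} - φ) / (c - 1)`
multiplies the moment of order `α` by `(c 2^(-|α|) - 1) / (c - 1)`: the integral is kept, the
moments already zero stay zero, and those of order `s + 1` are killed. -/
lemma exists_isMollifier (n s : ℕ) : ∃ φ : E n → ℝ, IsMollifier s φ := by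
  induction s with
  | zero =>
    let b : ContDiffBump (0 : E n) := ⟨1 / 2, 1, by norm_num, by norm_num⟩
    refine ⟨b.normed volume, b.contDiff_normed, fun z hz => ?_, b.integral_normed, ?_⟩
    · have : b z = 0 := b.zero_of_le_dist (by simpa using hz)
      simp [ContDiffBump.normed, this]
    · intro α h1 h2; omega
  | succ s ih =>
    obtain ⟨φ, hφ⟩ := ih
    have hh : (0 : ℝ) < 1 / 2 := by norm_num
    set c : ℝ := 2 ^ (s + 1) with hc
    have hc1 : 1 < c := one_lt_pow₀ (by norm_num) (by omega)
    have hc0 : c - 1 ≠ 0 := by linarith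
    have hgint : ∀ g : E n → ℝ, Continuous g → Integrable (fun z => φ z * g z) volume := fun g hg =>
      (hφ.contDiff.continuous.mul hg).integrable_of_hasCompactSupport hφ.hasCompactSupport.mul_right
    have hk0 : ∀ z : E n, 1 ≤ ‖z‖ → kern φ (1 / 2) z = 0 := fun z hz =>
      kern_eq_zero hφ.eq_zero hh (by linarith)
    have hgint' : ∀ g : E n → ℝ, Continuous g →
        Integrable (fun z => kern φ (1 / 2) z * g z) volume := fun g hg =>
      ((continuous_kern hφ.contDiff.continuous _).mul hg).integrable_of_hasCompactSupport
        (hasCompactSupport_of_eq_zero hk0).mul_right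
    have hmom : ∀ α : Fin n → ℕ, ∫ z, ((c - 1)⁻¹ * (c * kern φ (1 / 2) z - φ z)) *
        ∏ i, z i ^ α i = (c - 1)⁻¹ * (c * (1 / 2) ^ (∑ i, α i) - 1) *
          ∫ z, φ z * ∏ i, z i ^ α i := by
      intro α
      have h1 : ∀ z : E n, ((c - 1)⁻¹ * (c * kern φ (1 / 2) z - φ z)) * ∏ i, z i ^ α i =
          (c - 1)⁻¹ * c * (kern φ (1 / 2) z * ∏ i, z i ^ α i) -
            (c - 1)⁻¹ * (φ z * ∏ i, z i ^ α i) := fun z => by ring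
      simp_rw [h1]
      rw [integral_sub ((hgint' _ (by fun_prop)).const_mul _) ((hgint _ (by fun_prop)).const_mul _),
        integral_const_mul, integral_const_mul, integral_kern_monomial φ hh]
      ring
    refine ⟨fun z => (c - 1)⁻¹ * (c * kern φ (1 / 2) z - φ z), ?_, ?_, ?_, ?_⟩
    · have hk : ContDiff ℝ ((⊤ : ℕ∞) : WithTop ℕ∞) (kern φ (1 / 2)) := by
        unfold kern
        exact contDiff_const.mul (hφ.contDiff.comp (by fun_prop))
      exact contDiff_const.mul ((contDiff_const.mul hk).sub hφ.contDiff)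
    · intro z hz
      rw [hφ.eq_zero z hz, hk0 z hz]; simp
    · have := hmom 0
      simp only [Pi.zero_apply, pow_zero, Finset.prod_const_one, mul_one, Finset.sum_const_zero,
        hφ.integral_eq_one] at this
      rw [this, inv_mul_cancel₀ hc0]
    · intro α h1 h2
      rw [hmom]
      rcases h2.eq_or_lt with h3 | h3
      · rw [h3, hc, ← mul_pow]; norm_num
      · rw [hφ.moment α h1 (by omega), mul_zero]

/-- A mollifier as a test function. -/
def IsMollifier.test {s : ℕ} {φ : E n → ℝ} (h : IsMollifier s φ) : Test n where
  toFun := φ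
  contDiff' := h.contDiff
  hasCompactSupport' := h.hasCompactSupport
  tsupport_subset' := fun _ _ => trivial

/-- The test function `v ↦ c φ(K v + e)`. -/
def affineTest (φ : Test n) (c K : ℝ) (hK : K ≠ 0) (e : E n) : Test n where
  toFun v := c * φ (K • v + e)
  contDiff' := contDiff_const.mul (φ.contDiff.comp (by fun_prop))
  hasCompactSupport' := by
    have h : HasCompactSupport (fun v : E n => φ (K • v + e)) :=
      φ.hasCompactSupport.comp_homeomorph
        ((Homeomorph.smulOfNeZero K hK).trans (Homeomorph.addRight e))
    exact h.mul_left
  tsupport_subset' := fun _ _ => trivial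

lemma norm_iteratedFDeriv_affine (φ : Test n) (c K : ℝ) (hK : K ≠ 0) (e : E n) (k : ℕ) (v : E n) :
    ‖iteratedFDeriv ℝ k (affineTest φ c K hK e) v‖ =
      |c| * (|K| ^ k * ‖iteratedFDeriv ℝ k φ (K • v + e)‖) := by
  have h0 : (affineTest φ c K hK e : E n → ℝ) = c • fun v => (fun y => φ (y + e)) (K • v) := rfl
  have hc : ContDiff ℝ k (fun y => φ (y + e)) :=
    (φ.contDiff.of_le (by exact_mod_cast le_top)).comp (by fun_prop)
  have hc' : ContDiff ℝ k (fun v : E n => (fun y => φ (y + e)) (K • v)) :=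
    hc.comp (by fun_prop)
  rw [h0, iteratedFDeriv_const_smul_apply hc'.contDiffAt, norm_smul, Real.norm_eq_abs]
  congr 1
  rw [iteratedFDeriv_comp_const_smul K hc, norm_smul, norm_pow, Real.norm_eq_abs,
    iteratedFDeriv_comp_add_right]

lemma exists_bound_iteratedFDeriv (φ : Test n) (N : ℕ) :
    ∃ M : ℝ, 0 ≤ M ∧ ∀ k ≤ N, ∀ v, ‖iteratedFDeriv ℝ k φ v‖ ≤ M := by
  have h : ∀ k : ℕ, ∃ M : ℝ, ∀ v, ‖iteratedFDeriv ℝ k φ v‖ ≤ M := by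
    intro k
    have hc : Continuous (iteratedFDeriv ℝ k φ) :=
      φ.contDiff.continuous_iteratedFDeriv (by exact_mod_cast le_top)
    obtain ⟨M, hM⟩ := (φ.hasCompactSupport.iteratedFDeriv k).exists_bound_of_continuous hc
    exact ⟨M, hM⟩
  choose M hM using h
  refine ⟨∑ k ∈ Finset.range (N + 1), |M k|, Finset.sum_nonneg fun _ _ => abs_nonneg _,
    fun k hk v => ?_⟩
  refine ((hM k v).trans (le_abs_self _)).trans ?_
  exact Finset.single_le_sum (f := fun k => |M k|) (fun _ _ => abs_nonneg _)
    (Finset.mem_range.mpr (by omega))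

/-- The grand maximal function controls the convolutions with a fixed test function in a
nontangential way. -/
lemma exists_convAt_le (φ : Test n) (hφ : ∀ z, 1 ≤ ‖z‖ → φ z = 0) (hφi : ∫ z, φ z ≠ 0) (N : ℕ)
    {B : ℝ} (hB : 0 ≤ B) :
    ∃ C : ℝ≥0, ∀ (T : Distr n) (x z : E n) (t : ℝ) (ht : 0 < t), ‖x - z‖ ≤ B * t →
      (B + 2) * t < 1 → ‖convAt T φ t ht x‖ₑ ≤ C * grandMax N T z := by
  obtain ⟨M, hM0, hM⟩ := exists_bound_iteratedFDeriv φ (N + 1)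
  -- The function `φ_t(x - ·)` is rewritten as `c ψ_{Kt}(z - ·)`, where `ψ` is a shifted and
  -- contracted copy of `φ`. The shift `e` has length at most `B`, so `ψ` lives in the ball of
  -- radius `(B + 1) / K < 1`; the constant `c` normalizes its derivatives uniformly in `e`.
  set K : ℝ := B + 2 with hK
  have hK0 : 0 < K := by positivity
  have hK1 : 1 ≤ K := by linarith
  set c : ℝ := K ^ n * K ^ (N + 1) * (M + 1) with hc
  have hc0 : 0 < c := by positivity
  refine ⟨c.toNNReal, fun T x z t ht hxz htK => ?_⟩
  set e : E n := t⁻¹ • (x - z) with he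
  have hen : ‖e‖ ≤ B := by
    rw [he, norm_smul, norm_inv, Real.norm_of_nonneg ht.le, ← div_eq_inv_mul, div_le_iff₀ ht]
    exact hxz
  set ψ := affineTest φ (c⁻¹ * K ^ n) K hK0.ne' e with hψ
  have hψv : ∀ v, ψ v = c⁻¹ * K ^ n * φ (K • v + e) := fun v => rfl
  have hmem : ψ ∈ D0 n N := by
    refine ⟨?_, ?_, ?_⟩
    · have : tsupport ψ ⊆ Metric.closedBall 0 ((B + 1) / K) := by
        refine closure_minimal (fun v hv => ?_) Metric.isClosed_closedBall
        rw [mem_closedBall_zero_iff, le_div_iff₀ hK0]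
        by_contra hcon
        apply hv
        rw [hψv, hφ, mul_zero]
        have h1 : ‖K • v‖ ≤ ‖K • v + e‖ + ‖e‖ := by
          have := norm_sub_le (K • v + e) e
          rwa [add_sub_cancel_right] at this
        rw [norm_smul, Real.norm_of_nonneg hK0.le] at h1
        linarith
      refine this.trans (Metric.closedBall_subset_ball ?_)
      rw [div_lt_one hK0]; linarith
    · have h1 : ∫ v, ψ v = c⁻¹ * K ^ n * ((K ^ n)⁻¹ * ∫ v, φ v) := by
        simp_rw [hψv]
        rw [integral_const_mul]
        congr 1
        have h2 := Measure.integral_comp_smul_of_nonneg volume (fun v : E n => φ (v + e)) K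
          (hR := hK0.le)
        rw [h2, finrank_euclideanSpace_fin, smul_eq_mul, integral_add_right_eq_self (fun v => φ v)]
      rw [h1]
      have : (K ^ n)⁻¹ ≠ 0 := by positivity
      exact mul_ne_zero (by positivity) (mul_ne_zero this hφi)
    · intro k hk i v
      have h1 := (iteratedFDeriv ℝ k ψ v).le_opNorm
        (fun j => EuclideanSpace.single (i j) (1 : ℝ))
      simp only [PiLp.norm_single, norm_one, Finset.prod_const_one, mul_one] at h1
      rw [Real.norm_eq_abs] at h1
      refine h1.trans ?_
      rw [hψ, norm_iteratedFDeriv_affine, abs_of_pos (by positivity), abs_of_pos hK0]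
      calc c⁻¹ * K ^ n * (K ^ k * ‖iteratedFDeriv ℝ k φ (K • v + e)‖)
          ≤ c⁻¹ * K ^ n * (K ^ (N + 1) * (M + 1)) := by
            gcongr
            linarith [hM k hk (K • v + e)]
        _ = 1 := by rw [hc]; field_simp
  have heq : dilateAt φ x t ht = c • dilateAt ψ z (K * t) (by positivity) := by
    ext y
    change (t ^ n)⁻¹ * φ (t⁻¹ • (x - y)) =
      c * (((K * t) ^ n)⁻¹ * (c⁻¹ * K ^ n * φ (K • ((K * t)⁻¹ • (z - y)) + e)))
    have h1 : K • ((K * t)⁻¹ • (z - y)) + e = t⁻¹ • (x - y) := by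
      rw [smul_smul, mul_inv, ← mul_assoc, mul_inv_cancel₀ hK0.ne', one_mul, he, ← smul_add]
      congr 1; abel
    rw [h1, mul_pow]
    field_simp
  have h2 : convAt T φ t ht x = c • convAt T ψ (K * t) (by positivity) z := by
    unfold convAt
    rw [heq, map_smul]
  rw [h2, enorm_smul, Real.enorm_eq_ofReal hc0.le]
  gcongr
  · exact le_rfl
  · exact le_iSup₂_of_le ψ hmem (le_iSup₂_of_le (K * t) ⟨by positivity, htK⟩ le_rfl)

end Mollifier

/-! ### Iterated convolutions -/

section Conv
variable {n : ℕ}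

/-- The convolution of a kernel with a function. -/
def cv (κ : E n → ℝ) (a : E n → ℂ) (x : E n) : ℂ := ∫ y, κ (x - y) • a y

lemma continuous_cv {κ : E n → ℝ} (hκ : Continuous κ) (hs : HasCompactSupport κ)
    {a : E n → ℂ} (ha : LocallyIntegrable a volume) : Continuous (cv κ a) :=
  continuous_conv hκ hs ha

lemma cv_cv {κ κ' : E n → ℝ} (hκ : Continuous κ) (hκ' : Continuous κ') {r : ℝ}
    (hz : ∀ z, r ≤ ‖z‖ → κ z = 0) (hz' : ∀ z, r ≤ ‖z‖ → κ' z = 0)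
    {a : E n → ℂ} (ha : LocallyIntegrable a volume) (x : E n) :
    cv κ (cv κ' a) x = ∫ z, (∫ y, κ (x - y) * κ' (y - z)) • a z := by
  have hs := hasCompactSupport_of_eq_zero hz
  have hs' := hasCompactSupport_of_eq_zero hz'
  -- Only the values of `a` within `2 * r` of `x` enter; truncating there supplies the integrability
  -- for Fubini's theorem.
  set b : E n → ℂ := (Metric.closedBall x (2 * r)).indicator a with hb
  have hbi : Integrable b volume :=
    (integrable_indicator_iff Metric.isClosed_closedBall.measurableSet).mpr
      (ha.integrableOn_isCompact (isCompact_closedBall x (2 * r)))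
  have hab : ∀ y z, (κ (x - y) * κ' (y - z)) • a z = (κ (x - y) * κ' (y - z)) • b z := by
    intro y z
    by_cases hzm : z ∈ Metric.closedBall x (2 * r)
    · rw [hb, Set.indicator_of_mem hzm]
    · have h1 : 2 * r < ‖z - x‖ := by
        rw [mem_closedBall_iff_norm] at hzm; exact not_le.mp hzm
      have h2 : ‖z - x‖ ≤ ‖x - y‖ + ‖y - z‖ := by
        rw [norm_sub_rev z x]; exact norm_sub_le_norm_sub_add_norm_sub _ _ _
      rcases le_or_gt r ‖x - y‖ with h3 | h3
      · rw [hz _ h3]; simp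
      · rw [hz' (y - z) (by linarith)]; simp
  obtain ⟨M, hM⟩ := hs.exists_bound_of_continuous hκ
  have hi : Integrable (fun u : E n × E n => (κ (x - u.1) * κ' (u.1 - u.2)) • b u.2)
      (volume.prod volume) := by
    have h1 := hbi.convolution_integrand
      ((ContinuousLinearMap.lsmul ℝ ℝ : ℝ →L[ℝ] ℂ →L[ℝ] ℂ).flip)
      (hκ'.integrable_of_hasCompactSupport hs' (μ := volume))
    have h2 := h1.bdd_smul (φ := fun u : E n × E n => κ (x - u.1)) M
      (by have : Continuous fun u : E n × E n => κ (x - u.1) := hκ.comp (by fun_prop)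
          exact this.aestronglyMeasurable)
      (Filter.Eventually.of_forall fun u => hM _)
    refine h2.congr (Filter.Eventually.of_forall fun u => ?_)
    simp [mul_assoc]
  calc cv κ (cv κ' a) x = ∫ y, ∫ z, (κ (x - y) * κ' (y - z)) • b z := by
        unfold cv
        congr 1; ext y
        rw [← integral_smul]
        congr 1; ext z
        rw [smul_smul, hab]
    _ = ∫ z, ∫ y, (κ (x - y) * κ' (y - z)) • b z := integral_integral_swap hi
    _ = _ := by
        congr 1; ext z
        rw [← integral_smul_const]
        congr 1; ext y
        exact (hab y z).symm

/-- The reflection `y ↦ x + z - y` exchanges the two kernels in the composed kernel. -/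
lemma cv_comm {κ κ' : E n → ℝ} (hκ : Continuous κ) (hκ' : Continuous κ') {r : ℝ}
    (hz : ∀ z, r ≤ ‖z‖ → κ z = 0) (hz' : ∀ z, r ≤ ‖z‖ → κ' z = 0)
    {a : E n → ℂ} (ha : LocallyIntegrable a volume) (x : E n) :
    cv κ (cv κ' a) x = cv κ' (cv κ a) x := by
  rw [cv_cv hκ hκ' hz hz' ha, cv_cv hκ' hκ hz' hz ha]
  congr 1; ext z
  congr 1
  rw [← integral_sub_left_eq_self (fun y => κ (x - y) * κ' (y - z)) volume (x + z)]
  congr 1; ext y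
  rw [mul_comm]
  congr 2 <;> abel

lemma cv_sub_left {κ κ' : E n → ℝ} (hκ : Continuous κ) (hκ' : Continuous κ')
    (hs : HasCompactSupport κ) (hs' : HasCompactSupport κ') {a : E n → ℂ}
    (ha : LocallyIntegrable a volume) (x : E n) :
    cv (fun z => κ z - κ' z) a x = cv κ a x - cv κ' a x := by
  unfold cv
  rw [← integral_sub (integrable_conv hκ hs ha x) (integrable_conv hκ' hs' ha x)]
  simp [sub_smul]

lemma cv_add_right {κ : E n → ℝ} (hκ : Continuous κ)
    (hs : HasCompactSupport κ) {a b : E n → ℂ}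
    (ha : LocallyIntegrable a volume) (hb : LocallyIntegrable b volume) (x : E n) :
    cv κ (fun y => a y + b y) x = cv κ a x + cv κ b x := by
  unfold cv
  rw [← integral_add (integrable_conv hκ hs ha x) (integrable_conv hκ hs hb x)]
  simp [smul_add]

lemma norm_cv_le {κ : E n → ℝ} (hκ : Integrable κ volume) {a : E n → ℂ} {x : E n} {r M : ℝ}
    (hz : ∀ z, r ≤ ‖z‖ → κ z = 0) (h : ∀ y, ‖x - y‖ < r → ‖a y‖ ≤ M) :
    ‖cv κ a x‖ ≤ M * ∫ z, |κ z| := by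
  have h1 : ∫ y, |κ (x - y)| = ∫ z, |κ z| := integral_sub_left_eq_self (fun z => |κ z|) volume x
  rw [← h1, ← integral_const_mul]
  refine norm_integral_le_of_norm_le ((hκ.comp_sub_left x).abs.const_mul _)
    (Filter.Eventually.of_forall fun y => ?_)
  rw [norm_smul, Real.norm_eq_abs]
  rcases lt_or_ge ‖x - y‖ r with h2 | h2
  · rw [mul_comm]
    exact mul_le_mul_of_nonneg_right (h y h2) (abs_nonneg _)
  · simp [hz _ h2]

/-- Convolution with a kernel with vanishing moments produces vanishing moments. -/
lemma vanishingMoments_cv {s : ℕ} {κ : E n → ℝ} (hκ : Continuous κ) {r : ℝ}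
    (hz : ∀ z, r ≤ ‖z‖ → κ z = 0) (hm : VanishingMoments s fun z => (κ z : ℂ))
    {a : E n → ℂ} (ha : Integrable a volume) {R : ℝ} (hR : ∀ y, R < ‖y‖ → a y = 0) :
    VanishingMoments s (cv κ a) := by
  intro α hα
  have hs := hasCompactSupport_of_eq_zero hz
  set m : E n → ℝ := fun x => ∏ i, x i ^ α i with hmdef
  have hmc : Continuous m := by fun_prop
  set K := Metric.closedBall (0 : E n) (R + r)
  have hK : IsCompact K := isCompact_closedBall _ _
  -- The convolution is supported in `K`, so the monomial may be truncated there; boundedness is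
  -- needed for Fubini's theorem.
  set b : E n → ℝ := K.indicator m with hb
  obtain ⟨M, hM⟩ := hK.exists_bound_of_continuousOn hmc.continuousOn
  have hbM : ∀ x, ‖b x‖ ≤ |M| := by
    intro x
    by_cases hx : x ∈ K
    · rw [hb, Set.indicator_of_mem hx]; exact (hM x hx).trans (le_abs_self _)
    · rw [hb, Set.indicator_of_notMem hx]; simp
  have hmb : ∀ x y, (κ (x - y) • a y) * (m x : ℂ) = b x • (κ (x - y) • a y) := by
    intro x y
    by_cases hx : x ∈ K
    · rw [hb, Set.indicator_of_mem hx, mul_comm, Complex.real_smul]; simp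
    · rw [hb, Set.indicator_of_notMem hx, zero_smul]
      have h1 : R + r < ‖x‖ := by
        by_contra hc; exact hx (mem_closedBall_zero_iff.mpr (not_lt.mp hc))
      have h2 : ‖x‖ ≤ ‖x - y‖ + ‖y‖ := by
        have := norm_add_le (x - y) y; rwa [sub_add_cancel] at this
      rcases le_or_gt r ‖x - y‖ with h3 | h3
      · simp [hz _ h3]
      · simp [hR y (by linarith)]
  have hi : Integrable (fun u : E n × E n => b u.1 • (κ (u.1 - u.2) • a u.2))
      (volume.prod volume) := by
    have h1 := ha.convolution_integrand
      ((ContinuousLinearMap.lsmul ℝ ℝ : ℝ →L[ℝ] ℂ →L[ℝ] ℂ).flip)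
      (hκ.integrable_of_hasCompactSupport hs (μ := volume))
    refine h1.bdd_smul (φ := fun u : E n × E n => b u.1) |M| ?_
      (Filter.Eventually.of_forall fun u => hbM _)
    have : Measurable b := hmc.measurable.indicator hK.measurableSet
    exact (this.comp measurable_fst).aestronglyMeasurable
  have hzero : ∀ y, ∫ x, ((κ (x - y) : ℝ) : ℂ) * ((m x : ℝ) : ℂ) = 0 := by
    intro y
    -- A translate of a monomial is a polynomial of the same degree, so it is annihilated by the
    -- kernel.
    let P : MvPolynomial (Fin n) ℝ := ∏ i, (MvPolynomial.X i + MvPolynomial.C (y i)) ^ α i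
    have hdeg : P.totalDegree ≤ s := by
      refine (MvPolynomial.totalDegree_finsetProd _ _).trans (le_trans ?_ hα)
      refine Finset.sum_le_sum fun i _ => ?_
      refine (MvPolynomial.totalDegree_pow _ _).trans ?_
      have : (MvPolynomial.X i + MvPolynomial.C (y i) : MvPolynomial (Fin n) ℝ).totalDegree ≤ 1 :=
        (MvPolynomial.totalDegree_add _ _).trans (by simp)
      calc _ ≤ α i * 1 := Nat.mul_le_mul_left _ this
        _ = α i := mul_one _
    have hκc : Continuous fun z => ((κ z : ℝ) : ℂ) := by fun_prop
    have hev := hm.integral_eval hκc.locallyIntegrable hs.isCompact (fun z hz' => by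
      refine subset_tsupport κ ?_
      simpa using hz') P hdeg
    rw [← hev, ← integral_sub_right_eq_self
      (fun z => ((κ z : ℝ) : ℂ) * ((MvPolynomial.eval (fun i => z i) P : ℝ) : ℂ)) y]
    congr 1; ext x
    congr 2
    simp [P, hmdef]
  calc ∫ x, cv κ a x * ((∏ i, x i ^ α i : ℝ) : ℂ)
      = ∫ x, ∫ y, b x • (κ (x - y) • a y) := by
        congr 1; ext x
        unfold cv
        rw [← integral_mul_const]
        congr 1; ext y
        exact hmb x y
    _ = ∫ y, ∫ x, b x • (κ (x - y) • a y) := integral_integral_swap hi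
    _ = ∫ _y : E n, (0 : ℂ) := by
        congr 1; ext y
        have : ∀ x, b x • (κ (x - y) • a y) = (((κ (x - y) : ℝ) : ℂ) * ((m x : ℝ) : ℂ)) * a y := by
          intro x
          rw [← hmb, Complex.real_smul]; ring
        simp_rw [this]
        rw [integral_mul_const, hzero, zero_mul]
    _ = 0 := by simp

end Conv

/-! ### The discrete reproducing formula -/

section Reproducing
variable {n : ℕ} {s : ℕ} {φ : E n → ℝ}

/-- The difference of two consecutive dyadic dilates. -/
def diffKern (φ : E n → ℝ) (j : ℕ) (z : E n) : ℝ :=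
  kern φ ((1 / 2) ^ (j + 1)) z - kern φ ((1 / 2) ^ j) z

/-- The mean of `f` at scale `2⁻ʲ`. -/
def mean (φ : E n → ℝ) (f : E n → ℂ) (j : ℕ) : E n → ℂ := cv (kern φ ((1 / 2) ^ j)) f

/-- The sum of the means of `f` at two consecutive scales. -/
def meanSum (φ : E n → ℝ) (f : E n → ℂ) (j : ℕ) (y : E n) : ℂ := mean φ f (j + 1) y + mean φ f j y

/-- The twofold mean of `f` at scale `2⁻ʲ`. -/
def mean₂ (φ : E n → ℝ) (f : E n → ℂ) (j : ℕ) : E n → ℂ :=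
  cv (kern φ ((1 / 2) ^ j)) (mean φ f j)

lemma half_pow_pos (j : ℕ) : (0 : ℝ) < (1 / 2) ^ j := by positivity

lemma half_pow_succ (j : ℕ) : (1 / 2 : ℝ) ^ (j + 1) = (1 / 2) ^ j / 2 := by rw [pow_succ]; ring

lemma IsMollifier.kern_zero (h : IsMollifier s φ) {j : ℕ} {z : E n} (hz : (1 / 2) ^ j ≤ ‖z‖) :
    kern φ ((1 / 2) ^ j) z = 0 := kern_eq_zero h.eq_zero (half_pow_pos j) hz

lemma IsMollifier.kern_succ_zero (h : IsMollifier s φ) {j : ℕ} {z : E n}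
    (hz : (1 / 2) ^ j ≤ ‖z‖) : kern φ ((1 / 2) ^ (j + 1)) z = 0 :=
  h.kern_zero (by rw [half_pow_succ]; linarith [half_pow_pos j])

lemma IsMollifier.kern_cont (h : IsMollifier s φ) (t : ℝ) : Continuous (kern φ t) :=
  continuous_kern h.contDiff.continuous t

lemma IsMollifier.kern_compact (h : IsMollifier s φ) (j : ℕ) :
    HasCompactSupport (kern φ ((1 / 2) ^ j)) := hasCompactSupport_of_eq_zero fun _ => h.kern_zero

lemma IsMollifier.diffKern_zero (h : IsMollifier s φ) {j : ℕ} {z : E n}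
    (hz : (1 / 2) ^ j ≤ ‖z‖) : diffKern φ j z = 0 := by
  rw [diffKern, h.kern_zero hz, h.kern_succ_zero hz, sub_zero]

lemma IsMollifier.diffKern_cont (h : IsMollifier s φ) (j : ℕ) : Continuous (diffKern φ j) :=
  (h.kern_cont _).sub (h.kern_cont _)

lemma IsMollifier.diffKern_compact (h : IsMollifier s φ) (j : ℕ) :
    HasCompactSupport (diffKern φ j) := hasCompactSupport_of_eq_zero fun _ => h.diffKern_zero

lemma IsMollifier.kern_integrable (h : IsMollifier s φ) (j : ℕ) :
    Integrable (kern φ ((1 / 2) ^ j)) volume :=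
  (h.kern_cont _).integrable_of_hasCompactSupport (h.kern_compact j)

lemma IsMollifier.diffKern_integrable (h : IsMollifier s φ) (j : ℕ) :
    Integrable (diffKern φ j) volume :=
  (h.diffKern_cont _).integrable_of_hasCompactSupport (h.diffKern_compact j)

lemma IsMollifier.integral_abs_diffKern_le (h : IsMollifier s φ) (j : ℕ) :
    ∫ z, |diffKern φ j z| ≤ 2 * ∫ z, |φ z| := by
  calc ∫ z, |diffKern φ j z|
      ≤ ∫ z, (|kern φ ((1 / 2) ^ (j + 1)) z| + |kern φ ((1 / 2) ^ j) z|) := by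
        refine integral_mono (h.diffKern_integrable j).abs
          ((h.kern_integrable _).abs.add (h.kern_integrable _).abs) fun z => ?_
        exact abs_sub _ _
    _ = _ := by
        rw [integral_add (h.kern_integrable _).abs (h.kern_integrable _).abs,
          integral_abs_kern _ (half_pow_pos _), integral_abs_kern _ (half_pow_pos _)]
        ring

/-- In order zero the two dilates have equal integrals and cancel; in orders `1, …, s` each moment
vanishes separately. -/
lemma IsMollifier.vanishingMoments_diffKern (h : IsMollifier s φ) (j : ℕ) :
    VanishingMoments s fun z => (diffKern φ j z : ℂ) := by
  intro α hα
  have h1 : ∀ z : E n, (diffKern φ j z : ℂ) * ((∏ i, z i ^ α i : ℝ) : ℂ) =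
      ((diffKern φ j z * ∏ i, z i ^ α i : ℝ) : ℂ) := fun z => by push_cast; ring
  simp_rw [h1]
  rw [integral_complex_ofReal, Complex.ofReal_eq_zero]
  have hi : ∀ j : ℕ, Integrable (fun z : E n => kern φ ((1 / 2) ^ j) z * ∏ i, z i ^ α i)
      volume := fun j =>
    ((h.kern_cont _).mul (by fun_prop)).integrable_of_hasCompactSupport (h.kern_compact j).mul_right
  simp_rw [diffKern, sub_mul]
  rw [integral_sub (hi _) (hi _), integral_kern_monomial φ (half_pow_pos _),
    integral_kern_monomial φ (half_pow_pos _)]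
  rcases Nat.eq_zero_or_pos (∑ i, α i) with h0 | h0
  · rw [h0]; ring
  · rw [h.moment α h0 hα]; ring

lemma IsMollifier.continuous_mean (h : IsMollifier s φ) {f : E n → ℂ}
    (hf : LocallyIntegrable f volume) (j : ℕ) : Continuous (mean φ f j) :=
  continuous_cv (h.kern_cont _) (h.kern_compact j) hf

lemma IsMollifier.continuous_meanSum (h : IsMollifier s φ) {f : E n → ℂ}
    (hf : LocallyIntegrable f volume) (j : ℕ) : Continuous (meanSum φ f j) :=
  (h.continuous_mean hf _).add (h.continuous_mean hf _)

lemma IsMollifier.continuous_mean₂ (h : IsMollifier s φ) {f : E n → ℂ}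
    (hf : LocallyIntegrable f volume) (j : ℕ) : Continuous (mean₂ φ f j) :=
  continuous_cv (h.kern_cont _) (h.kern_compact j) (h.continuous_mean hf j).locallyIntegrable

/-- Difference of squares, `(P_{j+1} - P_j)(P_{j+1} + P_j) = P_{j+1}² - P_j²`, because convolutions
commute. The cancellation sits in the outer kernel, so the inner function can be cut without losing
moments. -/
lemma IsMollifier.cv_diffKern (h : IsMollifier s φ) {f : E n → ℂ}
    (hf : LocallyIntegrable f volume) (j : ℕ) (x : E n) :
    cv (diffKern φ j) (meanSum φ f j) x = mean₂ φ f (j + 1) x - mean₂ φ f j x := by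
  have h1 := (h.continuous_mean hf j).locallyIntegrable (μ := volume)
  have h2 := (h.continuous_mean hf (j + 1)).locallyIntegrable (μ := volume)
  have h3 : ∀ k, mean φ f k = cv (kern φ ((1 / 2) ^ k)) f := fun _ => rfl
  have h4 := cv_comm (h.kern_cont ((1 / 2) ^ (j + 1))) (h.kern_cont ((1 / 2) ^ j))
    (fun z => h.kern_succ_zero (z := z)) (fun z => h.kern_zero (z := z)) hf x
  have h5 : cv (diffKern φ j) (meanSum φ f j) x =
      cv (kern φ ((1 / 2) ^ (j + 1))) (meanSum φ f j) x - cv (kern φ ((1 / 2) ^ j)) (meanSum φ f j) x :=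
    cv_sub_left (h.kern_cont _) (h.kern_cont _) (h.kern_compact _) (h.kern_compact _)
      (h.continuous_meanSum hf j).locallyIntegrable x
  have h6 : ∀ k, cv (kern φ ((1 / 2) ^ k)) (meanSum φ f j) x =
      cv (kern φ ((1 / 2) ^ k)) (mean φ f (j + 1)) x + cv (kern φ ((1 / 2) ^ k)) (mean φ f j) x :=
    fun k => cv_add_right (h.kern_cont _) (h.kern_compact _) h2 h1 x
  rw [h5, h6, h6, mean₂, mean₂, h3 j, h3 (j + 1), h4]
  ring

lemma IsMollifier.integral_kern (h : IsMollifier s φ) (j : ℕ) :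
    ∫ z, kern φ ((1 / 2) ^ j) z = 1 := by
  have := integral_kern_mul φ (half_pow_pos j) (fun _ => 1)
  simpa [h.integral_eq_one] using this

lemma IsMollifier.cv_kern_const (h : IsMollifier s φ) (j : ℕ) (c : ℂ) (x : E n) :
    cv (kern φ ((1 / 2) ^ j)) (fun _ => c) x = c := by
  unfold cv
  rw [integral_smul_const, integral_sub_left_eq_self (kern φ ((1 / 2) ^ j)) volume x,
    h.integral_kern, one_smul]

/-- At a Lebesgue point the error is at most a constant times the mean of `|f - f(x)|` over the ball
of radius `2 · 2⁻ʲ`, the reach of two successive convolutions. -/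
lemma IsMollifier.tendsto_mean₂ (h : IsMollifier s φ) {f : E n → ℂ}
    (hf : LocallyIntegrable f volume) :
    ∀ᵐ x, Filter.Tendsto (fun j => mean₂ φ f j x) Filter.atTop (nhds (f x)) := by
  obtain ⟨M, hM⟩ := h.hasCompactSupport.exists_bound_of_continuous h.contDiff.continuous
  set V : ℝ := volume.real (Metric.closedBall (0 : E n) 2)
  filter_upwards [IsUnifLocDoublingMeasure.ae_tendsto_average_norm_sub volume hf 1] with x hx
  have hδ : Filter.Tendsto (fun j : ℕ => 2 * (1 / 2 : ℝ) ^ j) Filter.atTop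
      (nhdsWithin 0 (Set.Ioi 0)) := by
    rw [tendsto_nhdsWithin_iff]
    refine ⟨?_, Filter.Eventually.of_forall fun j => by simp⟩
    have := (tendsto_pow_atTop_nhds_zero_of_lt_one (by norm_num : (0 : ℝ) ≤ 1 / 2)
      (by norm_num)).const_mul 2
    simpa using this
  have hlim := hx (fun _ => x) (fun j : ℕ => 2 * (1 / 2 : ℝ) ^ j) hδ
    (Filter.Eventually.of_forall fun j => Metric.mem_closedBall_self (by positivity))
  rw [tendsto_iff_norm_sub_tendsto_zero]
  refine squeeze_zero (g := fun j => ((|M| * V) * ∫ z, |φ z|) *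
    ⨍ y in Metric.closedBall x (2 * (1 / 2 : ℝ) ^ j), ‖f y - f x‖) (fun _ => norm_nonneg _) ?_
    (by simpa using hlim.const_mul _)
  intro j
  set t : ℝ := (1 / 2) ^ j with ht
  have ht0 : 0 < t := half_pow_pos j
  have hcl : ∀ g : E n → ℂ, LocallyIntegrable g volume →
      ∀ y, cv (kern φ t) g y - f x = cv (kern φ t) (fun z => g z - f x) y := by
    intro g hg y
    have h1 := cv_add_right (h.kern_cont t) (h.kern_compact j) hg
      (continuous_const (y := -f x)).locallyIntegrable y
    have h2 := h.cv_kern_const j (-f x) y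
    rw [h2] at h1
    simp only [sub_eq_add_neg]
    exact h1.symm
  set I : ℝ := ∫ z in Metric.closedBall x (2 * t), ‖f z - f x‖ with hI
  have hvol : volume.real (Metric.closedBall x (2 * t)) = t ^ n * V := by
    have := Measure.addHaar_closedBall_mul volume x ht0.le (s := 2) (by norm_num)
    rw [mul_comm 2 t, measureReal_def, this]
    simp [V, measureReal_def, ENNReal.toReal_mul, ht0.le]
  have hinner : ∀ y, ‖x - y‖ < t → ‖mean φ f j y - f x‖ ≤ |M| * (t ^ n)⁻¹ * I := by
    intro y hy
    have hfi : IntegrableOn (fun z => f z - f x) (Metric.closedBall x (2 * t)) volume :=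
      (hf.sub (continuous_const (y := f x)).locallyIntegrable).integrableOn_isCompact
        (isCompact_closedBall _ _)
    rw [mean, hcl f hf, hI, ← integral_const_mul, ← integral_indicator
      Metric.isClosed_closedBall.measurableSet]
    refine norm_integral_le_of_norm_le ?_ (Filter.Eventually.of_forall fun z => ?_)
    · exact (integrable_indicator_iff Metric.isClosed_closedBall.measurableSet).mpr
        (hfi.norm.const_mul _)
    · by_cases hz : z ∈ Metric.closedBall x (2 * t)
      · rw [Set.indicator_of_mem hz, norm_smul]
        refine mul_le_mul_of_nonneg_right ?_ (norm_nonneg _)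
        rw [kern, norm_mul, norm_inv, norm_pow, Real.norm_of_nonneg ht0.le, mul_comm]
        exact mul_le_mul_of_nonneg_right ((hM _).trans (le_abs_self _)) (by positivity)
      · rw [Set.indicator_of_notMem hz]
        have h1 : 2 * t < ‖x - z‖ := by
          rw [mem_closedBall_iff_norm, norm_sub_rev] at hz; exact not_le.mp hz
        have h2 : ‖x - z‖ ≤ ‖x - y‖ + ‖y - z‖ := norm_sub_le_norm_sub_add_norm_sub _ _ _
        rw [h.kern_zero (by linarith)]; simp
  have h1 : ‖mean₂ φ f j x - f x‖ ≤ (|M| * (t ^ n)⁻¹ * I) * ∫ z, |kern φ t z| := by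
    rw [mean₂, hcl _ (h.continuous_mean hf j).locallyIntegrable]
    exact norm_cv_le (h.kern_integrable j) (fun z => h.kern_zero (z := z)) hinner
  refine h1.trans (le_of_eq ?_)
  rw [integral_abs_kern φ ht0, setAverage_eq, hvol, smul_eq_mul, ← hI]
  have hV : V ≠ 0 := by
    have : 0 < volume.real (Metric.closedBall (0 : E n) 2) :=
      ENNReal.toReal_pos (Metric.measure_closedBall_pos _ _ (by norm_num)).ne'
        (isCompact_closedBall _ _).measure_lt_top.ne
    exact this.ne'
  field_simp

end Reproducing

/-! ### Localized telescoping sums -/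

section Localized
variable {n : ℕ} {s : ℕ} {φ : E n → ℝ}

lemma half_pow_le_half {i j : ℕ} (h : i < j) : (1 / 2 : ℝ) ^ j ≤ (1 / 2) ^ i / 2 := by
  rw [← half_pow_succ]
  exact pow_le_pow_of_le_one (by norm_num) (by norm_num) h

lemma half_pow_le {i j : ℕ} (h : i ≤ j) : (1 / 2 : ℝ) ^ j ≤ (1 / 2) ^ i :=
  pow_le_pow_of_le_one (by norm_num) (by norm_num) h

lemma sum_half_pow_le (S : Finset ℕ) {τ : ℝ} (hτ : 0 ≤ τ) (h : ∀ j ∈ S, (1 / 2 : ℝ) ^ j ≤ τ) :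
    ∑ j ∈ S, (1 / 2 : ℝ) ^ j ≤ 2 * τ := by
  rcases S.eq_empty_or_nonempty with rfl | hS
  · simpa using hτ
  set a := S.min' hS
  have h1 : S ⊆ Finset.Ico a (S.max' hS + 1) := fun j hj =>
    Finset.mem_Ico.mpr ⟨S.min'_le j hj, Nat.lt_succ_of_le (S.le_max' j hj)⟩
  have h2 : ∀ b, a ≤ b → ∑ j ∈ Finset.Ico a b, (1 / 2 : ℝ) ^ j = 2 * (1 / 2) ^ a - 2 * (1 / 2) ^ b := by
    intro b hb
    induction b, hb using Nat.le_induction with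
    | base => simp
    | succ b hb ih => rw [Finset.sum_Ico_succ_top hb, ih, half_pow_succ]; ring
  calc ∑ j ∈ S, (1 / 2 : ℝ) ^ j ≤ ∑ j ∈ Finset.Ico a (S.max' hS + 1), (1 / 2 : ℝ) ^ j :=
        Finset.sum_le_sum_of_subset_of_nonneg h1 fun _ _ _ => by positivity
    _ ≤ 2 * (1 / 2) ^ a := by
        rw [h2 _ ((S.min'_le _ (S.max'_mem hS)).trans (Nat.le_succ _))]
        linarith [half_pow_pos (S.max' hS).succ]
    _ ≤ 2 * τ := by linarith [h a (S.min'_mem hS)]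

/-- A finite order-connected set of naturals is an interval, so the sum telescopes to two end terms.
-/
lemma norm_sum_sub_le_of_ordConnected {V : Type*} [SeminormedAddCommGroup V] (S : Finset ℕ)
    (hS : ∀ a ∈ S, ∀ b ∈ S, ∀ j, a ≤ j → j ≤ b → j ∈ S) (U : ℕ → V) {M : ℝ} (hM : 0 ≤ M)
    (h : ∀ j ∈ S, ‖U j‖ ≤ M ∧ ‖U (j + 1)‖ ≤ M) :
    ‖∑ j ∈ S, (U (j + 1) - U j)‖ ≤ 2 * M := by
  rcases S.eq_empty_or_nonempty with rfl | hne
  · simpa using hM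
  have hEq : S = Finset.Ico (S.min' hne) (S.max' hne + 1) := by
    ext j
    rw [Finset.mem_Ico, Nat.lt_succ_iff]
    exact ⟨fun hj => ⟨S.min'_le j hj, S.le_max' j hj⟩,
      fun hj => hS _ (S.min'_mem hne) _ (S.max'_mem hne) j hj.1 hj.2⟩
  have hle : S.min' hne ≤ S.max' hne + 1 := (S.min'_le _ (S.max'_mem hne)).trans (Nat.le_succ _)
  have hsum : ∑ j ∈ S, (U (j + 1) - U j) = U (S.max' hne + 1) - U (S.min' hne) := by
    conv_lhs => rw [hEq]
    exact Finset.sum_Ico_sub U hle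
  rw [hsum]
  calc _ ≤ ‖U (S.max' hne + 1)‖ + ‖U (S.min' hne)‖ := norm_sub_le _ _
    _ ≤ 2 * M := by
      linarith [(h _ (S.max'_mem hne)).2, (h _ (S.min'_mem hne)).1]

/-- For `A ≥ 3` one has `(A + 1) / 2 ≤ A - 1`, so the intervals `[(A - 1) 2⁻ʲ, (A + 1) 2⁻ʲ)` are
disjoint. -/
lemma card_scale_le_one (S : Finset ℕ) {A c : ℝ} (hA : 3 ≤ A) :
    (S.filter fun j => (A - 1) * (1 / 2) ^ j ≤ c ∧ c < (A + 1) * (1 / 2) ^ j).card ≤ 1 := by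
  rw [Finset.card_le_one]
  have key : ∀ i j : ℕ, i < j → (A - 1) * (1 / 2) ^ i ≤ c → c < (A + 1) * (1 / 2) ^ j → False := by
    intro i j hij h1 h2
    have h3 := half_pow_le_half hij
    have h4 := half_pow_pos i
    have h5 : (A + 1) * (1 / 2 : ℝ) ^ j ≤ (A + 1) * ((1 / 2) ^ i / 2) := by gcongr
    nlinarith
  intro i hi j hj
  simp only [Finset.mem_filter] at hi hj
  rcases lt_trichotomy i j with h | h | h
  · exact (key i j h hi.2.1 hj.2.2).elim
  · exact h
  · exact (key j i h hj.2.1 hi.2.2).elim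

open Classical in
/-- The part of the layer `meanSum φ f j` selected by a cutoff `ζ` and two distance functions. -/
def piece (φ : E n → ℝ) (f : E n → ℂ) (A : ℝ) (d d' ζ : E n → ℝ) (j : ℕ) (y : E n) : ℂ :=
  if A * (1 / 2) ^ j ≤ d y ∧ d' y < A * (1 / 2) ^ j then ζ y • meanSum φ f j y else 0

lemma norm_piece_le {f : E n → ℂ} {A Λ : ℝ} (hΛ : 0 ≤ Λ) {d d' ζ : E n → ℝ} {j : ℕ}
    (hζ0 : ∀ y, 0 ≤ ζ y) (hζ1 : ∀ y, ζ y ≤ 1)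
    (hu : ∀ y, d' y < A * (1 / 2) ^ j → ‖meanSum φ f j y‖ ≤ Λ) (y : E n) :
    ‖piece φ f A d d' ζ j y‖ ≤ Λ := by
  unfold piece
  split_ifs with hy
  · rw [norm_smul, Real.norm_of_nonneg (hζ0 y)]
    calc ζ y * ‖meanSum φ f j y‖ ≤ 1 * Λ :=
          mul_le_mul (hζ1 y) (hu y hy.2) (norm_nonneg _) zero_le_one
      _ = Λ := one_mul _
  · simpa using hΛ

lemma cv_eq_zero {κ : E n → ℝ} {a : E n → ℂ} {x : E n} {r : ℝ}
    (hz : ∀ z, r ≤ ‖z‖ → κ z = 0) (h : ∀ y, ‖x - y‖ < r → a y = 0) : cv κ a x = 0 := by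
  unfold cv
  rw [← integral_zero (E n) ℂ]
  congr 1; ext y
  rcases lt_or_ge ‖x - y‖ r with h2 | h2
  · rw [h y h2, smul_zero]
  · rw [hz _ h2, zero_smul]

lemma cv_congr {κ : E n → ℝ} {a b : E n → ℂ} {x : E n} {r : ℝ}
    (hz : ∀ z, r ≤ ‖z‖ → κ z = 0) (h : ∀ y, ‖x - y‖ < r → a y = b y) : cv κ a x = cv κ b x := by
  unfold cv
  congr 1; ext y
  rcases lt_or_ge ‖x - y‖ r with h2 | h2
  · rw [h y h2]
  · rw [hz _ h2, zero_smul, zero_smul]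

/-- The commutator of a kernel and a Lipschitz cutoff. -/
lemma norm_cv_mul_sub_le {κ : E n → ℝ} (hκ : Continuous κ) {r : ℝ} (hr : 0 ≤ r)
    (hz : ∀ z, r ≤ ‖z‖ → κ z = 0) {a : E n → ℂ} (ha : Continuous a) {ζ : E n → ℝ} {L Λ : ℝ}
    (hL0 : 0 ≤ L) (hζc : Continuous ζ) (hL : ∀ x y, |ζ x - ζ y| ≤ L * ‖x - y‖) {x : E n}
    (hΛ : ∀ y, ‖x - y‖ < r → ‖a y‖ ≤ Λ) :
    ‖cv κ (fun y => ζ y • a y) x - ζ x • cv κ a x‖ ≤ L * r * Λ * ∫ z, |κ z| := by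
  have hs := hasCompactSupport_of_eq_zero hz
  have hi := hκ.integrable_of_hasCompactSupport hs (μ := volume)
  have h1 : cv κ (fun y => ζ y • a y) x - ζ x • cv κ a x =
      cv κ (fun y => (ζ y - ζ x) • a y) x := by
    have h2 := integrable_conv hκ hs (hζc.smul ha).locallyIntegrable x
    have h3 := (integrable_conv hκ hs ha.locallyIntegrable x).smul (ζ x)
    unfold cv
    rw [← integral_smul]
    refine (integral_sub h2 h3).symm.trans ?_
    congr 1; ext y
    simp only [Pi.smul_apply, Pi.smul_apply']
    rw [smul_comm (ζ x), ← smul_sub, sub_smul]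
  rw [h1]
  refine norm_cv_le hi hz fun y hy => ?_
  rw [norm_smul, Real.norm_eq_abs, abs_sub_comm]
  refine mul_le_mul ((hL x y).trans ?_) (hΛ y hy) (norm_nonneg _) (by positivity)
  gcongr

/-- A localized piece of the reproducing formula is bounded uniformly in the number of layers. -/
lemma IsMollifier.norm_sum_piece_le (h : IsMollifier s φ) {f : E n → ℂ}
    (hf : LocallyIntegrable f volume) {d d' ζ : E n → ℝ} (hd : ∀ x y, |d x - d y| ≤ ‖x - y‖)
    (hd' : ∀ x y, |d' x - d' y| ≤ ‖x - y‖) (hζ0 : ∀ y, 0 ≤ ζ y) (hζ1 : ∀ y, ζ y ≤ 1)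
    (hζc : Continuous ζ) {L : ℝ} (hL0 : 0 ≤ L) (hL : ∀ x y, |ζ x - ζ y| ≤ L * ‖x - y‖) {δ : ℝ}
    (hδ0 : 0 ≤ δ) (hδ : ∀ y, ζ y ≠ 0 → d y ≤ δ) {A Λ : ℝ} (hA : 3 ≤ A) (hΛ : 0 ≤ Λ) {J₀ : ℕ}
    (hu : ∀ j, J₀ ≤ j → ∀ y, d' y < A * (1 / 2) ^ j → ‖meanSum φ f j y‖ ≤ Λ)
    (hU : ∀ j, J₀ ≤ j → ∀ y, d' y < 2 * A * (1 / 2) ^ j → ‖mean₂ φ f j y‖ ≤ Λ)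
    (J : ℕ) (x : E n) :
    ‖∑ j ∈ Finset.Ico J₀ J, cv (diffKern φ j) (piece φ f A d d' ζ j) x‖ ≤
      (2 + (2 + 2 * (δ / A) * L) * (2 * ∫ z, |φ z|)) * Λ := by
  classical
  set B : ℝ := 2 * ∫ z, |φ z| with hB
  have hB0 : 0 ≤ B := by
    have : 0 ≤ ∫ z, |φ z| := integral_nonneg fun _ => abs_nonneg _
    positivity
  have hA0 : 0 < A := by linarith
  set S := Finset.Ico J₀ J
  set T : ℕ → ℂ := fun j => cv (diffKern φ j) (piece φ f A d d' ζ j) x with hT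
  -- For a good scale both selecting inequalities hold on the whole ball of radius `2⁻ʲ` about `x`,
  -- so only the cutoff `ζ` remains inside the convolution. For any other scale, either the term
  -- vanishes or `d x` or `d' x` lies within `2⁻ʲ` of the threshold `A 2⁻ʲ`; the latter is charged
  -- to `e₁` and `e₂`, each nonzero for at most one `j`.
  set good : ℕ → Prop := fun j => (A + 1) * (1 / 2) ^ j ≤ d x ∧ d' x < (A - 1) * (1 / 2) ^ j
    with hgood
  set G : ℕ → ℂ := fun j => if good j then ζ x • (mean₂ φ f (j + 1) x - mean₂ φ f j x) else 0
    with hG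
  -- The error of moving `ζ` out of the convolution. It occurs only if `ζ` is nonzero somewhere near
  -- `x`, which forces `A 2⁻ʲ ≤ δ`; hence the errors form a geometric series of size `L δ / A`.
  set e : ℕ → ℝ := fun j => if (1 / 2 : ℝ) ^ j ≤ δ / A then L * (1 / 2) ^ j * Λ * B else 0 with he
  set e₁ : ℕ → ℝ := fun j =>
    if (A - 1) * (1 / 2) ^ j ≤ d x ∧ d x < (A + 1) * (1 / 2) ^ j then Λ * B else 0 with he₁
  set e₂ : ℕ → ℝ := fun j =>
    if (A - 1) * (1 / 2) ^ j ≤ d' x ∧ d' x < (A + 1) * (1 / 2) ^ j then Λ * B else 0 with he₂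
  have he0 : ∀ j, 0 ≤ e j := fun j => by
    simp only [he]; split_ifs <;> positivity
  have he10 : ∀ j, 0 ≤ e₁ j := fun j => by simp only [he₁]; split_ifs <;> positivity
  have he20 : ∀ j, 0 ≤ e₂ j := fun j => by simp only [he₂]; split_ifs <;> positivity
  have hTB : ∀ j ∈ S, ‖T j‖ ≤ Λ * B := by
    intro j hj
    refine (norm_cv_le (h.diffKern_integrable j) (fun z => h.diffKern_zero (z := z)) fun y _ =>
      norm_piece_le hΛ hζ0 hζ1 (hu j (Finset.mem_Ico.mp hj).1) y).trans ?_
    exact mul_le_mul_of_nonneg_left (h.integral_abs_diffKern_le j) hΛ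
  have hmain : ∀ j ∈ S, ‖T j - G j‖ ≤ e j + e₁ j + e₂ j := by
    intro j hj
    have hj0 := (Finset.mem_Ico.mp hj).1
    have ht := half_pow_pos j
    have hdx : ∀ y, ‖x - y‖ < (1 / 2) ^ j →
        d x - (1 / 2) ^ j < d y ∧ d y < d x + (1 / 2) ^ j := fun y hy => by
      have := abs_le.mp (hd x y); constructor <;> linarith
    have hdx' : ∀ y, ‖x - y‖ < (1 / 2) ^ j →
        d' x - (1 / 2) ^ j < d' y ∧ d' y < d' x + (1 / 2) ^ j := fun y hy => by
      have := abs_le.mp (hd' x y); constructor <;> linarith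
    have hzz : ∀ z : E n, (1 / 2) ^ j ≤ ‖z‖ → diffKern φ j z = 0 := fun z hz => h.diffKern_zero hz
    by_cases hg : good j
    · have hTj : T j = cv (diffKern φ j) (fun y => ζ y • meanSum φ f j y) x := by
        refine cv_congr hzz fun y hy => ?_
        have h1 := hdx y hy
        have h2 := hdx' y hy
        rw [piece, if_pos ⟨by linarith [hg.1], by linarith [hg.2]⟩]
      have hGj : G j = ζ x • cv (diffKern φ j) (meanSum φ f j) x := by
        simp only [hG, if_pos hg]; rw [h.cv_diffKern hf]
      suffices h3 : ‖T j - G j‖ ≤ e j by linarith [he10 j, he20 j]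
      by_cases hex : ∃ y, ‖x - y‖ < (1 / 2) ^ j ∧ ζ y ≠ 0
      · obtain ⟨y, hy, hy0⟩ := hex
        have h4 : (1 / 2 : ℝ) ^ j ≤ δ / A := by
          rw [le_div_iff₀ hA0]
          linarith [hδ y hy0, (hdx y hy).1, hg.1]
        simp only [he, if_pos h4]
        rw [hTj, hGj]
        refine (norm_cv_mul_sub_le (h.diffKern_cont j) ht.le hzz (h.continuous_meanSum hf j)
          hL0 hζc hL (Λ := Λ) fun y hy => hu j hj0 y (by linarith [(hdx' y hy).2, hg.2])).trans ?_
        exact mul_le_mul_of_nonneg_left (h.integral_abs_diffKern_le j) (by positivity)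
      · push Not at hex
        have h5 : ζ x = 0 := hex x (by simp)
        have h6 : T j = 0 := by
          rw [hTj]
          exact cv_eq_zero hzz fun y hy => by rw [hex y hy, zero_smul]
        rw [h6, hGj, h5]
        simpa using he0 j
    · have hGj : G j = 0 := by simp only [hG, if_neg hg]
      rw [hGj, sub_zero]
      by_cases h1 : (A - 1) * (1 / 2) ^ j ≤ d x ∧ d x < (A + 1) * (1 / 2) ^ j
      · have : e₁ j = Λ * B := by simp only [he₁, if_pos h1]
        linarith [hTB j hj, he0 j, he20 j]
      by_cases h2 : (A - 1) * (1 / 2) ^ j ≤ d' x ∧ d' x < (A + 1) * (1 / 2) ^ j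
      · have : e₂ j = Λ * B := by simp only [he₂, if_pos h2]
        linarith [hTB j hj, he0 j, he10 j]
      have hT0 : T j = 0 := by
        refine cv_eq_zero hzz fun y hy => ?_
        rw [piece, if_neg]
        rintro ⟨h3, h4⟩
        have h5 := hdx y hy
        have h6 := hdx' y hy
        simp only [hgood] at hg
        by_cases h7 : (A + 1) * (1 / 2) ^ j ≤ d x
        · have h8 : (A - 1) * (1 / 2) ^ j ≤ d' x := not_lt.mp fun h9 => hg ⟨h7, h9⟩
          exact h2 ⟨h8, by linarith⟩
        · exact h1 ⟨by linarith, not_le.mp h7⟩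
      rw [hT0, norm_zero]
      linarith [he0 j, he10 j, he20 j]
  have hGsum : ‖∑ j ∈ S, G j‖ ≤ 2 * Λ := by
    have h1 : ∑ j ∈ S, G j =
        ζ x • ∑ j ∈ S.filter good, (mean₂ φ f (j + 1) x - mean₂ φ f j x) := by
      rw [Finset.smul_sum, Finset.sum_filter]
    rw [h1, norm_smul, Real.norm_of_nonneg (hζ0 x)]
    have h2 : ‖∑ j ∈ S.filter good, (mean₂ φ f (j + 1) x - mean₂ φ f j x)‖ ≤ 2 * Λ := by
      refine norm_sum_sub_le_of_ordConnected _ ?_ (fun j => mean₂ φ f j x) hΛ ?_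
      · intro a ha b hb j haj hjb
        simp only [S, Finset.mem_filter, Finset.mem_Ico, hgood] at ha hb ⊢
        -- The lower condition on `d x` persists for larger `j`, the upper condition on `d' x` for
        -- smaller `j`, so the good scales form an interval.
        refine ⟨⟨by omega, by omega⟩, le_trans ?_ ha.2.1, hb.2.2.trans_le ?_⟩
        · exact mul_le_mul_of_nonneg_left (half_pow_le haj) (by linarith)
        · exact mul_le_mul_of_nonneg_left (half_pow_le hjb) (by linarith)
      · intro j hj
        simp only [S, Finset.mem_filter, Finset.mem_Ico, hgood] at hj
        have ht := half_pow_pos j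
        -- The factor `2` in the range of `hU` serves the index `j + 1`, whose scale is half as
        -- large.
        refine ⟨hU j hj.1.1 x (hj.2.2.trans_le ?_), hU (j + 1) (by omega) x (hj.2.2.trans_le ?_)⟩
        · gcongr; linarith
        · rw [half_pow_succ]; nlinarith
    calc ζ x * _ ≤ 1 * (2 * Λ) := mul_le_mul (hζ1 x) h2 (norm_nonneg _) zero_le_one
      _ = 2 * Λ := one_mul _
  have hesum : ∑ j ∈ S, e j ≤ 2 * (δ / A) * L * B * Λ := by
    have h1 : ∑ j ∈ S, e j =
        (∑ j ∈ S.filter fun j => (1 / 2 : ℝ) ^ j ≤ δ / A, (1 / 2 : ℝ) ^ j) * (L * Λ * B) := by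
      rw [Finset.sum_mul, Finset.sum_filter]
      refine Finset.sum_congr rfl fun j _ => ?_
      simp only [he]
      split_ifs
      · ring
      · rfl
    rw [h1]
    have h2 := sum_half_pow_le (S.filter fun j => (1 / 2 : ℝ) ^ j ≤ δ / A)
      (div_nonneg hδ0 hA0.le) fun j hj => (Finset.mem_filter.mp hj).2
    calc _ ≤ (2 * (δ / A)) * (L * Λ * B) := mul_le_mul_of_nonneg_right h2 (by positivity)
      _ = _ := by ring
  have hcard : ∀ c : ℝ, ∑ j ∈ S,
      (if (A - 1) * (1 / 2) ^ j ≤ c ∧ c < (A + 1) * (1 / 2) ^ j then Λ * B else 0) ≤ Λ * B := by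
    intro c
    rw [← Finset.sum_filter, Finset.sum_const, nsmul_eq_mul]
    have h1 : (((S.filter fun j => (A - 1) * (1 / 2) ^ j ≤ c ∧ c < (A + 1) * (1 / 2) ^ j).card : ℕ) : ℝ)
        ≤ 1 := by exact_mod_cast card_scale_le_one S hA
    exact mul_le_of_le_one_left (by positivity) h1
  calc ‖∑ j ∈ S, T j‖ = ‖∑ j ∈ S, (T j - G j) + ∑ j ∈ S, G j‖ := by
        rw [← Finset.sum_add_distrib]; simp
    _ ≤ ‖∑ j ∈ S, (T j - G j)‖ + ‖∑ j ∈ S, G j‖ := norm_add_le _ _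
    _ ≤ ∑ j ∈ S, (e j + e₁ j + e₂ j) + 2 * Λ := by
        refine add_le_add ((norm_sum_le _ _).trans (Finset.sum_le_sum hmain)) hGsum
    _ ≤ (2 * (δ / A) * L * B * Λ + Λ * B + Λ * B) + 2 * Λ := by
        rw [Finset.sum_add_distrib, Finset.sum_add_distrib]
        have := hcard (d x)
        have := hcard (d' x)
        simp only [he₁, he₂]
        linarith
    _ = _ := by ring

/-- The support of a localized piece of the reproducing formula. -/
lemma IsMollifier.exists_of_sum_piece_ne_zero (h : IsMollifier s φ) {f : E n → ℂ}
    {d d' ζ : E n → ℝ} {A : ℝ} {J₀ J : ℕ} {x : E n}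
    (hx : ∑ j ∈ Finset.Ico J₀ J, cv (diffKern φ j) (piece φ f A d d' ζ j) x ≠ 0) :
    ∃ j, J₀ ≤ j ∧ ∃ y, ‖x - y‖ < (1 / 2) ^ j ∧ ζ y ≠ 0 ∧ A * (1 / 2) ^ j ≤ d y := by
  obtain ⟨j, hj, hj0⟩ := Finset.exists_ne_zero_of_sum_ne_zero hx
  refine ⟨j, (Finset.mem_Ico.mp hj).1, ?_⟩
  by_contra hcon
  push Not at hcon
  refine hj0 (cv_eq_zero (fun z hz => h.diffKern_zero hz) fun y hy => ?_)
  rw [piece]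
  split_ifs with h1
  · by_cases h2 : ζ y = 0
    · rw [h2, zero_smul]
    · exact absurd h1.1 (not_le.mpr (hcon y hy h2))
  · rfl

end Localized

/-! ### A Lipschitz partition of unity adapted to an open set -/

section Partition
variable {n : ℕ}

/-- The distance to the complement of a set, truncated at `1`. -/
def depth (Ω : Set (E n)) (y : E n) : ℝ := (min (Metric.infEDist y Ωᶜ) 1).toReal

lemma ofReal_depth (Ω : Set (E n)) (y : E n) :
    ENNReal.ofReal (depth Ω y) = min (Metric.infEDist y Ωᶜ) 1 :=
  ENNReal.ofReal_toReal (ne_top_of_le_ne_top ENNReal.one_ne_top (min_le_right _ _))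

lemma depth_nonneg (Ω : Set (E n)) (y : E n) : 0 ≤ depth Ω y := ENNReal.toReal_nonneg

lemma depth_le_one (Ω : Set (E n)) (y : E n) : depth Ω y ≤ 1 := by
  have := ENNReal.toReal_mono ENNReal.one_ne_top (min_le_right (Metric.infEDist y Ωᶜ) 1)
  simpa [depth] using this

lemma depth_anti {Ω Ω' : Set (E n)} (h : Ω' ⊆ Ω) (y : E n) : depth Ω' y ≤ depth Ω y := by
  refine ENNReal.toReal_mono (ne_top_of_le_ne_top ENNReal.one_ne_top (min_le_right _ _)) ?_
  exact min_le_min_right _ (Metric.infEDist_anti (Set.compl_subset_compl.mpr h))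

lemma depth_sub_le (Ω : Set (E n)) (x y : E n) : |depth Ω x - depth Ω y| ≤ ‖x - y‖ := by
  have key : ∀ x y, depth Ω x ≤ depth Ω y + ‖x - y‖ := by
    intro x y
    rw [← ENNReal.ofReal_le_ofReal_iff (add_nonneg (depth_nonneg _ _) (norm_nonneg _)),
      ENNReal.ofReal_add (depth_nonneg _ _) (norm_nonneg _), ofReal_depth, ofReal_depth,
      ← dist_eq_norm, ← edist_dist]
    rcases le_total (Metric.infEDist y Ωᶜ) 1 with h | h
    · rw [min_eq_left h]
      exact (min_le_left _ _).trans Metric.infEDist_le_infEDist_add_edist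
    · rw [min_eq_right h]
      exact (min_le_right _ _).trans le_self_add
  rw [abs_sub_le_iff]
  have h1 := key x y
  have h2 := key y x
  rw [norm_sub_rev] at h2
  constructor <;> linarith

lemma continuous_depth (Ω : Set (E n)) : Continuous (depth Ω) := by
  refine LipschitzWith.continuous (K := 1) (LipschitzWith.of_dist_le_mul fun x y => ?_)
  rw [Real.dist_eq, dist_eq_norm]
  simpa using depth_sub_le Ω x y

lemma depth_eq_zero {Ω : Set (E n)} {y : E n} (hy : y ∉ Ω) : depth Ω y = 0 := by
  rw [depth, Metric.infEDist_zero_of_mem hy]; simp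

lemma depth_pos {Ω : Set (E n)} (hΩ : IsOpen Ω) {y : E n} (hy : y ∈ Ω) : 0 < depth Ω y := by
  rw [← ENNReal.ofReal_pos, ofReal_depth, lt_min_iff]
  refine ⟨pos_iff_ne_zero.mpr fun h0 => ?_, one_pos⟩
  exact (Metric.mem_iff_infEDist_zero_of_closed hΩ.isClosed_compl).mpr h0 hy

/-- For `r ≤ 1` the truncation of the depth at `1` is invisible. -/
lemma exists_notMem_of_depth_lt {Ω : Set (E n)} {y : E n} {r : ℝ} (hr : r ≤ 1)
    (h : depth Ω y < r) : ∃ z, z ∉ Ω ∧ ‖y - z‖ < r := by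
  have hr0 : 0 < r := (depth_nonneg _ _).trans_lt h
  have h1 : min (Metric.infEDist y Ωᶜ) 1 < ENNReal.ofReal r := by
    rw [← ofReal_depth]; exact (ENNReal.ofReal_lt_ofReal_iff hr0).mpr h
  rcases min_lt_iff.mp h1 with h2 | h2
  · obtain ⟨z, hz, hyz⟩ := Metric.infEDist_lt_iff.mp h2
    refine ⟨z, hz, ?_⟩
    rwa [edist_dist, ENNReal.ofReal_lt_ofReal_iff hr0, dist_eq_norm] at hyz
  · exact absurd h2 (not_lt.mpr (by simpa using hr))

lemma mem_of_lt_depth {Ω : Set (E n)} {y z : E n} (h : ‖y - z‖ < depth Ω y) : z ∈ Ω := by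
  by_contra hz
  have := abs_le.mp (depth_sub_le Ω y z)
  rw [depth_eq_zero hz] at this
  linarith [this.2]

/-- The truncation of a real number to `[0, 1]`. -/
def clamp (r : ℝ) : ℝ := max 0 (min 1 r)

lemma clamp_nonneg (r : ℝ) : 0 ≤ clamp r := le_max_left _ _

lemma clamp_le_one (r : ℝ) : clamp r ≤ 1 := max_le zero_le_one (min_le_left _ _)

lemma clamp_mono {r r' : ℝ} (h : r ≤ r') : clamp r ≤ clamp r' :=
  max_le_max_left _ (min_le_min_left _ h)

lemma clamp_of_nonpos {r : ℝ} (h : r ≤ 0) : clamp r = 0 :=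
  max_eq_left ((min_le_right _ _).trans h)

lemma clamp_of_one_le {r : ℝ} (h : 1 ≤ r) : clamp r = 1 := by
  rw [clamp, min_eq_left h]; exact max_eq_right zero_le_one

lemma clamp_sub_le (r r' : ℝ) : |clamp r - clamp r'| ≤ |r - r'| := by
  have h1 := abs_max_sub_max_le_max 0 (min 1 r) 0 (min 1 r')
  have h2 := abs_min_sub_min_le_max 1 r 1 r'
  rw [sub_self, abs_zero, max_eq_right (b := |_|) (abs_nonneg _)] at h1 h2
  exact h1.trans h2

/-- The cutoff selecting the depths comparable to `2⁻ˡ`. -/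
def layer (l : ℕ) (δ : ℝ) : ℝ :=
  clamp (δ / (1 / 2) ^ (l + 1) - 1) - clamp (δ / (1 / 2) ^ l - 1)

lemma layer_nonneg (l : ℕ) {δ : ℝ} (hδ : 0 ≤ δ) : 0 ≤ layer l δ := by
  refine sub_nonneg.mpr (clamp_mono ?_)
  have : δ / (1 / 2) ^ l ≤ δ / (1 / 2) ^ (l + 1) :=
    div_le_div_of_nonneg_left hδ (half_pow_pos _) (half_pow_le (Nat.le_succ l))
  linarith

lemma layer_le_one (l : ℕ) (δ : ℝ) : layer l δ ≤ 1 := by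
  unfold layer; linarith [clamp_le_one (δ / (1 / 2) ^ (l + 1) - 1), clamp_nonneg (δ / (1 / 2) ^ l - 1)]

lemma layer_sub_le (l : ℕ) (δ δ' : ℝ) : |layer l δ - layer l δ'| ≤ 3 / (1 / 2) ^ l * |δ - δ'| := by
  have h1 := clamp_sub_le (δ / (1 / 2) ^ (l + 1) - 1) (δ' / (1 / 2) ^ (l + 1) - 1)
  have h2 := clamp_sub_le (δ / (1 / 2) ^ l - 1) (δ' / (1 / 2) ^ l - 1)
  have h3 : ∀ t : ℝ, 0 < t → |δ / t - 1 - (δ' / t - 1)| = |δ - δ'| / t := by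
    intro t ht
    rw [sub_sub_sub_cancel_right, ← sub_div, abs_div, abs_of_pos ht]
  rw [h3 _ (half_pow_pos _)] at h1 h2
  have h4 : |δ - δ'| / (1 / 2) ^ (l + 1) = 2 / (1 / 2) ^ l * |δ - δ'| := by
    rw [half_pow_succ]; field_simp
  have h5 : |δ - δ'| / (1 / 2) ^ l = 1 / (1 / 2) ^ l * |δ - δ'| := by ring
  rw [h4] at h1
  rw [h5] at h2
  have h6 : layer l δ - layer l δ' =
      (clamp (δ / (1 / 2) ^ (l + 1) - 1) - clamp (δ' / (1 / 2) ^ (l + 1) - 1)) -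
      (clamp (δ / (1 / 2) ^ l - 1) - clamp (δ' / (1 / 2) ^ l - 1)) := by unfold layer; ring
  rw [h6]
  refine (abs_sub _ _).trans ((add_le_add h1 h2).trans (le_of_eq ?_))
  ring

lemma lt_of_layer_ne_zero {l : ℕ} {δ : ℝ} (h : layer l δ ≠ 0) :
    (1 / 2) ^ l / 2 < δ ∧ δ < 2 * (1 / 2) ^ l := by
  have ht := half_pow_pos l
  constructor
  · by_contra hcon
    refine h ?_
    have h1 : δ / (1 / 2) ^ (l + 1) - 1 ≤ 0 := by
      rw [sub_nonpos, div_le_one (half_pow_pos _), half_pow_succ]; exact not_lt.mp hcon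
    have h2 : δ / (1 / 2) ^ l - 1 ≤ 0 := by
      rw [sub_nonpos, div_le_one ht]; linarith [not_lt.mp hcon]
    rw [layer, clamp_of_nonpos h1, clamp_of_nonpos h2, sub_zero]
  · by_contra hcon
    refine h ?_
    have h1 : 1 ≤ δ / (1 / 2) ^ (l + 1) - 1 := by
      rw [le_sub_iff_add_le, le_div_iff₀ (half_pow_pos _), half_pow_succ]
      linarith [not_lt.mp hcon]
    have h2 : 1 ≤ δ / (1 / 2) ^ l - 1 := by
      rw [le_sub_iff_add_le, le_div_iff₀ ht]; linarith [not_lt.mp hcon]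
    rw [layer, clamp_of_one_le h1, clamp_of_one_le h2, sub_self]

/-- The layers telescope, and `δ ≤ 1` makes the initial term zero. This is one reason for truncating
the depth at `1`: scales indexed by `ℕ` then suffice, even for deep points. -/
lemma hasSum_layer {δ : ℝ} (h0 : 0 < δ) (h1 : δ ≤ 1) : HasSum (fun l => layer l δ) 1 := by
  obtain ⟨M, hM⟩ := exists_pow_lt_of_lt_one (half_pos h0) (by norm_num : (1 / 2 : ℝ) < 1)
  have hM1 : clamp (δ / (1 / 2) ^ M - 1) = 1 := by
    refine clamp_of_one_le ?_
    rw [le_sub_iff_add_le, le_div_iff₀ (half_pow_pos _)]; linarith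
  have hz : clamp (δ / (1 / 2) ^ 0 - 1) = 0 := clamp_of_nonpos (by simpa using h1)
  have hsum : ∑ l ∈ Finset.range M, layer l δ = 1 := by
    unfold layer
    rw [Finset.sum_range_sub (fun l => clamp (δ / (1 / 2) ^ l - 1)), hM1, hz, sub_zero]
  rw [← hsum]
  refine hasSum_sum_of_ne_finset_zero fun l hl => ?_
  by_contra hne
  have h2 := (lt_of_layer_ne_zero hne).2
  have h3 := half_pow_le (not_lt.mp fun h => hl (Finset.mem_range.mpr h))
  linarith

/-- The tent function. -/
def tent (r : ℝ) : ℝ := max 0 (1 - |r|)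

lemma tent_nonneg (r : ℝ) : 0 ≤ tent r := le_max_left _ _

lemma tent_le_one (r : ℝ) : tent r ≤ 1 := max_le zero_le_one (by linarith [abs_nonneg r])

lemma tent_sub_le (r r' : ℝ) : |tent r - tent r'| ≤ |r - r'| := by
  have h1 := abs_max_sub_max_le_max 0 (1 - |r|) 0 (1 - |r'|)
  rw [sub_self, abs_zero, max_eq_right (b := |_|) (abs_nonneg _)] at h1
  refine h1.trans ?_
  rw [show 1 - |r| - (1 - |r'|) = -(|r| - |r'|) by ring, abs_neg]
  exact abs_abs_sub_abs_le_abs_sub _ _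

lemma abs_lt_one_of_tent_ne_zero {r : ℝ} (h : tent r ≠ 0) : |r| < 1 := by
  by_contra hcon
  exact h (max_eq_left (by linarith [not_lt.mp hcon]))

lemma tent_eq_zero_of_notMem {r : ℝ} {m : ℤ} (hm : m ∉ ({⌊r⌋, ⌊r⌋ + 1} : Finset ℤ)) :
    tent (r - m) = 0 := by
  by_contra hne
  have h1 := abs_lt.mp (abs_lt_one_of_tent_ne_zero hne)
  have h2 := Int.floor_le r
  have h3 := Int.lt_floor_add_one r
  have h4 : m < ⌊r⌋ + 2 := by
    have : (m : ℝ) < (⌊r⌋ + 2 : ℤ) := by push_cast; linarith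
    exact_mod_cast this
  have h5 : ⌊r⌋ - 1 < m := by
    have : ((⌊r⌋ - 1 : ℤ) : ℝ) < (m : ℝ) := by push_cast; linarith
    exact_mod_cast this
  refine hm ?_
  simp only [Finset.mem_insert, Finset.mem_singleton]
  omega

lemma sum_tent (r : ℝ) : ∑ m ∈ ({⌊r⌋, ⌊r⌋ + 1} : Finset ℤ), tent (r - m) = 1 := by
  rw [Finset.sum_pair (by omega)]
  have h2 := Int.floor_le r
  have h3 := Int.lt_floor_add_one r
  have h4 : tent (r - ⌊r⌋) = 1 - (r - ⌊r⌋) := by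
    rw [tent, abs_of_nonneg (by linarith)]; exact max_eq_right (by linarith)
  have h5 : tent (r - (⌊r⌋ + 1 : ℤ)) = r - ⌊r⌋ := by
    rw [tent, abs_of_nonpos (by push_cast; linarith), max_eq_right (by push_cast; linarith)]
    push_cast; ring
  rw [h4, h5]; ring

/-- The tensor product of tents centered at the lattice point `m / c`. -/
def bump (c : ℝ) (m : Fin n → ℤ) (y : E n) : ℝ := ∏ i, tent (c * y i - m i)

lemma bump_nonneg (c : ℝ) (m : Fin n → ℤ) (y : E n) : 0 ≤ bump c m y :=
  Finset.prod_nonneg fun _ _ => tent_nonneg _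

lemma bump_le_one (c : ℝ) (m : Fin n → ℤ) (y : E n) : bump c m y ≤ 1 :=
  Finset.prod_le_one (fun _ _ => tent_nonneg _) fun _ _ => tent_le_one _

lemma abs_lt_of_bump_ne_zero {c : ℝ} {m : Fin n → ℤ} {y : E n} (h : bump c m y ≠ 0) (i : Fin n) :
    |c * y i - m i| < 1 :=
  abs_lt_one_of_tent_ne_zero (Finset.prod_ne_zero_iff.mp h i (Finset.mem_univ i))

lemma abs_prod_sub_prod_le {ι : Type*} (S : Finset ι) (a b : ι → ℝ) (ha0 : ∀ i, 0 ≤ a i)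
    (ha1 : ∀ i, a i ≤ 1) (hb0 : ∀ i, 0 ≤ b i) (hb1 : ∀ i, b i ≤ 1) :
    |∏ i ∈ S, a i - ∏ i ∈ S, b i| ≤ ∑ i ∈ S, |a i - b i| := by
  classical
  induction S using Finset.induction_on with
  | empty => simp
  | insert i S hi ih =>
    rw [Finset.prod_insert hi, Finset.prod_insert hi, Finset.sum_insert hi]
    have hA : |∏ j ∈ S, a j| ≤ 1 := by
      rw [abs_of_nonneg (Finset.prod_nonneg fun j _ => ha0 j)]
      exact Finset.prod_le_one (fun j _ => ha0 j) fun j _ => ha1 j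
    have hB : |b i| ≤ 1 := by rw [abs_of_nonneg (hb0 i)]; exact hb1 i
    calc _ = |(a i - b i) * ∏ j ∈ S, a j + b i * (∏ j ∈ S, a j - ∏ j ∈ S, b j)| := by
          congr 1; ring
      _ ≤ |a i - b i| * |∏ j ∈ S, a j| + |b i| * |∏ j ∈ S, a j - ∏ j ∈ S, b j| := by
          rw [← abs_mul, ← abs_mul]; exact abs_add_le _ _
      _ ≤ |a i - b i| * 1 + 1 * ∑ j ∈ S, |a j - b j| := by gcongr
      _ = _ := by ring

lemma bump_sub_le {c : ℝ} (hc : 0 ≤ c) (m : Fin n → ℤ) (x y : E n) :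
    |bump c m x - bump c m y| ≤ n * c * ‖x - y‖ := by
  refine (abs_prod_sub_prod_le _ _ _ (fun _ => tent_nonneg _) (fun _ => tent_le_one _)
    (fun _ => tent_nonneg _) fun _ => tent_le_one _).trans ?_
  calc ∑ i, |tent (c * x i - m i) - tent (c * y i - m i)| ≤ ∑ _i : Fin n, c * ‖x - y‖ := by
        refine Finset.sum_le_sum fun i _ => (tent_sub_le _ _).trans ?_
        rw [show c * x i - m i - (c * y i - m i) = c * (x - y) i by simp; ring, abs_mul,
          abs_of_nonneg hc]
        exact mul_le_mul_of_nonneg_left (abs_apply_le_norm _ i) hc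
    _ = _ := by simp; ring

/-- The product over the coordinates of the one-dimensional identity `∑ₘ tent (r - m) = 1`. -/
lemma hasSum_bump (c : ℝ) (y : E n) : HasSum (fun m => bump c m y) 1 := by
  classical
  have h1 : ∑ m ∈ Fintype.piFinset fun i => ({⌊c * y i⌋, ⌊c * y i⌋ + 1} : Finset ℤ),
      bump c m y = 1 := by
    unfold bump
    rw [← Finset.prod_univ_sum (fun i => ({⌊c * y i⌋, ⌊c * y i⌋ + 1} : Finset ℤ))
      (fun i m => tent (c * y i - m))]
    exact Finset.prod_eq_one fun i _ => sum_tent _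
  rw [← h1]
  refine hasSum_sum_of_ne_finset_zero fun m hm => ?_
  rw [Fintype.mem_piFinset] at hm
  push Not at hm
  obtain ⟨i, hi⟩ := hm
  exact Finset.prod_eq_zero (Finset.mem_univ i) (tent_eq_zero_of_notMem hi)

/-- The members of the partition of unity, indexed by a scale and a lattice point. -/
def cutoff (η : ℝ) (Ω : Set (E n)) (i : ℕ × (Fin n → ℤ)) (y : E n) : ℝ :=
  layer i.1 (depth Ω y) * bump (η * (1 / 2) ^ i.1)⁻¹ i.2 y

/-- The cubes carrying the partition of unity. -/
def whitney (η : ℝ) (i : ℕ × (Fin n → ℤ)) : Set (E n) :=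
  cube (WithLp.toLp 2 fun k => η * (1 / 2) ^ i.1 * i.2 k) (4 * (η * (1 / 2) ^ i.1))

lemma cutoff_nonneg (η : ℝ) (Ω : Set (E n)) (i : ℕ × (Fin n → ℤ)) (y : E n) :
    0 ≤ cutoff η Ω i y :=
  mul_nonneg (layer_nonneg _ (depth_nonneg _ _)) (bump_nonneg _ _ _)

lemma cutoff_le_one (η : ℝ) (Ω : Set (E n)) (i : ℕ × (Fin n → ℤ)) (y : E n) :
    cutoff η Ω i y ≤ 1 :=
  mul_le_one₀ (layer_le_one _ _) (bump_nonneg _ _ _) (bump_le_one _ _ _)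

/-- The Lipschitz constant is inverse to the scale, while the depth on the support is at most twice
the scale. The product of the two, which is all that enters the estimate of the pieces, is
independent of the scale. -/
lemma cutoff_sub_le {η : ℝ} (hη : 0 < η) (Ω : Set (E n)) (i : ℕ × (Fin n → ℤ)) (x y : E n) :
    |cutoff η Ω i x - cutoff η Ω i y| ≤ (3 + n / η) / (1 / 2) ^ i.1 * ‖x - y‖ := by
  have ht := half_pow_pos i.1
  have h1 := layer_sub_le i.1 (depth Ω x) (depth Ω y)
  have h2 := bump_sub_le (inv_nonneg.mpr (mul_pos hη ht).le) i.2 x y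
  have h3 := depth_sub_le Ω x y
  have hl : |layer i.1 (depth Ω y)| ≤ 1 := by
    rw [abs_of_nonneg (layer_nonneg _ (depth_nonneg _ _))]; exact layer_le_one _ _
  have hb : |bump (η * (1 / 2) ^ i.1)⁻¹ i.2 x| ≤ 1 := by
    rw [abs_of_nonneg (bump_nonneg _ _ _)]; exact bump_le_one _ _ _
  unfold cutoff
  calc _ = |(layer i.1 (depth Ω x) - layer i.1 (depth Ω y)) * bump (η * (1 / 2) ^ i.1)⁻¹ i.2 x +
        layer i.1 (depth Ω y) * (bump (η * (1 / 2) ^ i.1)⁻¹ i.2 x -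
          bump (η * (1 / 2) ^ i.1)⁻¹ i.2 y)| := by congr 1; ring
    _ ≤ |layer i.1 (depth Ω x) - layer i.1 (depth Ω y)| * |bump (η * (1 / 2) ^ i.1)⁻¹ i.2 x| +
        |layer i.1 (depth Ω y)| * |bump (η * (1 / 2) ^ i.1)⁻¹ i.2 x -
          bump (η * (1 / 2) ^ i.1)⁻¹ i.2 y| := by
        rw [← abs_mul, ← abs_mul]; exact abs_add_le _ _
    _ ≤ (3 / (1 / 2) ^ i.1 * ‖x - y‖) * 1 + 1 * (n * (η * (1 / 2) ^ i.1)⁻¹ * ‖x - y‖) := by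
        refine add_le_add (mul_le_mul (h1.trans ?_) hb (abs_nonneg _) (by positivity))
          (mul_le_mul hl h2 (abs_nonneg _) zero_le_one)
        exact mul_le_mul_of_nonneg_left h3 (by positivity)
    _ = _ := by field_simp

lemma continuous_cutoff {η : ℝ} (hη : 0 < η) (Ω : Set (E n)) (i : ℕ × (Fin n → ℤ)) :
    Continuous (cutoff η Ω i) := by
  have h0 : 0 ≤ (3 + n / η) / (1 / 2) ^ i.1 := by positivity
  refine LipschitzWith.continuous (K := ((3 + n / η) / (1 / 2) ^ i.1).toNNReal)
    (LipschitzWith.of_dist_le_mul fun x y => ?_)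
  rw [Real.dist_eq, dist_eq_norm, Real.coe_toNNReal _ h0]
  exact cutoff_sub_le hη Ω i x y

lemma hasSum_cutoff (η : ℝ) {Ω : Set (E n)} (hΩ : IsOpen Ω) {y : E n} (hy : y ∈ Ω) :
    HasSum (fun i => cutoff η Ω i y) 1 := by
  have h1 : ∀ l, HasSum (fun m => cutoff η Ω (l, m) y) (layer l (depth Ω y)) := fun l => by
    have := (hasSum_bump (η * (1 / 2) ^ l)⁻¹ y).mul_left (layer l (depth Ω y))
    rwa [mul_one] at this
  have h2 := hasSum_layer (depth_pos hΩ hy) (depth_le_one Ω y)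
  have h3 : Summable fun i => cutoff η Ω i y := by
    rw [summable_prod_of_nonneg fun i => cutoff_nonneg η Ω i y]
    refine ⟨fun l => (h1 l).summable, ?_⟩
    simp_rw [(h1 _).tsum_eq]
    exact h2.summable
  have h4 := h3.hasSum.prod_fiberwise h1
  rw [← h4.unique h2]
  exact h3.hasSum

lemma lt_of_cutoff_ne_zero {η : ℝ} (hη : 0 < η) {Ω : Set (E n)} {i : ℕ × (Fin n → ℤ)} {y : E n}
    (h : cutoff η Ω i y ≠ 0) :
    (1 / 2) ^ i.1 / 2 < depth Ω y ∧ depth Ω y < 2 * (1 / 2) ^ i.1 ∧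
      ∀ k, |y k - η * (1 / 2) ^ i.1 * i.2 k| < η * (1 / 2) ^ i.1 := by
  have h1 := lt_of_layer_ne_zero (left_ne_zero_of_mul h)
  refine ⟨h1.1, h1.2, fun k => ?_⟩
  have h2 := abs_lt_of_bump_ne_zero (right_ne_zero_of_mul h) k
  have hc : 0 < η * (1 / 2 : ℝ) ^ i.1 := by positivity
  have h3 : y k - η * (1 / 2) ^ i.1 * i.2 k =
      (η * (1 / 2) ^ i.1) * ((η * (1 / 2) ^ i.1)⁻¹ * y k - i.2 k) := by field_simp
  rw [h3, abs_mul, abs_of_pos hc]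
  exact mul_lt_of_lt_one_right hc h2

/-- Coordinatewise, `y` is within one unit `η 2⁻ˡ` of the lattice point and `z` within two; `16 n η
≤ 1` turns the three units into `3/16`. -/
lemma norm_sub_le_of_cutoff_ne_zero {η : ℝ} (hη : 0 < η) (hη1 : 16 * n * η ≤ 1) {Ω : Set (E n)}
    {i : ℕ × (Fin n → ℤ)} {y z : E n} (h : cutoff η Ω i y ≠ 0) (hz : z ∈ whitney η i) :
    ‖y - z‖ ≤ 3 / 16 * (1 / 2) ^ i.1 := by
  have h1 := (lt_of_cutoff_ne_zero hη h).2.2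
  have h2 : ∀ k, |(y - z) k| ≤ 3 * (η * (1 / 2) ^ i.1) := by
    intro k
    have h3 := abs_lt.mp (h1 k)
    have h4 := abs_le.mp (hz k)
    simp only at h4
    rw [PiLp.sub_apply, abs_le]
    constructor <;> linarith
  refine (norm_le_of_abs_le _ (by positivity) h2).trans ?_
  have ht := half_pow_pos i.1
  nlinarith

lemma whitney_subset {η : ℝ} (hη : 0 < η) (hη1 : 16 * n * η ≤ 1) {Ω : Set (E n)}
    {i : ℕ × (Fin n → ℤ)} {y : E n} (h : cutoff η Ω i y ≠ 0) : whitney η i ⊆ Ω := by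
  intro z hz
  have h1 := norm_sub_le_of_cutoff_ne_zero hη hη1 h hz
  have h2 := (lt_of_cutoff_ne_zero hη h).1
  exact mem_of_lt_depth (y := y) (by linarith [half_pow_pos i.1])

lemma card_int_abs_le (r : ℝ) : (Finset.Icc ⌈r - 2⌉ ⌊r + 2⌋).card ≤ 5 := by
  rw [Int.card_Icc]
  have h1 := Int.floor_le (r + 2)
  have h2 := Int.le_ceil (r - 2)
  have h3 : (⌊r + 2⌋ : ℤ) ≤ ⌈r - 2⌉ + 4 := by
    have : ((⌊r + 2⌋ : ℤ) : ℝ) ≤ (⌈r - 2⌉ + 4 : ℤ) := by push_cast; linarith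
    exact_mod_cast this
  omega

open Classical in
-- Each coordinate of the lattice point is within `2` of a given number, which leaves at most five
-- integers.
lemma tsum_whitney_lattice_le {η : ℝ} (hη : 0 < η) (l : ℕ) (z : E n) :
    ∑' m : Fin n → ℤ, (if z ∈ whitney η (l, m) then (1 : ℝ≥0∞) else 0) ≤ 5 ^ n := by
  set c := η * (1 / 2 : ℝ) ^ l with hc
  have hc0 : 0 < c := by positivity
  set F := Fintype.piFinset fun k => Finset.Icc ⌈z k / c - 2⌉ ⌊z k / c + 2⌋
  have hF : ∀ m ∉ F, (if z ∈ whitney η (l, m) then (1 : ℝ≥0∞) else 0) = 0 := by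
    intro m hm
    rw [if_neg]
    intro hz
    refine hm (Fintype.mem_piFinset.mpr fun k => Finset.mem_Icc.mpr ?_)
    have h1 := abs_le.mp (hz k)
    simp only [← hc] at h1
    rw [Int.ceil_le, Int.le_floor]
    have h2 : z k / c * c = z k := by field_simp
    constructor <;> nlinarith
  rw [tsum_eq_sum hF]
  calc _ ≤ ∑ _m ∈ F, (1 : ℝ≥0∞) := Finset.sum_le_sum fun m _ => by split_ifs <;> simp
    _ = (F.card : ℝ≥0∞) := by simp
    _ ≤ ((5 ^ n : ℕ) : ℝ≥0∞) := by
        refine Nat.cast_le.mpr ?_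
        rw [Fintype.card_piFinset]
        calc _ ≤ ∏ _k : Fin n, 5 := Finset.prod_le_prod' fun k _ => card_int_abs_le _
          _ = 5 ^ n := by simp
    _ = 5 ^ n := by norm_num

open Classical in
/-- The cubes that meet the partition of unity have bounded overlap. -/
lemma tsum_whitney_le {η : ℝ} (hη : 0 < η) (hη1 : 16 * n * η ≤ 1) (Ω : Set (E n)) (z : E n) :
    ∑' i : ℕ × (Fin n → ℤ),
      (if (∃ y, cutoff η Ω i y ≠ 0) ∧ z ∈ whitney η i then (1 : ℝ≥0∞) else 0) ≤
      Ω.indicator (fun _ => 3 * 5 ^ n) z := by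
  by_cases hzΩ : z ∈ Ω
  swap
  · rw [Set.indicator_of_notMem hzΩ, nonpos_iff_eq_zero, ENNReal.tsum_eq_zero]
    intro i
    rw [if_neg]
    rintro ⟨⟨y, hy⟩, hz⟩
    exact hzΩ (whitney_subset hη hη1 hy hz)
  rw [Set.indicator_of_mem hzΩ]
  -- On the support of the cutoff the depth lies between `1/2` and `2` times `2⁻ˡ`, and moving to
  -- `z` changes it by at most `3/16`. The ratio of the resulting bounds is `7 < 8`, so at most
  -- three scales occur.
  set P : ℕ → Prop := fun l => 5 / 16 * (1 / 2) ^ l ≤ depth Ω z ∧ depth Ω z ≤ 35 / 16 * (1 / 2) ^ l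
  have hP : ∀ l l', P l → P l' → l' < l + 3 := by
    intro l l' h1 h2
    by_contra hcon
    have h3 : (1 / 2 : ℝ) ^ l' ≤ (1 / 2) ^ (l + 3) := half_pow_le (not_lt.mp hcon)
    rw [pow_add] at h3
    have := half_pow_pos l
    have h4 := h1.1
    have h5 := h2.2
    norm_num at h3
    linarith
  have hcount : ∑' l : ℕ, (if P l then (1 : ℝ≥0∞) else 0) ≤ 3 := by
    by_cases hex : ∃ l, P l
    · set l₀ := Nat.find hex
      have hF : ∀ l ∉ Finset.Ico l₀ (l₀ + 3), (if P l then (1 : ℝ≥0∞) else 0) = 0 := by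
        intro l hl
        rw [if_neg]
        intro h1
        exact hl (Finset.mem_Ico.mpr ⟨Nat.find_min' hex h1, hP _ _ (Nat.find_spec hex) h1⟩)
      rw [tsum_eq_sum hF]
      calc _ ≤ ∑ _l ∈ Finset.Ico l₀ (l₀ + 3), (1 : ℝ≥0∞) :=
            Finset.sum_le_sum fun m _ => by split_ifs <;> simp
        _ = 3 := by simp
    · push Not at hex
      simp [hex]
  calc _ ≤ ∑' i : ℕ × (Fin n → ℤ),
        (if P i.1 then (1 : ℝ≥0∞) else 0) * (if z ∈ whitney η i then (1 : ℝ≥0∞) else 0) := by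
        refine ENNReal.tsum_le_tsum fun i => ?_
        split_ifs with h1 h2 h3 h3 <;> try simp
        · exact (h3 h1.2).elim
        · obtain ⟨⟨y, hy⟩, hz⟩ := h1
          refine h2 ?_
          have h4 := norm_sub_le_of_cutoff_ne_zero hη hη1 hy hz
          have h5 := lt_of_cutoff_ne_zero hη hy
          have h6 := abs_le.mp (depth_sub_le Ω y z)
          constructor <;> linarith
        · exact h2 (by
            obtain ⟨⟨y, hy⟩, hz⟩ := h1
            have h4 := norm_sub_le_of_cutoff_ne_zero hη hη1 hy hz
            have h5 := lt_of_cutoff_ne_zero hη hy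
            have h6 := abs_le.mp (depth_sub_le Ω y z)
            constructor <;> linarith)
    _ = ∑' l : ℕ, (if P l then (1 : ℝ≥0∞) else 0) *
          ∑' m : Fin n → ℤ, (if z ∈ whitney η (l, m) then (1 : ℝ≥0∞) else 0) := by
        rw [ENNReal.tsum_prod']
        exact tsum_congr fun l => by rw [← ENNReal.tsum_mul_left]
    _ ≤ ∑' l : ℕ, (if P l then (1 : ℝ≥0∞) else 0) * 5 ^ n :=
        ENNReal.tsum_le_tsum fun l => mul_le_mul_right (tsum_whitney_lattice_le hη l z) _
    _ ≤ 3 * 5 ^ n := by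
        rw [ENNReal.tsum_mul_right]
        exact mul_le_mul_left hcount _

end Partition

/-! ### The pieces of the decomposition -/

section Pieces
variable {n : ℕ}

/-- A mollifier together with constants for which the means of a function are controlled by its
grand maximal function. -/
structure Calibration (s N : ℕ) (φ : E n → ℝ) (A η : ℝ) (J₀ : ℕ) (C : ℝ≥0) : Prop where
  moll : IsMollifier s φ
  eta_pos : 0 < η
  eta_le : 16 * n * η ≤ 1
  eta_le_one : 16 * η ≤ 1
  mul_eta : A * η = 2
  scale : 2 * A * (1 / 2) ^ J₀ ≤ 1
  meanSum_le : ∀ f : E n → ℂ, LocallyIntegrable f volume → ∀ j, J₀ ≤ j → ∀ y z : E n,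
    ‖y - z‖ ≤ A * (1 / 2) ^ j → ‖meanSum φ f j y‖ₑ ≤ C * grandMax N (ofFun f) z
  mean₂_le : ∀ f : E n → ℂ, LocallyIntegrable f volume → ∀ j, J₀ ≤ j → ∀ y z : E n,
    ‖y - z‖ ≤ 2 * A * (1 / 2) ^ j → ‖mean₂ φ f j y‖ₑ ≤ C * grandMax N (ofFun f) z

lemma exists_calibration (n s N : ℕ) : ∃ (φ : E n → ℝ) (A η : ℝ) (J₀ : ℕ) (C : ℝ≥0),
    Calibration s N φ A η J₀ C := by
  obtain ⟨φ, hφ⟩ := exists_isMollifier n s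
  set η : ℝ := 1 / (16 * (n + 1)) with hη
  have hη0 : 0 < η := by positivity
  -- With `A η = 2`, a layer `j` with `A 2⁻ʲ` below the depth `2 · 2⁻ˡ` has kernel radius `2⁻ʲ < η
  -- 2⁻ˡ`, so convolution does not leave the Whitney cube.
  set A : ℝ := 2 / η with hA
  have hA0 : 0 < A := by positivity
  have hAη : A * η = 2 := by rw [hA]; field_simp
  obtain ⟨J₀, hJ₀⟩ := exists_pow_lt_of_lt_one (by positivity : 0 < 1 / (2 * A + 3))
    (by norm_num : (1 / 2 : ℝ) < 1)
  rw [lt_div_iff₀ (by positivity)] at hJ₀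
  -- The aperture `2 * A + 1` covers the distance `2 * A` required for `mean₂` plus the reach of its
  -- outer convolution.
  obtain ⟨C, hC⟩ := exists_convAt_le hφ.test hφ.eq_zero
    (by have : ∫ z, hφ.test z = 1 := hφ.integral_eq_one
        rw [this]; exact one_ne_zero) N (by positivity : 0 ≤ 2 * A + 1)
  have hmean : ∀ f : E n → ℂ, LocallyIntegrable f volume → ∀ j, J₀ ≤ j → ∀ y z : E n,
      ‖y - z‖ ≤ (2 * A + 1) * (1 / 2) ^ j → ‖mean φ f j y‖ₑ ≤ C * grandMax N (ofFun f) z := by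
    intro f hf j hj y z hyz
    have h1 := hC (ofFun f) y z _ (half_pow_pos j) hyz (by
      have := half_pow_le hj
      have h2 : (2 * A + 1 + 2) * (1 / 2 : ℝ) ^ j ≤ (2 * A + 1 + 2) * (1 / 2) ^ J₀ := by gcongr
      linarith)
    rw [convAt_ofFun hf] at h1
    exact h1
  set I : ℝ := ∫ z, |φ z| with hI
  have hI0 : 0 ≤ I := integral_nonneg fun _ => abs_nonneg _
  refine ⟨φ, A, η, J₀, 2 * C + C * I.toNNReal, hφ, hη0, ?_, ?_, hAη, ?_, ?_, ?_⟩
  · rw [hη]; field_simp; linarith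
  · rw [hη, mul_one_div, div_le_one (by positivity)]
    have : (0 : ℝ) ≤ n := Nat.cast_nonneg n
    linarith
  · linarith [half_pow_pos J₀]
  · intro f hf j hj y z hyz
    have ht := half_pow_pos j
    have h1 := hmean f hf j hj y z (hyz.trans (by gcongr; linarith))
    have h2 := hmean f hf (j + 1) (by omega) y z (hyz.trans (by rw [half_pow_succ]; nlinarith))
    calc ‖meanSum φ f j y‖ₑ ≤ ‖mean φ f (j + 1) y‖ₑ + ‖mean φ f j y‖ₑ := enorm_add_le _ _
      _ ≤ C * grandMax N (ofFun f) z + C * grandMax N (ofFun f) z := add_le_add h2 h1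
      _ = ((2 * C : ℝ≥0) : ℝ≥0∞) * grandMax N (ofFun f) z := by push_cast; ring
      _ ≤ _ := by
          refine mul_le_mul_left (ENNReal.coe_le_coe.mpr ?_) _
          exact le_self_add
  · intro f hf j hj x z hxz
    rcases eq_or_ne (C * grandMax N (ofFun f) z) ∞ with htop | htop
    · have hC0 : (C : ℝ≥0∞) ≠ 0 := fun h0 => by
        rw [h0, zero_mul] at htop; exact ENNReal.zero_ne_top htop
      have hM : grandMax N (ofFun f) z = ∞ := by
        by_contra hne
        exact ENNReal.mul_ne_top ENNReal.coe_ne_top hne htop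
      rw [hM, ENNReal.mul_top]
      · exact le_top
      · simp only [ne_eq, ENNReal.coe_eq_zero, add_eq_zero, mul_eq_zero, not_and_or]
        left; simpa using hC0
    · set M := (C * grandMax N (ofFun f) z).toReal
      have h1 : ‖mean₂ φ f j x‖ ≤ M * ∫ z, |kern φ ((1 / 2) ^ j) z| := by
        refine norm_cv_le (hφ.kern_integrable j) (fun z => hφ.kern_zero (z := z)) fun y hy => ?_
        have h2 := hmean f hf j hj y z (by
          calc ‖y - z‖ ≤ ‖y - x‖ + ‖x - z‖ := norm_sub_le_norm_sub_add_norm_sub _ _ _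
            _ ≤ (2 * A + 1) * (1 / 2) ^ j := by rw [norm_sub_rev y x]; linarith)
        have h3 := ENNReal.toReal_mono htop h2
        rwa [toReal_enorm] at h3
      rw [integral_abs_kern φ (half_pow_pos j)] at h1
      rw [← ofReal_norm]
      refine (ENNReal.ofReal_le_ofReal h1).trans ?_
      rw [ENNReal.ofReal_mul ENNReal.toReal_nonneg, ENNReal.ofReal_toReal htop]
      calc C * grandMax N (ofFun f) z * ENNReal.ofReal I
          = ((C * I.toNNReal : ℝ≥0) : ℝ≥0∞) * grandMax N (ofFun f) z := by
            rw [ENNReal.ofReal, ENNReal.coe_mul]; ring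
        _ ≤ _ := mul_le_mul_left (ENNReal.coe_le_coe.mpr le_add_self) _

variable {s N : ℕ} {φ : E n → ℝ} {A η : ℝ} {J₀ : ℕ} {C : ℝ≥0}

lemma Calibration.three_le (h : Calibration s N φ A η J₀ C) : 3 ≤ A := by
  have h1 := h.mul_eta
  have h2 := h.eta_le_one
  have h3 := h.eta_pos
  by_contra hcon
  nlinarith [not_le.mp hcon]

/-- Pass to the limit in the bound for the twofold means. -/
lemma Calibration.ae_enorm_le (h : Calibration s N φ A η J₀ C) {f : E n → ℂ}
    (hf : LocallyIntegrable f volume) : ∀ᵐ x, ‖f x‖ₑ ≤ C * grandMax N (ofFun f) x := by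
  filter_upwards [h.moll.tendsto_mean₂ hf] with x hx
  refine le_of_tendsto hx.enorm ?_
  filter_upwards [Filter.eventually_ge_atTop J₀] with j hj
  exact h.mean₂_le f hf j hj x x (by
    have := h.three_le
    have := half_pow_pos j
    rw [sub_self, norm_zero]; positivity)

/-- The superlevel sets of a function at dyadic heights. -/
def level (M : E n → ℝ≥0∞) (k : ℤ) : Set (E n) := {y | (2 : ℝ≥0∞) ^ k < M y}

lemma isOpen_level {M : E n → ℝ≥0∞} (hM : LowerSemicontinuous M) (k : ℤ) : IsOpen (level M k) :=
  hM.isOpen_preimage _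

lemma level_anti (M : E n → ℝ≥0∞) {k l : ℤ} (h : k ≤ l) : level M l ⊆ level M k := fun _ hy =>
  (ENNReal.zpow_le_of_le (by norm_num) h).trans_lt hy

lemma ofReal_two_zpow (k : ℤ) : ENNReal.ofReal ((2 : ℝ) ^ k) = (2 : ℝ≥0∞) ^ k := by
  have h1 : ((2 : ℝ) ^ k) = (((2 : ℝ≥0) ^ k : ℝ≥0) : ℝ) := by push_cast; rfl
  rw [h1, ENNReal.ofReal_coe_nnreal, ENNReal.coe_zpow (by norm_num)]
  norm_num

lemma norm_le_of_enorm_le_zpow {v : ℂ} {C : ℝ≥0} {k : ℤ} (h : ‖v‖ₑ ≤ C * (2 : ℝ≥0∞) ^ k) :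
    ‖v‖ ≤ C * 2 ^ k := by
  have h1 : (C : ℝ≥0∞) * (2 : ℝ≥0∞) ^ k ≠ ∞ :=
    ENNReal.mul_ne_top ENNReal.coe_ne_top (ENNReal.zpow_ne_top (by norm_num) (by norm_num) k)
  have h2 := ENNReal.toReal_mono h1 h
  rwa [toReal_enorm, ENNReal.toReal_mul, ENNReal.coe_toReal, ← ofReal_two_zpow,
    ENNReal.toReal_ofReal (by positivity)] at h2

/-- Some point within `A 2⁻ʲ` lies outside the superlevel set, and there the maximal function is at
most `2 ^ k`. The choice of `J₀` keeps the radius below the truncation of the depth. -/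
lemma Calibration.norm_meanSum_le (h : Calibration s N φ A η J₀ C) {f : E n → ℂ}
    (hf : LocallyIntegrable f volume) {k : ℤ} {j : ℕ} (hj : J₀ ≤ j) {y : E n}
    (hy : depth (level (grandMax N (ofFun f)) k) y < A * (1 / 2) ^ j) :
    ‖meanSum φ f j y‖ ≤ C * 2 ^ k := by
  have hA := h.three_le
  have h1 : A * (1 / 2) ^ j ≤ 1 := by
    have h2 : 2 * A * (1 / 2) ^ j ≤ 2 * A * (1 / 2 : ℝ) ^ J₀ := by gcongr 2 * A * ?_; exact half_pow_le hj
    have := half_pow_pos j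
    nlinarith [h.scale]
  obtain ⟨z, hz, hyz⟩ := exists_notMem_of_depth_lt h1 hy
  refine norm_le_of_enorm_le_zpow ((h.meanSum_le f hf j hj y z hyz.le).trans ?_)
  exact mul_le_mul_right (not_lt.mp hz) _

lemma Calibration.norm_mean₂_le (h : Calibration s N φ A η J₀ C) {f : E n → ℂ}
    (hf : LocallyIntegrable f volume) {k : ℤ} {j : ℕ} (hj : J₀ ≤ j) {y : E n}
    (hy : depth (level (grandMax N (ofFun f)) k) y < 2 * A * (1 / 2) ^ j) :
    ‖mean₂ φ f j y‖ ≤ C * 2 ^ k := by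
  have hA := h.three_le
  have h1 : 2 * A * (1 / 2) ^ j ≤ 1 := by
    have h2 : 2 * A * (1 / 2) ^ j ≤ 2 * A * (1 / 2 : ℝ) ^ J₀ := by gcongr 2 * A * ?_; exact half_pow_le hj
    linarith [h.scale]
  obtain ⟨z, hz, hyz⟩ := exists_notMem_of_depth_lt h1 hy
  refine norm_le_of_enorm_le_zpow ((h.mean₂_le f hf j hj y z hyz.le).trans ?_)
  exact mul_le_mul_right (not_lt.mp hz) _

/-- The index set of the decomposition: a height, a scale and a lattice point. -/
abbrev Index (n : ℕ) : Type := ℤ × ℕ × (Fin n → ℤ)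

/-- The layer `j` of the function localized to the cube with the given index. -/
def localPiece (φ : E n → ℝ) (A η : ℝ) (N : ℕ) (f : E n → ℂ) (i : Index n) (j : ℕ) : E n → ℂ :=
  piece φ f A (depth (level (grandMax N (ofFun f)) i.1))
    (depth (level (grandMax N (ofFun f)) (i.1 + 1)))
    (cutoff η (level (grandMax N (ofFun f)) i.1) i.2) j

/-- A multiple of an atom: the sum of finitely many layers of a function localized to a cube. -/
def localSum (φ : E n → ℝ) (A η : ℝ) (N J₀ J : ℕ) (f : E n → ℂ) (i : Index n) (x : E n) : ℂ :=
  ∑ j ∈ Finset.Ico J₀ J, cv (diffKern φ j) (localPiece φ A η N f i j) x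

/-- The cube with the given index meets the corresponding superlevel set in an essential way. -/
def Active (η : ℝ) (N : ℕ) (f : E n → ℂ) (i : Index n) : Prop :=
  ∃ y, cutoff η (level (grandMax N (ofFun f)) i.1) i.2 y ≠ 0

/-- Points selected at height `k` are close to the complement of the level `k + 1`, which gives `Λ =
C 2^(k+1)`. The scale cancels in the product of `δ` and the Lipschitz constant. -/
lemma Calibration.exists_localSum_le (h : Calibration s N φ A η J₀ C) :
    ∃ K : ℝ≥0, ∀ f : E n → ℂ, LocallyIntegrable f volume → ∀ (J : ℕ) (i : Index n) (x : E n),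
      ‖localSum φ A η N J₀ J f i x‖ₑ ≤ K * (2 : ℝ≥0∞) ^ i.1 := by
  set K : ℝ := (2 + (2 + 2 * (3 * η + n)) * (2 * ∫ z, |φ z|)) * (C * 2) with hK
  have hA := h.three_le
  have hη := h.eta_pos
  refine ⟨K.toNNReal, fun f hf J i x => ?_⟩
  have ht := half_pow_pos i.2.1
  have h1 := h.moll.norm_sum_piece_le hf
    (depth_sub_le (level (grandMax N (ofFun f)) i.1))
    (depth_sub_le (level (grandMax N (ofFun f)) (i.1 + 1)))
    (cutoff_nonneg η (level (grandMax N (ofFun f)) i.1) i.2)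
    (cutoff_le_one η (level (grandMax N (ofFun f)) i.1) i.2)
    (continuous_cutoff hη _ _) (L := (3 + n / η) / (1 / 2) ^ i.2.1) (by positivity)
    (cutoff_sub_le hη _ _) (δ := 2 * (1 / 2) ^ i.2.1) (by positivity)
    (fun y hy => (lt_of_cutoff_ne_zero hη hy).2.1.le) hA (Λ := C * 2 ^ (i.1 + 1)) (by positivity)
    (fun j hj y hy => h.norm_meanSum_le hf hj hy) (fun j hj y hy => h.norm_mean₂_le hf hj hy) J x
  have h2 : 2 * (2 * (1 / 2) ^ i.2.1 / A) * ((3 + n / η) / (1 / 2) ^ i.2.1) = 2 * (3 * η + n) := by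
    have hA' : A = 2 / η := by rw [eq_div_iff hη.ne']; exact h.mul_eta
    rw [hA']; field_simp
  rw [h2, zpow_add_one₀ (by norm_num)] at h1
  have h3 : ‖localSum φ A η N J₀ J f i x‖ ≤ K * 2 ^ i.1 := by
    refine h1.trans (le_of_eq ?_)
    rw [hK]; ring
  rw [← ofReal_norm]
  refine (ENNReal.ofReal_le_ofReal h3).trans (le_of_eq ?_)
  rw [ENNReal.ofReal_mul' (by positivity), ofReal_two_zpow, ENNReal.ofReal]

/-- The cutoff lives within `η 2⁻ˡ` of the lattice point and the kernels that occur have radius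
below `η 2⁻ˡ`; the Whitney cube has half-side `2 η 2⁻ˡ`. -/
lemma Calibration.of_localSum_ne_zero (h : Calibration s N φ A η J₀ C) {f : E n → ℂ} {J : ℕ}
    {i : Index n} {x : E n} (hx : localSum φ A η N J₀ J f i x ≠ 0) :
    Active η N f i ∧ x ∈ whitney η i.2 := by
  obtain ⟨j, -, y, hxy, hy, hdy⟩ := h.moll.exists_of_sum_piece_ne_zero hx
  refine ⟨⟨y, hy⟩, fun k => ?_⟩
  have h1 := lt_of_cutoff_ne_zero h.eta_pos hy
  have hA := h.three_le
  have h2 : (1 / 2 : ℝ) ^ j < η * (1 / 2) ^ i.2.1 := by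
    have h3 : A * (1 / 2 : ℝ) ^ j < A * (η * (1 / 2) ^ i.2.1) := by
      rw [← mul_assoc, h.mul_eta]; linarith [h1.2.1]
    exact lt_of_mul_lt_mul_left h3 (by linarith)
  have h4 := abs_apply_le_norm (x - y) k
  rw [PiLp.sub_apply] at h4
  have h5 := abs_le.mp h4
  have h6 := abs_lt.mp (h1.2.2 k)
  simp only
  rw [abs_le]
  constructor <;> linarith

lemma piece_eq_indicator (f : E n → ℂ) (d d' ζ : E n → ℝ) (j : ℕ) :
    piece φ f A d d' ζ j = {y | A * (1 / 2) ^ j ≤ d y ∧ d' y < A * (1 / 2) ^ j}.indicator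
      fun y => ζ y • meanSum φ f j y := by
  classical
  ext y
  rw [piece, Set.indicator_apply]
  congr

lemma Calibration.measurable_localPiece (h : Calibration s N φ A η J₀ C) {f : E n → ℂ}
    (hf : LocallyIntegrable f volume) (i : Index n) (j : ℕ) :
    Measurable (localPiece φ A η N f i j) := by
  rw [localPiece, piece_eq_indicator]
  refine ((continuous_cutoff h.eta_pos _ _).smul (h.moll.continuous_meanSum hf j)).measurable.indicator
    ?_
  exact (measurableSet_le measurable_const (continuous_depth _).measurable).inter
    (measurableSet_lt (continuous_depth _).measurable measurable_const)

lemma Calibration.cutoff_eq_zero (h : Calibration s N φ A η J₀ C) (Ω : Set (E n))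
    {i : ℕ × (Fin n → ℤ)} {y : E n} (hy : y ∉ whitney η i) : cutoff η Ω i y = 0 := by
  by_contra hne
  refine hy fun k => ?_
  have h1 := (lt_of_cutoff_ne_zero h.eta_pos hne).2.2 k
  have := half_pow_pos i.1
  have := mul_pos h.eta_pos this
  simp only
  linarith

lemma Calibration.isCompact_whitney (h : Calibration s N φ A η J₀ C) (i : ℕ × (Fin n → ℤ)) :
    IsCompact (whitney η i : Set (E n)) :=
  isCompact_cube _ (by have := h.eta_pos; positivity)

lemma Calibration.integrable_localPiece (h : Calibration s N φ A η J₀ C) {f : E n → ℂ}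
    (hf : LocallyIntegrable f volume) (i : Index n) (j : ℕ) :
    Integrable (localPiece φ A η N f i j) volume := by
  rw [localPiece, piece_eq_indicator]
  refine Integrable.indicator ?_ ?_
  · refine ((continuous_cutoff h.eta_pos _ _).smul
      (h.moll.continuous_meanSum hf j)).integrable_of_hasCompactSupport ?_
    refine HasCompactSupport.of_support_subset_isCompact (h.isCompact_whitney i.2) ?_
    intro y hy
    by_contra hcon
    refine hy ?_
    simp only [Pi.smul_apply', h.cutoff_eq_zero _ hcon, zero_smul]
  · exact (measurableSet_le measurable_const (continuous_depth _).measurable).inter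
      (measurableSet_lt (continuous_depth _).measurable measurable_const)

lemma Calibration.continuous_localSum (h : Calibration s N φ A η J₀ C) {f : E n → ℂ}
    (hf : LocallyIntegrable f volume) (J : ℕ) (i : Index n) :
    Continuous (localSum φ A η N J₀ J f i) := by
  unfold localSum
  exact continuous_finsetSum _ fun j _ => continuous_cv (h.moll.diffKern_cont j)
    (h.moll.diffKern_compact j) (h.integrable_localPiece hf i j).locallyIntegrable

lemma Calibration.vanishingMoments_localSum (h : Calibration s N φ A η J₀ C) {f : E n → ℂ}
    (hf : LocallyIntegrable f volume) (J : ℕ) (i : Index n) :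
    VanishingMoments s (localSum φ A η N J₀ J f i) := by
  obtain ⟨R, hR⟩ := (h.isCompact_whitney i.2).isBounded.subset_closedBall 0
  have hz : ∀ j y, R < ‖y‖ → localPiece φ A η N f i j y = 0 := by
    intro j y hy
    have h1 : y ∉ whitney η i.2 := fun hmem => by
      have := hR hmem
      rw [mem_closedBall_zero_iff] at this
      linarith
    rw [localPiece, piece_eq_indicator]
    simp only [Set.indicator_apply, h.cutoff_eq_zero _ h1, zero_smul, ite_self]
  have hvm : ∀ j, VanishingMoments s (cv (diffKern φ j) (localPiece φ A η N f i j)) := fun j =>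
    vanishingMoments_cv (h.moll.diffKern_cont j) (fun z hz' => h.moll.diffKern_zero hz')
      (h.moll.vanishingMoments_diffKern j) (h.integrable_localPiece hf i j) (hz j)
  intro α hα
  unfold localSum
  simp_rw [Finset.sum_mul]
  rw [integral_finsetSum]
  · exact Finset.sum_eq_zero fun j _ => hvm j α hα
  · intro j _
    have hc := continuous_cv (h.moll.diffKern_cont j)
      (h.moll.diffKern_compact j) (h.integrable_localPiece hf i j).locallyIntegrable
    refine (hc.mul (by fun_prop)).integrable_of_hasCompactSupport (HasCompactSupport.mul_right ?_)
    refine HasCompactSupport.of_support_subset_isCompact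
      (isCompact_closedBall (0 : E n) (R + (1 / 2) ^ j)) fun x hx => ?_
    rw [mem_closedBall_zero_iff]
    by_contra hcon
    refine hx (cv_eq_zero (fun z hz' => h.moll.diffKern_zero hz') fun y hy => hz j y ?_)
    have : ‖x‖ ≤ ‖x - y‖ + ‖y‖ := by
      have := norm_add_le (x - y) y; rwa [sub_add_cancel] at this
    linarith [not_le.mp hcon]

end Pieces

/-! ### Summation of the pieces -/

section Summation
variable {n : ℕ} {s N : ℕ} {φ : E n → ℝ} {A η : ℝ} {J₀ : ℕ} {C : ℝ≥0}

/-- Depth decreases with the height, and the largest height with depth at least `A 2⁻ʲ` is taken.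
Such heights are bounded above because `M f (y)` is finite. If there were none, the layer would be
at most `C 2^k` at `y` for every `k`, hence zero. -/
lemma Calibration.exists_height (h : Calibration s N φ A η J₀ C) {f : E n → ℂ}
    (hf : LocallyIntegrable f volume) {j : ℕ} (hj : J₀ ≤ j) {y : E n}
    (hM : grandMax N (ofFun f) y ≠ ∞) (hu : meanSum φ f j y ≠ 0) :
    ∃ k : ℤ, A * (1 / 2) ^ j ≤ depth (level (grandMax N (ofFun f)) k) y ∧
      depth (level (grandMax N (ofFun f)) (k + 1)) y < A * (1 / 2) ^ j := by
  have hA := h.three_le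
  have ht : 0 < A * (1 / 2 : ℝ) ^ j := by
    have := half_pow_pos j
    positivity
  set P : ℤ → Prop := fun k => A * (1 / 2) ^ j ≤ depth (level (grandMax N (ofFun f)) k) y with hP
  have hbdd : ∃ b, ∀ k, P k → k ≤ b := by
    obtain ⟨b, hb⟩ := pow_unbounded_of_one_lt (grandMax N (ofFun f) y).toReal one_lt_two
    refine ⟨b, fun k hk => ?_⟩
    by_contra hcon
    have h1 : y ∉ level (grandMax N (ofFun f)) k := by
      refine fun hmem => not_le.mpr
        (show (2 : ℝ≥0∞) ^ (b : ℤ) < _ from (level_anti _ (not_le.mp hcon).le) hmem) ?_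
      rw [← ENNReal.ofReal_toReal hM, ← ofReal_two_zpow]
      refine ENNReal.ofReal_le_ofReal ?_
      rw [zpow_natCast]; exact hb.le
    simp only [hP, depth_eq_zero h1] at hk
    linarith
  have hinh : ∃ k, P k := by
    by_contra hcon
    push Not at hcon
    have h1 : ∀ k : ℤ, ‖meanSum φ f j y‖ ≤ C * 2 ^ k := fun k =>
      h.norm_meanSum_le hf hj (not_le.mp (hcon k))
    have hpos : 0 < ‖meanSum φ f j y‖ := norm_pos_iff.mpr hu
    obtain ⟨m, hm⟩ := exists_pow_lt_of_lt_one
      (by positivity : 0 < ‖meanSum φ f j y‖ / (C + 1)) (by norm_num : (1 / 2 : ℝ) < 1)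
    rw [lt_div_iff₀ (by positivity)] at hm
    have h2 := h1 (-(m : ℤ))
    rw [zpow_neg, zpow_natCast, ← inv_pow, ← one_div] at h2
    nlinarith [half_pow_pos m]
  obtain ⟨k, hk, hk'⟩ := Int.exists_greatest_of_bdd hbdd hinh
  refine ⟨k, hk, ?_⟩
  by_contra hcon
  have := hk' (k + 1) (not_lt.mp hcon)
  omega

/-- Exactly one height selects the point, by monotonicity of the depth in the height, and the
cutoffs of that height sum to one there. -/
lemma Calibration.hasSum_localPiece (h : Calibration s N φ A η J₀ C) {f : E n → ℂ}
    (hf : LocallyIntegrable f volume) {j : ℕ} (hj : J₀ ≤ j) {y : E n}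
    (hM : grandMax N (ofFun f) y ≠ ∞) :
    HasSum (fun i => localPiece φ A η N f i j y) (meanSum φ f j y) ∧
      HasSum (fun i => ‖localPiece φ A η N f i j y‖) ‖meanSum φ f j y‖ := by
  rcases eq_or_ne (meanSum φ f j y) 0 with hu | hu
  · have h0 : ∀ i, localPiece φ A η N f i j y = 0 := fun i => by
      rw [localPiece, piece, hu, smul_zero, ite_self]
    simp_rw [h0, hu, norm_zero]
    exact ⟨hasSum_zero, hasSum_zero⟩
  obtain ⟨k, hk, hk'⟩ := h.exists_height hf hj hM hu
  have hA := h.three_le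
  have ht := half_pow_pos j
  set Mf := grandMax N (ofFun f) with hMf
  have hyk : y ∈ level Mf k := by
    by_contra hcon
    rw [depth_eq_zero hcon] at hk
    have : 0 < A * (1 / 2 : ℝ) ^ j := by positivity
    linarith
  have hζ := hasSum_cutoff η (isOpen_level (lowerSemicontinuous_grandMax hf N) k) hyk
  have hin : ∀ i, localPiece φ A η N f (k, i) j y = cutoff η (level Mf k) i y • meanSum φ f j y :=
    fun i => by rw [localPiece, piece, if_pos ⟨hk, hk'⟩]
  have hout : ∀ i : Index n, i ∉ Set.range (Prod.mk k) → localPiece φ A η N f i j y = 0 := by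
    intro i hi
    rw [localPiece, piece, if_neg]
    rintro ⟨h1, h2⟩
    refine hi ⟨i.2, ?_⟩
    rcases lt_trichotomy i.1 k with h3 | h3 | h3
    · have := depth_anti (level_anti Mf (by omega : i.1 + 1 ≤ k)) y
      linarith
    · rw [← h3]
    · have := depth_anti (level_anti Mf (by omega : k + 1 ≤ i.1)) y
      linarith
  have hinj : Function.Injective (Prod.mk k : ℕ × (Fin n → ℤ) → Index n) := Prod.mk_right_injective k
  constructor
  · rw [← hinj.hasSum_iff hout]
    have := hζ.smul_const (meanSum φ f j y)
    rw [one_smul] at this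
    exact this.congr_fun (fun i => hin i)
  · rw [← hinj.hasSum_iff fun i hi => by rw [hout i hi, norm_zero]]
    have := hζ.mul_right ‖meanSum φ f j y‖
    rw [one_mul] at this
    refine this.congr_fun fun i => ?_
    simp only [Function.comp, hin i, norm_smul, Real.norm_of_nonneg (cutoff_nonneg _ _ _ _), hMf]

/-- Sum the pieces inside each of the finitely many convolutions; the absolute sums equal
`|meanSum|` almost everywhere, so dominated convergence applies. -/
lemma Calibration.hasSum_localSum (h : Calibration s N φ A η J₀ C) {f : E n → ℂ}
    (hf : LocallyIntegrable f volume) (hM : ∀ᵐ y, grandMax N (ofFun f) y ≠ ∞) {J : ℕ}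
    (hJ : J₀ ≤ J) (x : E n) :
    HasSum (fun i => localSum φ A η N J₀ J f i x) (mean₂ φ f J x - mean₂ φ f J₀ x) := by
  have h1 : mean₂ φ f J x - mean₂ φ f J₀ x =
      ∑ j ∈ Finset.Ico J₀ J, cv (diffKern φ j) (meanSum φ f j) x := by
    simp_rw [h.moll.cv_diffKern hf]
    exact (Finset.sum_Ico_sub (fun j => mean₂ φ f j x) hJ).symm
  rw [h1]
  refine hasSum_sum fun j hj => ?_
  have hj0 := (Finset.mem_Ico.mp hj).1
  have hκc : Continuous fun y => diffKern φ j (x - y) := (h.moll.diffKern_cont j).comp (by fun_prop)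
  refine hasSum_integral_of_dominated_convergence
    (fun i y => ‖diffKern φ j (x - y) • localPiece φ A η N f i j y‖) ?_ ?_ ?_ ?_ ?_
  · intro i
    exact (hκc.measurable.smul (h.measurable_localPiece hf i j)).aestronglyMeasurable
  · exact fun i => Filter.Eventually.of_forall fun y => le_rfl
  · filter_upwards [hM] with y hy
    simp_rw [norm_smul]
    exact ((h.hasSum_localPiece hf hj0 hy).2.mul_left _).summable
  · have hgint := (integrable_conv (h.moll.diffKern_cont j) (h.moll.diffKern_compact j)
      (h.moll.continuous_meanSum hf j).locallyIntegrable x).norm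
    refine hgint.congr ?_
    filter_upwards [hM] with y hy
    simp_rw [norm_smul]
    exact ((h.hasSum_localPiece hf hj0 hy).2.mul_left _).tsum_eq.symm
  · filter_upwards [hM] with y hy
    exact (h.hasSum_localPiece hf hj0 hy).1.const_smul _

open Classical in
-- At each height the cubes overlap boundedly inside the superlevel set; the heights with `2^k < M f
-- (x)` then form a geometric series.
lemma Calibration.exists_tsum_le (h : Calibration s N φ A η J₀ C) {θ : ℝ} (hθ : 0 < θ) :
    ∃ K : ℝ≥0, ∀ (f : E n → ℂ) (x : E n),
      ∑' i : Index n, (if Active η N f i ∧ x ∈ whitney η i.2 then ((2 : ℝ≥0∞) ^ i.1) ^ θ else 0) ≤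
        K * grandMax N (ofFun f) x ^ θ := by
  obtain ⟨K, -, hK⟩ := exists_tsum_dyadic_le hθ
  refine ⟨3 * 5 ^ n * K, fun f x => ?_⟩
  set M := grandMax N (ofFun f)
  calc _ = ∑' k : ℤ, ∑' i : ℕ × (Fin n → ℤ), ((2 : ℝ≥0∞) ^ k) ^ θ *
        (if (∃ y, cutoff η (level M k) i y ≠ 0) ∧ x ∈ whitney η i then (1 : ℝ≥0∞) else 0) := by
        rw [ENNReal.tsum_prod']
        refine tsum_congr fun k => tsum_congr fun i => ?_
        rw [mul_ite, mul_one, mul_zero]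
        rfl
    _ ≤ ∑' k : ℤ, ((2 : ℝ≥0∞) ^ k) ^ θ * (level M k).indicator (fun _ => 3 * 5 ^ n) x := by
        refine ENNReal.tsum_le_tsum fun k => ?_
        rw [ENNReal.tsum_mul_left]
        exact mul_le_mul_right (tsum_whitney_le h.eta_pos h.eta_le _ x) _
    _ = 3 * 5 ^ n * ∑' k : ℤ, (if (2 : ℝ≥0∞) ^ k < M x then ((2 : ℝ≥0∞) ^ k) ^ θ else 0) := by
        rw [← ENNReal.tsum_mul_left]
        refine tsum_congr fun k => ?_
        rw [Set.indicator_apply, mul_ite, mul_ite, mul_zero, mul_zero, mul_comm]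
        exact if_congr Iff.rfl rfl rfl
    _ ≤ 3 * 5 ^ n * (K * M x ^ θ) := mul_le_mul_right (hK _) _
    _ = _ := by push_cast; ring

end Summation

/-! ### Absolute convergence and total atomic cost of the pieces -/

section Bounds
variable {n : ℕ} {w : E n → ℝ} {p q : ℝ} {s N : ℕ} {φ : E n → ℝ} {A η : ℝ} {J₀ : ℕ} {C : ℝ≥0}

/-- The overlap estimate with `θ = 1`; it is the majorant that later gives convergence in `L^q_w`.
-/
lemma Calibration.enorm_localSum_le (h : Calibration s N φ A η J₀ C) :
    ∃ K : ℝ≥0, ∀ f : E n → ℂ, LocallyIntegrable f volume → ∀ (J : ℕ) (x : E n),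
      ∑' i, ‖localSum φ A η N J₀ J f i x‖ₑ ≤ K * grandMax N (ofFun f) x := by
  classical
  obtain ⟨K, hK⟩ := h.exists_localSum_le
  obtain ⟨K', hK'⟩ := h.exists_tsum_le one_pos
  refine ⟨K * K', fun f hf J x => ?_⟩
  have h1 := hK' f x
  simp only [ENNReal.rpow_one] at h1
  calc ∑' i, ‖localSum φ A η N J₀ J f i x‖ₑ
      ≤ ∑' i : Index n, K *
          (if Active η N f i ∧ x ∈ whitney η i.2 then (2 : ℝ≥0∞) ^ i.1 else 0) := by
        refine ENNReal.tsum_le_tsum fun i => ?_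
        by_cases h0 : localSum φ A η N J₀ J f i x = 0
        · rw [h0, enorm_zero]; exact zero_le
        · rw [if_pos (h.of_localSum_ne_zero h0)]
          exact hK f hf J i x
    _ ≤ K * (K' * grandMax N (ofFun f) x) := by
        rw [ENNReal.tsum_mul_left]; exact mul_le_mul_right h1 _
    _ = _ := by push_cast; ring

/-- Each piece costs at most a constant times `2^(kp) w(Q)`. Write this as an integral over `Q`,
exchange sum and integral, and use the overlap estimate with `θ = p`. -/
lemma Calibration.finNorm_localSum_le (h : Calibration s N φ A η J₀ C) (hw : Admissible w p q) :
    ∃ K : ℝ≥0, ∀ f : E n → ℂ, LocallyIntegrable f volume → ∀ J : ℕ,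
      ∑' i, finNorm w p q s (ofFun (localSum φ A η N J₀ J f i)) ^ p ≤
        K * ∫⁻ x, grandMax N (ofFun f) x ^ p ∂(wMeasure w) := by
  classical
  obtain ⟨K, hK⟩ := h.exists_localSum_le
  obtain ⟨K', hK'⟩ := h.exists_tsum_le hw.p_pos
  have hp := hw.p_pos
  refine ⟨K ^ p * K', fun f hf J => ?_⟩
  have hη := h.eta_pos
  have h1 : ∀ i, finNorm w p q s (ofFun (localSum φ A η N J₀ J f i)) ^ p ≤
      ∫⁻ x, K ^ p * (if Active η N f i ∧ x ∈ whitney η i.2 then ((2 : ℝ≥0∞) ^ i.1) ^ p else 0)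
        ∂(wMeasure w) := by
    intro i
    have ht := half_pow_pos i.2.1
    by_cases hact : Active η N f i
    · have h2 := hw.finNorm_rpow_le_of_bounded s (a := localSum φ A η N J₀ J f i)
        (h.continuous_localSum hf J i).aestronglyMeasurable
        (x := WithLp.toLp 2 fun k => η * (1 / 2) ^ i.2.1 * i.2.2 k)
        (t := 4 * (η * (1 / 2) ^ i.2.1)) (by positivity)
        (by
          have h3 : (1 / 2 : ℝ) ^ i.2.1 ≤ 1 := pow_le_one₀ (by norm_num) (by norm_num)
          nlinarith [h.eta_le_one])
        (fun x hx => (h.of_localSum_ne_zero hx).2)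
        (fun _ => h.vanishingMoments_localSum hf J i) (hK f hf J i)
      refine h2.trans (le_of_eq ?_)
      have h4 : (fun x => (K : ℝ≥0∞) ^ p *
          (if Active η N f i ∧ x ∈ whitney η i.2 then ((2 : ℝ≥0∞) ^ i.1) ^ p else 0)) =
          (whitney η i.2).indicator fun _ => ((K : ℝ≥0∞) * (2 : ℝ≥0∞) ^ i.1) ^ p := by
        ext x
        simp only [hact, true_and, Set.indicator_apply]
        split_ifs
        · rw [ENNReal.mul_rpow_of_nonneg _ _ hp.le]
        · rw [mul_zero]
      rw [h4, lintegral_indicator_const (h.isCompact_whitney i.2).measurableSet]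
      rfl
    · have h2 : localSum φ A η N J₀ J f i = 0 := by
        ext x
        by_contra h0
        exact hact (h.of_localSum_ne_zero h0).1
      rw [h2, ofFun_zero, hw.finNorm_zero, ENNReal.zero_rpow_of_pos hp]
      exact zero_le
  calc ∑' i, finNorm w p q s (ofFun (localSum φ A η N J₀ J f i)) ^ p
      ≤ ∑' i : Index n, ∫⁻ x, K ^ p *
          (if Active η N f i ∧ x ∈ whitney η i.2 then ((2 : ℝ≥0∞) ^ i.1) ^ p else 0)
            ∂(wMeasure w) := ENNReal.tsum_le_tsum h1
    _ = ∫⁻ x, ∑' i : Index n, K ^ p *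
          (if Active η N f i ∧ x ∈ whitney η i.2 then ((2 : ℝ≥0∞) ^ i.1) ^ p else 0)
            ∂(wMeasure w) := by
        rw [lintegral_tsum]
        intro i
        refine (Measurable.const_mul (Measurable.ite ?_ measurable_const measurable_const) _).aemeasurable
        exact (MeasurableSet.const _).inter (h.isCompact_whitney i.2).measurableSet
    _ ≤ ∫⁻ x, ((K ^ p * K' : ℝ≥0) : ℝ≥0∞) * grandMax N (ofFun f) x ^ p ∂(wMeasure w) := by
        refine lintegral_mono fun x => ?_
        rw [ENNReal.tsum_mul_left, ENNReal.coe_mul, ← ENNReal.coe_rpow_of_nonneg _ hp.le, mul_assoc]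
        exact mul_le_mul_right (hK' f x) _
    _ = _ := lintegral_const_mul _ ((measurable_grandMax hf N).pow_const p)

end Bounds

/-! ### The lower bound -/

section Lower
variable {n : ℕ} {w : E n → ℝ} {p q : ℝ} {s N : ℕ} {φ : E n → ℝ} {A η : ℝ} {J₀ : ℕ} {C : ℝ≥0}

/-- On functions supported in `S`, the finite atomic quasi-norm is bounded by a multiple of the
norm of `L^q_w`. -/
def BoundedOn (w : E n → ℝ) (p q : ℝ) (s : ℕ) (S : Set (E n)) : Prop :=
  ∃ K : ℝ≥0∞, K ≠ ∞ ∧ ∀ ρ : E n → ℂ, AEStronglyMeasurable ρ volume → Function.support ρ ⊆ S →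
    finNorm w p q s (ofFun ρ) ≤ K * eLpNorm ρ (ENNReal.ofReal q) (wMeasure w)

lemma Admissible.boundedOn_univ (h : Admissible w p q) (s : ℕ) (hw : wMeasure w Set.univ ≠ ∞) :
    BoundedOn w p q s Set.univ := by
  refine ⟨wMeasure w Set.univ ^ (1 / p - 1 / q), ?_, fun ρ hρ _ => ?_⟩
  · exact ENNReal.rpow_ne_top_of_nonneg (by linarith [h.exponent_neg]) hw
  · rw [mul_comm]; exact h.finNorm_ofFun_le_univ s hρ hw

lemma continuous_bump {c : ℝ} (hc : 0 ≤ c) (m : Fin n → ℤ) : Continuous (bump (n := n) c m) := by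
  refine LipschitzWith.continuous (K := (n * c).toNNReal) (LipschitzWith.of_dist_le_mul fun x y => ?_)
  rw [Real.dist_eq, dist_eq_norm, Real.coe_toNNReal _ (by positivity)]
  exact bump_sub_le hc m x y

/-- A ball is covered by finitely many cubes of side `2`, on which no moments are required, so a
partition of unity splits the function into multiples of atoms. The constant depends on `R`. -/
lemma Admissible.boundedOn_closedBall (h : Admissible w p q) (s : ℕ) (R : ℝ) :
    BoundedOn w p q s (Metric.closedBall 0 R) := by
  have hp := h.p_pos
  set b : ℤ := ⌈R⌉ + 1 with hb
  set F : Finset (Fin n → ℤ) := Fintype.piFinset fun _ => Finset.Icc (-b) b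
  set c : (Fin n → ℤ) → E n := fun m => WithLp.toLp 2 fun i => (m i : ℝ)
  set W : (Fin n → ℤ) → ℝ≥0∞ := fun m => wMeasure w (cube (c m) 2) ^ (1 / p - 1 / q)
  have hW : ∀ m, W m ≠ ∞ := fun m =>
    ENNReal.rpow_ne_top_of_nonneg (by linarith [h.exponent_neg])
      (h.isWeight.wMeasure_cube_lt_top (c m) (by norm_num)).ne
  set K : ℝ≥0∞ := (∑ m ∈ F, W m ^ p) ^ (1 / p)
  have hK : K ≠ ∞ := by
    refine ENNReal.rpow_ne_top_of_nonneg (by positivity) (ENNReal.sum_ne_top.mpr fun m _ => ?_)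
    exact ENNReal.rpow_ne_top_of_nonneg hp.le (hW m)
  -- The summand `1` makes the constant nonzero, for the case of infinite norm.
  refine ⟨K + 1, ENNReal.add_ne_top.mpr ⟨hK, ENNReal.one_ne_top⟩, fun ρ hρ hsupp => ?_⟩
  rcases eq_or_ne (eLpNorm ρ (ENNReal.ofReal q) (wMeasure w)) ∞ with htop | htop
  · rw [htop, ENNReal.mul_top (by simp)]; exact le_top
  set g : (Fin n → ℤ) → E n → ℂ := fun m x => bump 1 m x • ρ x with hg
  have hgm : ∀ m, AEStronglyMeasurable (g m) volume := fun m =>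
    (continuous_bump zero_le_one m).aestronglyMeasurable.smul hρ
  have hgle : ∀ m, eLpNorm (g m) (ENNReal.ofReal q) (wMeasure w) ≤
      eLpNorm ρ (ENNReal.ofReal q) (wMeasure w) := fun m => by
    refine eLpNorm_mono fun x => ?_
    rw [hg, norm_smul, Real.norm_of_nonneg (bump_nonneg _ _ _)]
    exact mul_le_of_le_one_left (norm_nonneg _) (bump_le_one _ _ _)
  have hgi : ∀ m, LocallyIntegrable (g m) volume := fun m =>
    h.locallyIntegrable (hgm m) ((hgle m).trans_lt htop.lt_top)
  have hsum : ρ = ∑ m ∈ F, g m := by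
    ext x
    rw [Finset.sum_apply]
    simp only [hg]
    rw [← Finset.sum_smul]
    by_cases hx : ρ x = 0
    · rw [hx, smul_zero]
    · have hxR := mem_closedBall_zero_iff.mp (hsupp hx)
      have h1 : ∀ m ∉ F, bump 1 m x = 0 := by
        intro m hm
        by_contra hne
        refine hm (Fintype.mem_piFinset.mpr fun i => Finset.mem_Icc.mpr ?_)
        have h2 := abs_lt.mp (abs_lt_of_bump_ne_zero hne i)
        have h3 := abs_le.mp ((abs_apply_le_norm x i).trans hxR)
        have h4 := Int.le_ceil R
        constructor
        · have : ((-b : ℤ) : ℝ) ≤ m i := by rw [hb]; push_cast; linarith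
          exact_mod_cast this
        · have : (m i : ℝ) ≤ (b : ℤ) := by rw [hb]; push_cast; linarith
          exact_mod_cast this
      rw [(hasSum_sum_of_ne_finset_zero h1).unique (hasSum_bump 1 x), one_smul]
  have hone : ∀ m, finNorm w p q s (ofFun (g m)) ≤
      eLpNorm ρ (ENNReal.ofReal q) (wMeasure w) * W m := by
    intro m
    refine (h.finNorm_ofFun_le s (hgm m) (x := c m) (t := 2) (by norm_num) le_rfl ?_
      (fun h2 => by norm_num at h2)).trans (mul_le_mul_left (hgle m) _)
    intro x hx i
    have h1 : bump 1 m x ≠ 0 := fun h0 => hx (by simp only [hg, h0, zero_smul])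
    have h2 := abs_lt_of_bump_ne_zero h1 i
    simp only [c]
    rw [one_mul] at h2
    linarith
  have hp' : finNorm w p q s (ofFun ρ) ^ p ≤
      (K * eLpNorm ρ (ENNReal.ofReal q) (wMeasure w)) ^ p := by
    calc finNorm w p q s (ofFun ρ) ^ p = finNorm w p q s (∑ m ∈ F, ofFun (g m)) ^ p := by
          conv_lhs => rw [hsum]
          rw [ofFun_sum F fun m _ => hgi m]
      _ ≤ ∑ m ∈ F, finNorm w p q s (ofFun (g m)) ^ p := h.finNorm_sum_rpow s F _
      _ ≤ ∑ m ∈ F, (W m ^ p) * eLpNorm ρ (ENNReal.ofReal q) (wMeasure w) ^ p := by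
          refine Finset.sum_le_sum fun m _ => ?_
          rw [← ENNReal.mul_rpow_of_nonneg _ _ hp.le, mul_comm]
          exact ENNReal.rpow_le_rpow (hone m) hp.le
      _ = _ := by
          rw [← Finset.sum_mul, ENNReal.mul_rpow_of_nonneg _ _ hp.le, ← ENNReal.rpow_mul,
            one_div_mul_cancel hp.ne', ENNReal.rpow_one]
  refine ((ENNReal.rpow_le_rpow_iff hp).mp hp').trans (mul_le_mul_left le_self_add _)

/-- Countable subadditivity. Cut the series after a finite set of terms: the remainder tends to zero
in `L^q_w` by dominated convergence and stays supported in `S`, so its atomic quasi-norm tends to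
zero whatever the constant attached to `S`. -/
lemma Admissible.finNorm_rpow_le_tsum (h : Admissible w p q) {S : Set (E n)}
    (hS : BoundedOn w p q s S) {ι : Type*} [Countable ι] {g : ι → E n → ℂ} {G : E n → ℂ}
    (hg : ∀ i, Continuous (g i)) (hG : Continuous G) (hgS : ∀ i, Function.support (g i) ⊆ S)
    (hGS : Function.support G ⊆ S) (hsum : ∀ x, HasSum (fun i => g i x) (G x))
    {M : E n → ℝ≥0∞} (hM : ∫⁻ x, M x ^ q ∂(wMeasure w) ≠ ∞)
    (hb : ∀ x, ∑' i, ‖g i x‖ₑ ≤ M x) :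
    finNorm w p q s (ofFun G) ^ p ≤ ∑' i, finNorm w p q s (ofFun (g i)) ^ p := by
  have hp := h.p_pos
  have hq := h.q_pos
  obtain ⟨K, hK, hKS⟩ := hS
  set ρ : Finset ι → E n → ℂ := fun F => G - ∑ i ∈ F, g i with hρ
  have hsc : ∀ F : Finset ι, Continuous (∑ i ∈ F, g i) := fun F => by
    have : (∑ i ∈ F, g i) = fun x => ∑ i ∈ F, g i x := by ext x; simp
    rw [this]
    exact continuous_finsetSum _ fun i _ => hg i
  have hρc : ∀ F, Continuous (ρ F) := fun F => hG.sub (hsc F)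
  have hρS : ∀ F, Function.support (ρ F) ⊆ S := by
    intro F x hx
    by_contra hcon
    have h0 : ∀ i, g i x = 0 := fun i => by
      by_contra hne; exact hcon (hgS i hne)
    have h1 : G x = 0 := by
      by_contra hne; exact hcon (hGS hne)
    exact hx (by simp [hρ, h0, h1])
  have hρ0 : ∀ x, Filter.Tendsto (fun F => ρ F x) Filter.atTop (nhds 0) := by
    intro x
    have := (tendsto_const_nhds (x := G x)).sub (hsum x)
    rw [sub_self] at this
    refine this.congr fun F => ?_
    simp [hρ]
  have hρM : ∀ F x, ‖ρ F x‖ₑ ≤ 2 * M x := by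
    intro F x
    have h1 : ‖G x‖ₑ ≤ M x := by
      rw [← (hsum x).tsum_eq]
      exact enorm_tsum_le_tsum_enorm.trans (hb x)
    have h2 : ‖∑ i ∈ F, g i x‖ₑ ≤ M x :=
      (enorm_sum_le _ _).trans ((ENNReal.sum_le_tsum F).trans (hb x))
    calc ‖ρ F x‖ₑ = ‖G x - ∑ i ∈ F, g i x‖ₑ := by simp [hρ]
      _ ≤ ‖G x‖ₑ + ‖∑ i ∈ F, g i x‖ₑ := enorm_sub_le
      _ ≤ M x + M x := add_le_add h1 h2
      _ = 2 * M x := by ring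
  have hgint : Filter.Tendsto (fun F => ∫⁻ x, ‖ρ F x‖ₑ ^ q ∂(wMeasure w)) Filter.atTop
      (nhds 0) := by
    have h1 := tendsto_lintegral_filter_of_dominated_convergence (μ := wMeasure w)
      (l := (Filter.atTop : Filter (Finset ι))) (F := fun F x => ‖ρ F x‖ₑ ^ q) (f := fun _ => 0)
      (fun x => (2 : ℝ≥0∞) ^ q * M x ^ q)
      (Filter.Eventually.of_forall fun F => (hρc F).measurable.enorm.pow_const q)
      (Filter.Eventually.of_forall fun F => Filter.Eventually.of_forall fun x => by
        rw [← ENNReal.mul_rpow_of_nonneg _ _ hq.le]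
        exact ENNReal.rpow_le_rpow (hρM F x) hq.le)
      (by
        rw [lintegral_const_mul' _ _ (ENNReal.rpow_ne_top_of_nonneg hq.le (by norm_num))]
        exact ENNReal.mul_ne_top (ENNReal.rpow_ne_top_of_nonneg hq.le (by norm_num)) hM)
      (Filter.Eventually.of_forall fun x => by
        have h2 := (hρ0 x).enorm.ennrpow_const q
        rwa [enorm_zero, ENNReal.zero_rpow_of_pos hq] at h2)
    simpa using h1
  have hterm : Filter.Tendsto (fun F => ∑' i, finNorm w p q s (ofFun (g i)) ^ p +
      (K * eLpNorm (ρ F) (ENNReal.ofReal q) (wMeasure w)) ^ p) Filter.atTop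
      (nhds (∑' i, finNorm w p q s (ofFun (g i)) ^ p)) := by
    have h1 : Filter.Tendsto (fun F => eLpNorm (ρ F) (ENNReal.ofReal q) (wMeasure w))
        Filter.atTop (nhds 0) := by
      have h2 := hgint.ennrpow_const (1 / q)
      rw [ENNReal.zero_rpow_of_pos (by positivity)] at h2
      refine h2.congr fun F => ?_
      rw [← h.eLpNorm_rpow, ← ENNReal.rpow_mul, mul_one_div_cancel hq.ne', ENNReal.rpow_one]
    have h3 := (ENNReal.Tendsto.const_mul h1 (Or.inr hK)).ennrpow_const p
    rw [mul_zero, ENNReal.zero_rpow_of_pos hp] at h3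
    have h4 := (tendsto_const_nhds (x := ∑' i, finNorm w p q s (ofFun (g i)) ^ p)).add h3
    rwa [add_zero] at h4
  refine ge_of_tendsto hterm (Filter.Eventually.of_forall fun F => ?_)
  have hdec : ofFun G = ∑ i ∈ F, ofFun (g i) + ofFun (ρ F) := by
    rw [← ofFun_sum F fun i _ => (hg i).locallyIntegrable,
      ← ofFun_add (hsc F).locallyIntegrable (hρc F).locallyIntegrable]
    congr 1
    simp [hρ]
  rw [hdec]
  refine (h.finNorm_add_rpow s _ _).trans (add_le_add ?_ ?_)
  · exact (h.finNorm_sum_rpow s F _).trans (ENNReal.sum_le_tsum F)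
  · exact ENNReal.rpow_le_rpow (hKS _ (hρc F).aestronglyMeasurable (hρS F)) hp.le

lemma Calibration.two_mul_dim_le (h : Calibration s N φ A η J₀ C) : 2 * (n : ℝ) ≤ A := by
  have h1 := h.mul_eta
  have h2 := h.eta_le
  have h3 := h.eta_pos
  by_contra hcon
  nlinarith [not_le.mp hcon]

/-- The part of `mean₂ φ f J₀` near a lattice point. -/
def coarsePart (φ : E n → ℝ) (J₀ : ℕ) (f : E n → ℂ) (m : Fin n → ℤ) (x : E n) : ℂ :=
  bump (1 * (1 / 2) ^ J₀)⁻¹ m x • mean₂ φ f J₀ x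


lemma mem_whitney_of_bump_ne_zero {l : ℕ} {m : Fin n → ℤ} {x : E n}
    (hx : bump (1 * (1 / 2) ^ l)⁻¹ m x ≠ 0) : x ∈ whitney 1 (l, m) := by
  intro k
  have ht := half_pow_pos l
  have h1 := abs_lt_of_bump_ne_zero hx k
  simp only [one_mul] at h1 ⊢
  have h2 : x k - (1 / 2) ^ l * m k = (1 / 2) ^ l * (((1 / 2) ^ l)⁻¹ * x k - m k) := by
    field_simp
  rw [h2, abs_mul, abs_of_pos ht]
  nlinarith

lemma Calibration.hasSum_coarsePart (f : E n → ℂ) (x : E n) :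
    HasSum (fun m => coarsePart φ J₀ f m x) (mean₂ φ f J₀ x) := by
  have := (hasSum_bump (1 * (1 / 2) ^ J₀)⁻¹ x).smul_const (mean₂ φ f J₀ x)
  rwa [one_smul] at this

lemma Calibration.tsum_enorm_coarsePart_le (h : Calibration s N φ A η J₀ C) {f : E n → ℂ}
    (hf : LocallyIntegrable f volume) (x : E n) :
    ∑' m, ‖coarsePart φ J₀ f m x‖ₑ ≤ C * grandMax N (ofFun f) x := by
  have h1 := (hasSum_bump (1 * (1 / 2) ^ J₀)⁻¹ x).mul_right ‖mean₂ φ f J₀ x‖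
  rw [one_mul ‖mean₂ φ f J₀ x‖] at h1
  have h2 : ∀ m, ‖coarsePart φ J₀ f m x‖ₑ =
      ENNReal.ofReal (bump (1 * (1 / 2) ^ J₀)⁻¹ m x * ‖mean₂ φ f J₀ x‖) := fun m => by
    rw [← ofReal_norm, coarsePart, norm_smul, Real.norm_of_nonneg (bump_nonneg _ _ _)]
  simp_rw [h2]
  rw [← ENNReal.ofReal_tsum_of_nonneg
    (fun m => mul_nonneg (bump_nonneg _ _ _) (norm_nonneg _)) h1.summable, h1.tsum_eq, ofReal_norm]
  refine h.mean₂_le f hf J₀ le_rfl x x ?_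
  have := h.three_le
  have := half_pow_pos J₀
  rw [sub_self, norm_zero]; positivity

/-- Each part lives on a cube of side `4 · 2^(-J₀) ≤ 1`; regarded on the concentric unit cube it
needs no moments. Doubling with a factor fixed by `J₀` returns to the small cube. -/
lemma Calibration.finNorm_coarsePart_le (h : Calibration s N φ A η J₀ C) (hw : Admissible w p q) :
    ∃ K : ℝ≥0, ∀ f : E n → ℂ, LocallyIntegrable f volume →
      ∑' m, finNorm w p q s (ofFun (coarsePart φ J₀ f m)) ^ p ≤
        K * ∫⁻ x, grandMax N (ofFun f) x ^ p ∂(wMeasure w) := by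
  classical
  have hp := hw.p_pos
  have hA := h.three_le
  have ht := half_pow_pos J₀
  have ht1 : 4 * (1 / 2 : ℝ) ^ J₀ ≤ 1 := by nlinarith [h.scale]
  set t : ℝ := (1 / 2) ^ J₀ with htdef
  obtain ⟨D, hD⟩ := hw.weight.exists_doubling (1 / (4 * t)) (by
    rw [le_div_iff₀ (by positivity)]; linarith) 1
  refine ⟨D * C ^ p * 5 ^ n, fun f hf => ?_⟩
  set M := grandMax N (ofFun f)
  have hMm : Measurable M := measurable_grandMax hf N
  have hone : ∀ m, finNorm w p q s (ofFun (coarsePart φ J₀ f m)) ^ p ≤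
      ∫⁻ x, D * C ^ p * ((if x ∈ whitney 1 (J₀, m) then (1 : ℝ≥0∞) else 0) * M x ^ p)
        ∂(wMeasure w) := by
    intro m
    set c : E n := WithLp.toLp 2 fun k => 1 * (1 / 2) ^ J₀ * m k with hc
    have hQ : whitney 1 (J₀, m) = cube c (4 * t) := by rw [whitney, one_mul]
    have hQ1 : cube c (4 * t) ⊆ cube c 1 := fun y hy k => (hy k).trans (by linarith)
    -- Any two points of the small cube are within `4 n t ≤ 2 A t`, so the part is bounded by `C M
    -- f` at every point of the cube. With the infimum as height, `L^p w(Q)` is at most the integral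
    -- of `(C M f)^p` over `Q`.
    set L : ℝ≥0∞ := ⨅ z ∈ cube c (4 * t), (C : ℝ≥0∞) * M z with hL
    have hsupp : Function.support (coarsePart φ J₀ f m) ⊆ cube c (4 * t) := by
      intro x hx
      rw [← hQ]
      refine mem_whitney_of_bump_ne_zero fun h0 => hx ?_
      rw [coarsePart, h0, zero_smul]
    have hbound : ∀ x, ‖coarsePart φ J₀ f m x‖ₑ ≤ L := by
      intro x
      by_cases hx : coarsePart φ J₀ f m x = 0
      · rw [hx, enorm_zero]; exact zero_le
      refine le_iInf₂ fun z hz => ?_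
      have h1 : ‖coarsePart φ J₀ f m x‖ₑ ≤ ‖mean₂ φ f J₀ x‖ₑ := by
        rw [enorm_le_iff_norm_le, coarsePart, norm_smul, Real.norm_of_nonneg (bump_nonneg _ _ _)]
        exact mul_le_of_le_one_left (norm_nonneg _) (bump_le_one _ _ _)
      refine h1.trans (h.mean₂_le f hf J₀ le_rfl x z ?_)
      have h2 : ‖x - z‖ ≤ n * (4 * t) := by
        refine norm_le_of_abs_le _ (by positivity) fun k => ?_
        have h3 := abs_le.mp (hsupp hx k)
        have h4 := abs_le.mp (hz k)
        rw [PiLp.sub_apply, abs_le]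
        constructor <;> linarith
      refine h2.trans ?_
      nlinarith [h.two_mul_dim_le]
    have hcont : Continuous (coarsePart φ J₀ f m) :=
      (continuous_bump (by positivity) m).smul (h.moll.continuous_mean₂ hf J₀)
    have h5 := hw.finNorm_rpow_le_of_bounded s hcont.aestronglyMeasurable (x := c) (t := 1)
      one_pos (by norm_num) (hsupp.trans hQ1) (fun h6 => absurd h6 (lt_irrefl _)) hbound
    have h7 : wMeasure w (cube c 1) ≤ D * wMeasure w (cube c (4 * t)) := by
      have := hD c (4 * t) (by positivity) ht1
      rwa [one_div, inv_mul_cancel₀ (by positivity)] at this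
    have hQm : MeasurableSet (cube c (4 * t)) := measurableSet_cube _ _
    calc finNorm w p q s (ofFun (coarsePart φ J₀ f m)) ^ p
        ≤ L ^ p * (D * wMeasure w (cube c (4 * t))) := h5.trans (mul_le_mul_right h7 _)
      _ = D * ∫⁻ _ in cube c (4 * t), L ^ p ∂(wMeasure w) := by
          rw [setLIntegral_const]; ring
      _ ≤ D * ∫⁻ x in cube c (4 * t), (C : ℝ≥0∞) ^ p * M x ^ p ∂(wMeasure w) := by
          refine mul_le_mul_right (setLIntegral_mono' hQm fun x hx => ?_) _
          rw [← ENNReal.mul_rpow_of_nonneg _ _ hp.le]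
          exact ENNReal.rpow_le_rpow (iInf₂_le x hx) hp.le
      _ = ∫⁻ x, D * C ^ p * ((if x ∈ whitney 1 (J₀, m) then (1 : ℝ≥0∞) else 0) * M x ^ p)
            ∂(wMeasure w) := by
          rw [← lintegral_indicator hQm, ← lintegral_const_mul' _ _ ENNReal.coe_ne_top]
          refine lintegral_congr fun x => ?_
          rw [hQ, Set.indicator_apply]
          split_ifs <;> ring
  calc ∑' m, finNorm w p q s (ofFun (coarsePart φ J₀ f m)) ^ p
      ≤ ∑' m, ∫⁻ x, D * C ^ p * ((if x ∈ whitney 1 (J₀, m) then (1 : ℝ≥0∞) else 0) * M x ^ p)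
        ∂(wMeasure w) := ENNReal.tsum_le_tsum hone
    _ = ∫⁻ x, ∑' m, D * C ^ p * ((if x ∈ whitney 1 (J₀, m) then (1 : ℝ≥0∞) else 0) * M x ^ p)
        ∂(wMeasure w) := by
        rw [lintegral_tsum]
        intro m
        refine (Measurable.const_mul (Measurable.mul (Measurable.ite ?_ measurable_const
          measurable_const) (hMm.pow_const p)) _).aemeasurable
        exact measurableSet_cube _ _
    _ ≤ ∫⁻ x, ((D * C ^ p * 5 ^ n : ℝ≥0) : ℝ≥0∞) * M x ^ p ∂(wMeasure w) := by
        refine lintegral_mono fun x => ?_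
        rw [ENNReal.tsum_mul_left, ENNReal.tsum_mul_right, ENNReal.coe_mul, ENNReal.coe_mul,
          ← ENNReal.coe_rpow_of_nonneg _ hp.le, mul_assoc (_ * _)]
        refine mul_le_mul_right (mul_le_mul_left ?_ _) _
        refine (tsum_whitney_lattice_le one_pos J₀ x).trans (le_of_eq ?_)
        norm_num
    _ = _ := lintegral_const_mul _ (hMm.pow_const p)

/-- The lower bound for functions in `L^q_w`. -/
lemma Admissible.exists_finNorm_le (hw : Admissible w p q) (s N : ℕ) :
    ∃ K : ℝ≥0, ∀ (f : E n → ℂ) (S : Set (E n)), AEStronglyMeasurable f volume →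
      eLpNorm f (ENNReal.ofReal q) (wMeasure w) ≠ ∞ → BoundedOn w p q s S →
      Function.support f ⊆ S → Function.support (grandMax N (ofFun f)) ⊆ S →
      finNorm w p q s (ofFun f) ≤ K * hardyNorm w p N (ofFun f) := by
  have hp := hw.p_pos
  have hq := hw.q_pos
  obtain ⟨φ, A, η, J₀, C, h⟩ := exists_calibration n s N
  obtain ⟨K₁, hK₁⟩ := h.finNorm_localSum_le hw
  obtain ⟨K₂, hK₂⟩ := h.finNorm_coarsePart_le hw
  obtain ⟨K₃, hK₃⟩ := h.enorm_localSum_le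
  obtain ⟨K₄, hK₄⟩ := hw.lintegral_grandMax_le N
  refine ⟨(K₂ + K₁) ^ (1 / p), fun f S hfm hfq hS hfS hMS => ?_⟩
  have hf := hw.locallyIntegrable hfm hfq.lt_top
  set M := grandMax N (ofFun f) with hMdef
  have hMm : Measurable M := measurable_grandMax hf N
  have hMq : ∫⁻ x, M x ^ q ∂(wMeasure w) ≠ ∞ := by
    refine ne_top_of_le_ne_top ?_ (hK₄ f hf)
    refine ENNReal.mul_ne_top ENNReal.coe_ne_top ?_
    rw [← hw.eLpNorm_rpow]
    exact ENNReal.rpow_ne_top_of_nonneg hq.le hfq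
  have hKMq : ∀ K : ℝ≥0, ∫⁻ x, (K * M x) ^ q ∂(wMeasure w) ≠ ∞ := by
    intro K
    simp_rw [ENNReal.mul_rpow_of_nonneg _ _ hq.le]
    have : (K : ℝ≥0∞) ^ q ≠ ∞ := ENNReal.rpow_ne_top_of_nonneg hq.le ENNReal.coe_ne_top
    rw [lintegral_const_mul' _ _ this]
    exact ENNReal.mul_ne_top this hMq
  have hMfin : ∀ᵐ x, M x ≠ ∞ := by
    refine hw.isWeight.volume_absolutelyContinuous.ae_le ?_
    filter_upwards [ae_lt_top (hMm.pow_const q) hMq] with x hx htop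
    rw [htop, ENNReal.top_rpow_of_pos hq] at hx
    exact lt_irrefl _ hx
  have hcS : ∀ {v : E n → ℂ} {K : ℝ≥0}, (∀ x, ‖v x‖ₑ ≤ K * M x) → Function.support v ⊆ S := by
    intro v K hv x hx
    refine hMS fun h0 => hx ?_
    have := hv x
    rw [h0, mul_zero, nonpos_iff_eq_zero, enorm_eq_zero] at this
    exact this
  have hm₂ : ∀ j, J₀ ≤ j → ∀ x, ‖mean₂ φ f j x‖ₑ ≤ C * M x := fun j hj x =>
    h.mean₂_le f hf j hj x x (by
      have := h.three_le
      have := half_pow_pos j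
      rw [sub_self, norm_zero]; positivity)
  have hcoarse : finNorm w p q s (ofFun (mean₂ φ f J₀)) ^ p ≤
      K₂ * ∫⁻ x, M x ^ p ∂(wMeasure w) := by
    refine (hw.finNorm_rpow_le_tsum hS (g := coarsePart φ J₀ f) (M := fun x => C * M x)
      (fun m => (continuous_bump (by positivity) m).smul (h.moll.continuous_mean₂ hf J₀))
      (h.moll.continuous_mean₂ hf J₀)
      (fun m => hcS fun x => (ENNReal.le_tsum m).trans (h.tsum_enorm_coarsePart_le hf x))
      (hcS (hm₂ J₀ le_rfl)) (Calibration.hasSum_coarsePart f) (hKMq C)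
      (h.tsum_enorm_coarsePart_le hf)).trans (hK₂ f hf)
  -- The bound does not depend on `J`, since the pieces are bounded uniformly in the number of
  -- layers.
  have hfine : ∀ J, J₀ ≤ J → finNorm w p q s (ofFun (mean₂ φ f J - mean₂ φ f J₀)) ^ p ≤
      K₁ * ∫⁻ x, M x ^ p ∂(wMeasure w) := by
    intro J hJ
    refine (hw.finNorm_rpow_le_tsum hS (g := localSum φ A η N J₀ J f) (M := fun x => K₃ * M x)
      (h.continuous_localSum hf J)
      ((h.moll.continuous_mean₂ hf J).sub (h.moll.continuous_mean₂ hf J₀))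
      (fun i => hcS fun x => (ENNReal.le_tsum i).trans (hK₃ f hf J x))
      (hcS (K := C + C) fun x => ?_) (h.hasSum_localSum hf hMfin hJ) (hKMq K₃)
      (hK₃ f hf J)).trans (hK₁ f hf J)
    calc ‖(mean₂ φ f J - mean₂ φ f J₀) x‖ₑ ≤ ‖mean₂ φ f J x‖ₑ + ‖mean₂ φ f J₀ x‖ₑ := enorm_sub_le
      _ ≤ C * M x + C * M x := add_le_add (hm₂ J hJ x) (hm₂ J₀ le_rfl x)
      _ = _ := by push_cast; ring
  obtain ⟨K, hK, hKS⟩ := hS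
  set ρ : ℕ → E n → ℂ := fun J => f - mean₂ φ f J with hρ
  have hρm : ∀ J, AEStronglyMeasurable (ρ J) volume := fun J =>
    hfm.sub (h.moll.continuous_mean₂ hf J).aestronglyMeasurable
  have hρw : ∀ J, AEStronglyMeasurable (ρ J) (wMeasure w) := fun J =>
    (hρm J).mono_ac wMeasure_absolutelyContinuous
  have hρS : ∀ J, J₀ ≤ J → Function.support (ρ J) ⊆ S := by
    intro J hJ x hx
    by_contra hcon
    have h1 : f x = 0 := by by_contra hne; exact hcon (hfS hne)
    have h2 : mean₂ φ f J x = 0 := by by_contra hne; exact hcon (hcS (hm₂ J hJ) hne)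
    exact hx (by simp [hρ, h1, h2])
  -- The remainder `f - mean₂ φ f J` tends to zero almost everywhere and is dominated by `2 C M f`,
  -- which lies in `L^q_w`.
  have hgint : Filter.Tendsto (fun J => ∫⁻ x, ‖ρ J x‖ₑ ^ q ∂(wMeasure w)) Filter.atTop
      (nhds 0) := by
    have h1 := tendsto_lintegral_filter_of_dominated_convergence' (μ := wMeasure w)
      (l := (Filter.atTop : Filter ℕ)) (F := fun J x => ‖ρ J x‖ₑ ^ q) (f := fun _ => 0)
      (fun x => (((C + C : ℝ≥0) : ℝ≥0∞) * M x) ^ q)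
      (Filter.Eventually.of_forall fun J => (hρw J).enorm.pow_const q)
      (by
        filter_upwards [Filter.eventually_ge_atTop J₀] with J hJ
        filter_upwards [wMeasure_absolutelyContinuous.ae_le (h.ae_enorm_le hf)] with x hx
        refine ENNReal.rpow_le_rpow ?_ hq.le
        calc ‖ρ J x‖ₑ ≤ ‖f x‖ₑ + ‖mean₂ φ f J x‖ₑ := enorm_sub_le
          _ ≤ C * M x + C * M x := add_le_add hx (hm₂ J hJ x)
          _ = _ := by push_cast; ring)
      (hKMq (C + C))
      (by
        filter_upwards [wMeasure_absolutelyContinuous.ae_le (h.moll.tendsto_mean₂ hf)] with x hx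
        have h2 := ((tendsto_const_nhds (x := f x)).sub hx).enorm.ennrpow_const q
        rwa [sub_self, enorm_zero, ENNReal.zero_rpow_of_pos hq] at h2)
    simpa using h1
  -- The constant `K` depends on `S`, hence on `f`, but it disappears in the limit.
  have hterm : Filter.Tendsto (fun J => K₂ * ∫⁻ x, M x ^ p ∂(wMeasure w) +
      K₁ * ∫⁻ x, M x ^ p ∂(wMeasure w) +
      (K * eLpNorm (ρ J) (ENNReal.ofReal q) (wMeasure w)) ^ p) Filter.atTop
      (nhds (K₂ * ∫⁻ x, M x ^ p ∂(wMeasure w) + K₁ * ∫⁻ x, M x ^ p ∂(wMeasure w))) := by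
    have h1 : Filter.Tendsto (fun J => eLpNorm (ρ J) (ENNReal.ofReal q) (wMeasure w))
        Filter.atTop (nhds 0) := by
      have h2 := hgint.ennrpow_const (1 / q)
      rw [ENNReal.zero_rpow_of_pos (by positivity)] at h2
      refine h2.congr fun F => ?_
      rw [← hw.eLpNorm_rpow, ← ENNReal.rpow_mul, mul_one_div_cancel hq.ne', ENNReal.rpow_one]
    have h3 := (ENNReal.Tendsto.const_mul h1 (Or.inr hK)).ennrpow_const p
    rw [mul_zero, ENNReal.zero_rpow_of_pos hp] at h3
    have h4 := (tendsto_const_nhds (x := K₂ * ∫⁻ x, M x ^ p ∂(wMeasure w) +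
      K₁ * ∫⁻ x, M x ^ p ∂(wMeasure w))).add h3
    rwa [add_zero] at h4
  have hfinal : finNorm w p q s (ofFun f) ^ p ≤
      K₂ * ∫⁻ x, M x ^ p ∂(wMeasure w) + K₁ * ∫⁻ x, M x ^ p ∂(wMeasure w) := by
    refine ge_of_tendsto hterm ?_
    filter_upwards [Filter.eventually_ge_atTop J₀] with J hJ
    have hi₀ := (h.moll.continuous_mean₂ hf J₀).locallyIntegrable (μ := volume)
    have hi := (h.moll.continuous_mean₂ hf J).locallyIntegrable (μ := volume)
    have hdec : ofFun f = ofFun (mean₂ φ f J₀) + ofFun (mean₂ φ f J - mean₂ φ f J₀) +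
        ofFun (ρ J) := by
      rw [← ofFun_add hi₀ (hi.sub hi₀), ← ofFun_add (hi₀.add (hi.sub hi₀)) (hf.sub hi)]
      congr 1
      simp
    rw [hdec]
    refine (hw.finNorm_add_rpow s _ _).trans (add_le_add ?_ ?_)
    · exact (hw.finNorm_add_rpow s _ _).trans (add_le_add hcoarse (hfine J hJ))
    · exact ENNReal.rpow_le_rpow (hKS _ (hρm J) (hρS J hJ)) hp.le
  rw [← ENNReal.rpow_le_rpow_iff hp, ENNReal.mul_rpow_of_nonneg _ _ hp.le, hardyNorm_rpow hp,
    ENNReal.coe_rpow_of_nonneg _ (by positivity), ← ENNReal.rpow_mul, one_div_mul_cancel hp.ne',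
    ENNReal.rpow_one, ENNReal.coe_add, add_mul]
  exact hfinal

end Lower

/-! ### The finite atomic space -/

section FinSpace
variable {n : ℕ} {w : E n → ℝ} {p q : ℝ} {s N : ℕ}

/-- The functions in `L^q_w` on which the two quasi-norms are compared. -/
structure IsTame (w : E n → ℝ) (q : ℝ) (g : E n → ℂ) : Prop where
  aestronglyMeasurable : AEStronglyMeasurable g volume
  lt_top : eLpNorm g (ENNReal.ofReal q) (wMeasure w) < ∞
  bounded : wMeasure w Set.univ ≠ ∞ ∨ ∃ R, Function.support g ⊆ Metric.closedBall 0 R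

lemma IsTame.zero : IsTame w q (0 : E n → ℂ) :=
  ⟨aestronglyMeasurable_zero, by simp, Or.inr ⟨0, by simp⟩⟩

lemma IsTame.add (h : Admissible w p q) {f g : E n → ℂ} (hf : IsTame w q f) (hg : IsTame w q g) :
    IsTame w q (f + g) := by
  refine ⟨hf.1.add hg.1, ?_, ?_⟩
  · refine (eLpNorm_add_le (hf.1.mono_ac wMeasure_absolutelyContinuous)
      (hg.1.mono_ac wMeasure_absolutelyContinuous) h.one_le_ofReal).trans_lt ?_
    exact ENNReal.add_lt_top.mpr ⟨hf.2, hg.2⟩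
  · rcases hf.3 with h1 | ⟨R, hR⟩
    · exact Or.inl h1
    rcases hg.3 with h1 | ⟨R', hR'⟩
    · exact Or.inl h1
    refine Or.inr ⟨max R R', (Function.support_add f g).trans (Set.union_subset ?_ ?_)⟩
    · exact hR.trans (Metric.closedBall_subset_closedBall (le_max_left _ _))
    · exact hR'.trans (Metric.closedBall_subset_closedBall (le_max_right _ _))

lemma IsTame.smul {f : E n → ℂ} (hf : IsTame w q f) (c : ℂ) : IsTame w q (c • f) := by
  refine ⟨hf.1.const_smul c, ?_, ?_⟩
  · rw [eLpNorm_const_smul]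
    exact ENNReal.mul_lt_top enorm_lt_top hf.2
  · rcases hf.3 with h1 | ⟨R, hR⟩
    · exact Or.inl h1
    · exact Or.inr ⟨R, (Function.support_const_smul_subset c f).trans hR⟩

/-- Atoms have bounded support, and single atoms matter only when `w(ℝⁿ)` is finite, since otherwise
they represent the zero distribution. -/
lemma Admissible.exists_isTame (h : Admissible w p q) {T : Distr n}
    (hT : T ∈ finSpace w p q s) : ∃ g, IsTame w q g ∧ T = ofFun g := by
  refine Submodule.span_induction (p := fun T _ => ∃ g, IsTame w q g ∧ T = ofFun g)
    ?_ ?_ ?_ ?_ hT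
  · rintro _ ⟨a, ha | ha, rfl⟩
    · obtain ⟨x, t, ht, ha⟩ := ha
      refine ⟨a, ⟨ha.1, ha.eLpNorm_lt_top h ht, Or.inr ?_⟩, rfl⟩
      obtain ⟨R, hR⟩ := (isCompact_cube x ht.le).isBounded.subset_closedBall 0
      exact ⟨R, ha.support_subset.trans hR⟩
    · have hfin : eLpNorm a (ENNReal.ofReal q) (wMeasure w) < ∞ :=
        ha.2.trans_lt (rpow_ne_top_of_ne_zero h.univ_ne_zero h.exponent_neg.le).lt_top
      by_cases hw : wMeasure w Set.univ = ∞
      · have h0 : eLpNorm a (ENNReal.ofReal q) (wMeasure w) = 0 := by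
          have := ha.2
          rwa [hw, ENNReal.top_rpow_of_neg h.exponent_neg, nonpos_iff_eq_zero] at this
        exact ⟨0, IsTame.zero, ofFun_congr (ha.locallyIntegrable h) (h.eq_zero_of_eLpNorm ha.1 h0)⟩
      · exact ⟨a, ⟨ha.1, hfin, Or.inl hw⟩, rfl⟩
  · exact ⟨0, IsTame.zero, ofFun_zero.symm⟩
  · rintro _ _ _ _ ⟨f, hf, rfl⟩ ⟨g, hg, rfl⟩
    exact ⟨f + g, hf.add h hg,
      (ofFun_add (h.locallyIntegrable hf.1 hf.2) (h.locallyIntegrable hg.1 hg.2)).symm⟩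
  · rintro c _ _ ⟨f, hf, rfl⟩
    exact ⟨c • f, hf.smul c, (ofFun_smul (h.locallyIntegrable hf.1 hf.2) c).symm⟩

/-- By locality, the maximal function of a function supported in a ball of radius `R` lives in the
ball of radius `R + 1`. -/
lemma IsTame.exists_boundedOn (h : Admissible w p q) (s N : ℕ) {f : E n → ℂ} (hf : IsTame w q f) :
    ∃ S, BoundedOn w p q s S ∧ Function.support f ⊆ S ∧
      Function.support (grandMax N (ofFun f)) ⊆ S := by
  rcases hf.3 with h1 | ⟨R, hR⟩
  · exact ⟨Set.univ, h.boundedOn_univ s h1, Set.subset_univ _, Set.subset_univ _⟩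
  · refine ⟨Metric.closedBall 0 (R + 1), h.boundedOn_closedBall s _,
      hR.trans (Metric.closedBall_subset_closedBall (by linarith)), fun x hx => ?_⟩
    by_contra hcon
    rw [mem_closedBall_zero_iff, not_le] at hcon
    refine hx (grandMax_eq_zero (h.locallyIntegrable hf.1 hf.2) N fun y hy => ?_)
    by_contra hne
    have h2 := mem_closedBall_zero_iff.mp (hR hne)
    have h3 : ‖x‖ ≤ ‖x - y‖ + ‖y‖ := by
      have := norm_add_le (x - y) y; rwa [sub_add_cancel] at this
    linarith

lemma IsTame.finNorm_lt_top (h : Admissible w p q) (s : ℕ) {f : E n → ℂ} (hf : IsTame w q f) :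
    finNorm w p q s (ofFun f) < ∞ := by
  obtain ⟨S, ⟨K, hK, hKS⟩, hS, -⟩ := hf.exists_boundedOn h s 0
  exact (hKS f hf.1 hS).trans_lt (ENNReal.mul_lt_top hK.lt_top hf.2)

/-- A vanishing Hardy quasi-norm makes `M f` vanish almost everywhere, and `M f` dominates `f` up to
a constant. -/
lemma IsTame.ofFun_eq_zero (h : Admissible w p q) {f : E n → ℂ} (hf : IsTame w q f)
    (h0 : hardyNorm w p N (ofFun f) = 0) : ofFun f = 0 := by
  have hp := h.p_pos
  have hli := h.locallyIntegrable hf.1 hf.2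
  obtain ⟨φ, A, η, J₀, C, hc⟩ := exists_calibration n 0 N
  have h1 : ∫⁻ x, grandMax N (ofFun f) x ^ p ∂(wMeasure w) = 0 := by
    rw [← hardyNorm_rpow hp, h0, ENNReal.zero_rpow_of_pos hp]
  rw [lintegral_eq_zero_iff ((measurable_grandMax hli N).pow_const p)] at h1
  have h2 : f =ᵐ[volume] 0 := by
    filter_upwards [h.isWeight.volume_absolutelyContinuous.ae_le h1, hc.ae_enorm_le hli]
      with x hx hfx
    have h3 : grandMax N (ofFun f) x = 0 := by
      by_contra hne
      exact hne ((ENNReal.rpow_eq_zero_iff_of_pos hp).mp hx)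
    rw [h3, mul_zero, nonpos_iff_eq_zero, enorm_eq_zero] at hfx
    exact hfx
  rw [ofFun_congr hli h2, ofFun_zero]

/-- A functional whose `p`-th power is subadditive satisfies a quasi-triangle inequality. -/
lemma le_mul_add_of_rpow_le {a b c : ℝ≥0∞} (hp : 0 < p) (h : a ^ p ≤ b ^ p + c ^ p) :
    a ≤ ((2 : ℝ≥0) ^ (1 / p) : ℝ≥0) * (b + c) := by
  rw [← ENNReal.rpow_le_rpow_iff hp, ENNReal.mul_rpow_of_nonneg _ _ hp.le,
    ENNReal.coe_rpow_of_nonneg _ (by positivity), ← ENNReal.rpow_mul, one_div_mul_cancel hp.ne',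
    ENNReal.rpow_one]
  calc a ^ p ≤ b ^ p + c ^ p := h
    _ ≤ (b + c) ^ p + (b + c) ^ p := add_le_add
        (ENNReal.rpow_le_rpow le_self_add hp.le) (ENNReal.rpow_le_rpow le_add_self hp.le)
    _ = _ := by rw [← two_mul]; rfl

lemma one_le_two_rpow (hp : 0 < p) : (1 : ℝ≥0) ≤ 2 ^ (1 / p) :=
  NNReal.one_le_rpow (by norm_num) (by positivity)

end FinSpace

end LocalHardy

end

/-! ### Equivalence of the quasi-norms -/

theorem theorem6p1 (n : ℕ) (hn : 1 ≤ n) (w : LocalHardy.E n → ℝ)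
    (hw : LocalHardy.IsAInftyLoc w) (p q : ℝ) (hp0 : 0 < p) (hp1 : p ≤ 1)
    (hq : LocalHardy.critIndex w < q) (s : ℕ)
    (hs : ⌊(n : ℝ) * (LocalHardy.critIndex w / p - 1)⌋ ≤ (s : ℤ))
    (N : ℕ) (hN : LocalHardy.critOrder w p ≤ N) :
    LocalHardy.IsQuasiNormOn (LocalHardy.finSpace w p q s) (LocalHardy.finNorm w p q s) ∧
    LocalHardy.IsQuasiNormOn (LocalHardy.finSpace w p q s) (LocalHardy.hardyNorm w p N) ∧
    ∃ C : ℝ≥0, 0 < C ∧ ∀ f ∈ LocalHardy.finSpace w p q s,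
      LocalHardy.hardyNorm w p N f ≤ C * LocalHardy.finNorm w p q s f ∧
      LocalHardy.finNorm w p q s f ≤ C * LocalHardy.hardyNorm w p N f := by
  have h : LocalHardy.Admissible w p q := ⟨hw, hn, hp0, hp1, hq⟩
  obtain ⟨C₁, hC₁⟩ := h.exists_hardyNorm_le hs hN
  obtain ⟨C₂, hC₂⟩ := h.exists_finNorm_le s N
  have hlower : ∀ f ∈ LocalHardy.finSpace w p q s,
      LocalHardy.finNorm w p q s f ≤ C₂ * LocalHardy.hardyNorm w p N f := by
    intro f hf
    obtain ⟨g, hg, rfl⟩ := h.exists_isTame hf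
    obtain ⟨S, hS, h1, h2⟩ := hg.exists_boundedOn h s N
    exact hC₂ g S hg.1 hg.2.ne hS h1 h2
  have hfin : ∀ f ∈ LocalHardy.finSpace w p q s, LocalHardy.finNorm w p q s f < ∞ := by
    intro f hf
    obtain ⟨g, hg, rfl⟩ := h.exists_isTame hf
    exact hg.finNorm_lt_top h s
  have hzero : ∀ f ∈ LocalHardy.finSpace w p q s, LocalHardy.hardyNorm w p N f = 0 → f = 0 := by
    intro f hf h0
    obtain ⟨g, hg, rfl⟩ := h.exists_isTame hf
    exact hg.ofFun_eq_zero h h0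
  have hzero' : ∀ f, LocalHardy.finNorm w p q s f = 0 → LocalHardy.hardyNorm w p N f = 0 := by
    intro f h0
    have := hC₁ f
    rwa [h0, mul_zero, nonpos_iff_eq_zero] at this
  have hfin0 := h.finNorm_zero s
  refine ⟨⟨hfin, fun f hf => ⟨fun h0 => hzero f hf (hzero' f h0), ?_⟩,
    fun c f _ => h.finNorm_smul s c f, ⟨2 ^ (1 / p), LocalHardy.one_le_two_rpow hp0,
      fun f _ g _ => LocalHardy.le_mul_add_of_rpow_le hp0 (h.finNorm_add_rpow s f g)⟩⟩,
    ⟨fun f hf => (hC₁ f).trans_lt (ENNReal.mul_lt_top ENNReal.coe_lt_top (hfin f hf)),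
      fun f hf => ⟨hzero f hf, ?_⟩, fun c f _ => LocalHardy.hardyNorm_smul hp0 N c f,
      ⟨2 ^ (1 / p), LocalHardy.one_le_two_rpow hp0, fun f hf g _ =>
        LocalHardy.le_mul_add_of_rpow_le hp0 ?_⟩⟩,
    ⟨C₁ + C₂ + 1, by positivity, fun f hf => ⟨(hC₁ f).trans ?_, (hlower f hf).trans ?_⟩⟩⟩
  · rintro rfl; exact hfin0
  · rintro rfl; exact hzero' 0 hfin0
  -- Members of the finite space are functions, so their maximal functions are measurable, as the
  -- triangle inequality requires.
  · obtain ⟨a, ha, rfl⟩ := h.exists_isTame hf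
    exact LocalHardy.hardyNorm_add_rpow hp0 hp1 N
      (LocalHardy.measurable_grandMax (h.locallyIntegrable ha.1 ha.2) N)
  · refine mul_le_mul_left (ENNReal.coe_le_coe.mpr ?_) _
    rw [add_assoc]; exact le_self_add
  · refine mul_le_mul_left (ENNReal.coe_le_coe.mpr ?_) _
    rw [add_right_comm]; exact le_add_self
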